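/- For a small category $\mathcal{C}$, a left (right) $\mathcal{C}$-module is a covariant functor from $\mathcal{C}$ (from $\mathcal{C}^{op}$) to abelian groups; $P_x^{\mathcal{C}}=\mathbb{Z}[\mathrm{Hom}_{\mathcal{C}}(x,-)]$ are the standard projectives and $\underline{\mathbb{Z}}$ is the constant module. The tensor product $F\otimes_{\mathcal{C}}G$ of a right module $F$ and a left module $G$ is the quotient of $\bigoplus_x F(x)\otimes G(x)$ by the relations $F(f)a\otimes b=a\otimes G(f)b$, and $\mathrm{Tor}^{\mathcal{C}}_*$ denotes its left derived functors (zero in negative degrees). A left module is of type $FP$ if it has a finite resolution by projective modules each of which is a quotient of a finite sum of standard projectives. For $n\ge 0$, the category $\mathcal{C}$ is a duality category of dimension $n$ with dualizing functor $D$ if $\underline{\mathbb{Z}}$ is of type $FP$ and, for $D$ the right module $D(x)=\mathrm{Ext}^n_{\mathcal{C}}(\underline{\mathbb{Z}},P_x^{\mathcal{C}})$, there are natural isomorphisms of functors of left $\mathcal{C}$-modules $$\mathrm{Ext}^i_{\mathcal{C}}(\underline{\mathbb{Z}},-)\cong\mathrm{Tor}^{\mathcal{C}}_{n-i}(D,-)\qquad(i\ge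 0).$$ A duality category is a duality category of some dimension $n$. **Proposition.** Let $\varphi:\mathcal{C}\to\mathcal{D}$ be a functor between two small categories. For an object $d$ of $\mathcal{D}$ let $\varphi|d$ be the category of pairs $(a,\ \varphi(a)\to d)$, let $d|\varphi$ be the category of pairs $(a,\ d\to\varphi(a))$, with the evident morphisms, and let $j:d|\varphi\to\mathcal{C}$ be the forgetful functor $(a,\ d\to\varphi(a))\mapsto a$. Assume that $\mathcal{C}$ is a duality category of dimension $n$ with dualizing functor $D$, and that for every object $d$ of $\mathcal{D}$ the category $\varphi|d$ is contractible, i.e. the geometric realization of its nerve is a contractible space. If for every object $d$ of $\mathcal{D}$ $$\mathrm{Tor}^{d|\varphi}_{n-i}(\mathrm{Res}_j D,\underline{\mathbb{Z}})=0\quad\text{for all } i\ne n,\ i\ge 0,$$ where $\mathrm{Res}_jD=D\circ j^{op}$, then $\mathcal{D}$ is a duality category. -/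

import Mathlib

universe u

open CategoryTheory CategoryTheory.Limits Opposite
open scoped TensorProduct DirectSum

namespace CatDuality

noncomputable section

section Modules

variable (C : Type u) [SmallCategory C]

/-- Left `C`-modules: covariant functors from the small category `C` to abelian groups.
Right `C`-modules are left modules over `Cᵒᵖ`. -/
abbrev LMod : Type (u + 1) := C ⥤ AddCommGrpCat.{u}

/-- Right `C`-modules. -/
abbrev RMod : Type (u + 1) := Cᵒᵖ ⥤ AddCommGrpCat.{u}

/-- The bifunctor `(x, y) ↦ ℤ[Hom(x, y)]`, as the functor sending `x` to the standard projective
`P_x = ℤ[Hom(x, -)]`. -/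
def stdProj : Cᵒᵖ ⥤ LMod C :=
  coyoneda ⋙ (Functor.whiskeringRight C (Type u) AddCommGrpCat.{u}).obj AddCommGrpCat.free

/-- The constant module `ℤ`. -/
def constZ : LMod C := (Functor.const C).obj (AddCommGrpCat.of (ULift.{u} ℤ))

end Modules

section EnoughProjectives

variable {C : Type u} [SmallCategory C]

/-- The Yoneda lemma for standard projectives. -/
def stdProjEquiv (x : C) (F : LMod C) : ((stdProj C).obj (op x) ⟶ F) ≃ F.obj x :=
  ((AddCommGrpCat.adj.whiskerRight C).homEquiv (coyoneda.obj (op x)) F).trans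
    (coyonedaEquiv (F := F ⋙ forget AddCommGrpCat.{u}))

theorem stdProjEquiv_comp (x : C) {F G : LMod C} (p : (stdProj C).obj (op x) ⟶ F) (g : F ⟶ G) :
    stdProjEquiv x G (p ≫ g) = g.app x (stdProjEquiv x F p) := by
  exact congrArg (coyonedaEquiv (F := G ⋙ forget AddCommGrpCat.{u}))
    ((AddCommGrpCat.adj.whiskerRight C).homEquiv_naturality_right
      (X := coyoneda.obj (op x)) p g)

instance stdProj_projective (x : C) : Projective ((stdProj C).obj (op x)) where
  factors {E X} f e he := by
    have h : Function.Surjective (e.app x) := by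
      rw [← AddCommGrpCat.epi_iff_surjective]
      infer_instance
    obtain ⟨a, ha⟩ := h (stdProjEquiv x X f)
    refine ⟨(stdProjEquiv x E).symm a, (stdProjEquiv x X).injective ?_⟩
    rw [stdProjEquiv_comp, Equiv.apply_symm_apply, ha]

instance enoughProjectives : EnoughProjectives (LMod C) where
  presentation F := by
    let P : (Σ x : C, F.obj x) → LMod C := fun s => (stdProj C).obj (op s.1)
    let π : ∐ P ⟶ F := Sigma.desc fun s => (stdProjEquiv s.1 F).symm s.2
    have hπ : Epi π := by
      rw [NatTrans.epi_iff_epi_app]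
      intro x
      rw [AddCommGrpCat.epi_iff_surjective]
      intro a
      refine ⟨stdProjEquiv x _ (Sigma.ι P ⟨x, a⟩), ?_⟩
      rw [← stdProjEquiv_comp, Sigma.ι_desc, Equiv.apply_symm_apply]
    exact ⟨{ p := ∐ P, f := π }⟩

instance hasExt : HasExt.{u} (LMod C) := hasExt_of_enoughProjectives.{u} (LMod C)

end EnoughProjectives

section Tor

variable {C : Type u} [SmallCategory C]

open Classical in
/-- The relations `F(f) a ⊗ b = a ⊗ G(f) b` defining the tensor product over `C`. -/
def tensorRel (F : RMod C) (G : LMod C) : AddSubgroup (⨁ x : C, F.obj (op x) ⊗[ℤ] G.obj x) :=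
  AddSubgroup.closure
    {z | ∃ (x y : C) (f : x ⟶ y) (a : F.obj (op y)) (b : G.obj x),
      z = DirectSum.of (fun x : C => F.obj (op x) ⊗[ℤ] G.obj x) x (F.map f.op a ⊗ₜ b) -
        DirectSum.of (fun x : C => F.obj (op x) ⊗[ℤ] G.obj x) y (a ⊗ₜ G.map f b)}

/-- The map `⨁ₓ F(x) ⊗ G(x) → ⨁ₓ F(x) ⊗ G'(x)` induced by `g : G ⟶ G'`. -/
def tensorPre (F : RMod C) {G G' : LMod C} (g : G ⟶ G') :
    (⨁ x : C, F.obj (op x) ⊗[ℤ] G.obj x) →+ (⨁ x : C, F.obj (op x) ⊗[ℤ] G'.obj x) :=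
  DirectSum.map fun x => (LinearMap.lTensor (F.obj (op x)) (g.app x).hom.toIntLinearMap).toAddMonoidHom

theorem tensorRel_le (F : RMod C) {G G' : LMod C} (g : G ⟶ G') :
    tensorRel F G ≤ (tensorRel F G').comap (tensorPre F g) := by
  classical
  rw [tensorRel, AddSubgroup.closure_le]
  rintro _ ⟨x, y, f, a, b, rfl⟩
  refine AddSubgroup.subset_closure ⟨x, y, f, a, g.app x b, ?_⟩
  have h : g.app y (G.map f b) = G'.map f (g.app x b) := by
    rw [← ConcreteCategory.comp_apply, ← ConcreteCategory.comp_apply, g.naturality]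
  rw [map_sub, tensorPre, DirectSum.map_of, DirectSum.map_of, ← h]
  rfl

/-- The functor `F ⊗_C - `, for a right module `F`: on objects it is the quotient of
`⨁ₓ F(x) ⊗ G(x)` by the relations `F(f) a ⊗ b = a ⊗ G(f) b`. -/
def tensorFunctor (F : RMod C) : LMod C ⥤ AddCommGrpCat.{u} where
  obj G := AddCommGrpCat.of ((⨁ x : C, F.obj (op x) ⊗[ℤ] G.obj x) ⧸ tensorRel F G)
  map g := AddCommGrpCat.ofHom (QuotientAddGroup.map _ _ (tensorPre F g) (tensorRel_le F g))
  map_id G := by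
    classical
    refine AddCommGrpCat.hom_ext (QuotientAddGroup.addMonoidHom_ext _ (DirectSum.addHom_ext' ?_))
    intro x
    ext z
    induction z using TensorProduct.induction_on with
    | zero => simp
    | add a b ha hb => rw [map_add, map_add, ha, hb]
    | tmul a b => simp [tensorPre, DirectSum.map_of]
  map_comp g g' := by
    classical
    refine AddCommGrpCat.hom_ext (QuotientAddGroup.addMonoidHom_ext _ (DirectSum.addHom_ext' ?_))
    intro x
    ext z
    induction z using TensorProduct.induction_on with
    | zero => simp
    | add a b ha hb => rw [map_add, map_add, ha, hb]
    | tmul a b => simp [tensorPre, DirectSum.map_of]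

theorem tensorPre_add (F : RMod C) {G G' : LMod C} (g g' : G ⟶ G') :
    tensorPre F (g + g') = tensorPre F g + tensorPre F g' := by
  classical
  refine DirectSum.addHom_ext' fun x => DFunLike.ext _ _ fun z => ?_
  induction z using TensorProduct.induction_on with
  | zero => simp
  | add a b ha hb => rw [map_add, map_add, ha, hb]
  | tmul a b => simp [tensorPre, DirectSum.map_of, TensorProduct.tmul_add]

instance tensorFunctor_additive (F : RMod C) : (tensorFunctor F).Additive where
  map_add {G G' g g'} := by
    refine AddCommGrpCat.hom_ext (QuotientAddGroup.addMonoidHom_ext _ ?_)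
    refine DFunLike.ext _ _ fun z => ?_
    change QuotientAddGroup.mk' (tensorRel F G') (tensorPre F (g + g') z) =
      QuotientAddGroup.mk' (tensorRel F G') (tensorPre F g z) +
        QuotientAddGroup.mk' (tensorRel F G') (tensorPre F g' z)
    rw [tensorPre_add, AddMonoidHom.add_apply, map_add]

/-- `Tor_m^C(F, -)` for a right module `F`: the `m`-th left derived functor of `F ⊗_C -`, which is
zero for negative `m`. -/
def Tor (F : RMod C) : ℤ → LMod C ⥤ AddCommGrpCat.{u}
  | Int.ofNat m => (tensorFunctor F).leftDerived m
  | Int.negSucc _ => (Functor.const (LMod C)).obj (AddCommGrpCat.of PUnit.{u + 1})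

end Tor

section Duality

variable {C : Type u} [SmallCategory C]

/-- A module is of finite type if it is a quotient of a finite sum of standard projectives. -/
def IsFiniteType (F : LMod C) : Prop :=
  ∃ (k : ℕ) (x : Fin k → C) (p : (∐ fun j => (stdProj C).obj (op (x j))) ⟶ F), Epi p

/-- A module is of type `FP` if it has a finite resolution by projectives of finite type. -/
def IsTypeFP (F : LMod C) : Prop :=
  ∃ P : ProjectiveResolution F, (∀ m, IsFiniteType (P.complex.X m)) ∧
    ∃ N : ℕ, ∀ m, N < m → IsZero (P.complex.X m)

/-- The right module `Dⁿ(F)`, that is `x ↦ Extⁿ(F, P_x)`. -/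
def dualModule (F : LMod C) (n : ℕ) : RMod C :=
  stdProj C ⋙ (Abelian.extFunctor n).obj (op F)

/-- `F` is a duality functor (of degree `n`): it is of type `FP`, and there are natural isomorphisms
`Extⁱ(F, -) ≅ Tor_{n-i}(Dⁿ(F), -)`. The right module `Dⁿ(F)` is then its dualizing functor. -/
def IsDualityFunctor (F : LMod C) (n : ℕ) : Prop :=
  IsTypeFP F ∧ ∀ i : ℕ,
    Nonempty ((Abelian.extFunctor i).obj (op F) ≅ Tor (dualModule F n) ((n : ℤ) - (i : ℤ)))

variable (C)

/-- `C` is a duality category of dimension `n`: the constant module `ℤ` is a duality functor of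
degree `n`. -/
def IsDualityCategoryOfDim (n : ℕ) : Prop := IsDualityFunctor (constZ C) n

/-- `C` is a duality category. -/
def IsDualityCategory : Prop := ∃ n : ℕ, IsDualityCategoryOfDim C n

/-- The dualizing functor of a duality category of dimension `n`. -/
abbrev dualizingFunctor (n : ℕ) : RMod C := dualModule (constZ C) n

/-- A small category is contractible if the geometric realization of its nerve is. -/
def IsContractible : Prop := ContractibleSpace (SSet.toTop.obj (nerve C))

end Duality

end

end CatDuality

namespace CatDuality

noncomputable section

/-! ### Simplicial chains, reduced cycles and boundaries -/

section Chains

/-! The proof rests on a criterion, a transfer along φ, and a topological input.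

Criterion (`isDualityFunctor_of_ext_eq_zero`): a module F of type FP with Extⁱ(F, P_y) = 0 for all y
and all i ≠ n is a duality functor of degree n. Because F has a resolution of finite type, every Ext
class with values in a free module already lives on a finite part of it, so Extⁱ(F, -) vanishes on
free modules for i ≠ n. Shifting dimension up past the length of the resolution gives Extⁱ(F, -) = 0
for i > n. Hence Extⁿ(F, -) is right exact, and an Eilenberg–Watts argument (`isIso_coendMap`)
identifies it with Dⁿ(F) ⊗ -. For i < n, both Extⁱ(F, G) and Tor_{n-i}(Dⁿ(F), G) are the kernel of
Extⁿ(F, Ωⁿ⁻ⁱG) → Extⁿ(F, L), where L is the free cover of Ωⁿ⁻ⁱ⁻¹G. Working with functorial syzygies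
makes this natural.

Transfer: induction along φ carries the bar resolution of ℤ over C to the complex d ↦ ℤ[N(φ|d)]
(`indBar`), which resolves ℤ over D because the φ|d are acyclic. Any projective resolution is
homotopy equivalent to the bar resolution, so all of them induce to resolutions (`indResolution`).
Thus type FP passes to D, and by adjunction the vanishing of Extⁱ_C(ℤ, φ*G) implies that of
Extⁱ_D(ℤ, G). For G = P_d, the module φ*P_d is induced from the constant module along d|φ → C. That
induction is exact, preserves projectives and satisfies a projection formula, so duality for C turns
the Tor hypothesis into Extⁱ_C(ℤ, φ*P_d) = 0 for i ≠ n.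

Topological input (`mem_bdry_of_contractibleSpace`): if |X| is contractible, reduced cycles of X are
boundaries. Let S be the set of maps from the nerve of (0,1] to X, two maps being near when they
agree off a set of parameters of small measure. A simplex σ and a point x of Δᵐ give the element
"take the vertex of σ at the t-quantile of x" of S. This is continuous in x and defines X → Sing S,
which factors through Sing |X| and so kills reduced cycles. Conversely, suppose that z bounds in
Sing S. By uniform continuity, close points of a simplex of the bounding chain go to maps agreeing
off a small set, so a finite set of close points can be evaluated at a parameter avoiding all the
bad sets. Nerves of posets of such finite sets serve as acyclic models in place of subdivision. They
push the bounding chain back to X, and a comparison of models shows that z itself returns to a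
homologous cycle. -/

/-- The `k`-simplices of a simplicial set. -/
abbrev Sx (X : SSet.{u}) (k : ℕ) : Type u := X.obj (op (SimplexCategory.mk k))

/-- The simplicial chains of a simplicial set. -/
abbrev Ch (X : SSet.{u}) (k : ℕ) : Type u := FreeAbelianGroup (Sx X k)

/-- The simplicial abelian group of chains. -/
abbrev chSimp : SSet.{u} ⥤ SimplicialObject AddCommGrpCat.{u} :=
  (SimplicialObject.whiskering _ _).obj AddCommGrpCat.free

/-- The boundary of a simplicial chain. -/
def bd (X : SSet.{u}) (k : ℕ) : Ch X (k + 1) →+ Ch X k :=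
  FreeAbelianGroup.lift fun x => ∑ i : Fin (k + 2), (-1 : ℤ) ^ (i : ℕ) • .of (X.δ i x)

/-- The augmentation of simplicial chains. -/
def aug (X : SSet.{u}) : Ch X 0 →+ ℤ := FreeAbelianGroup.lift fun _ => 1

/-- The map on chains induced by a map of simplicial sets. -/
def chMap {X Y : SSet.{u}} (f : X ⟶ Y) (k : ℕ) : Ch X k →+ Ch Y k :=
  FreeAbelianGroup.map (f.app (op (.mk k)))

@[simp]
lemma bd_of (X : SSet.{u}) (k : ℕ) (x : Sx X (k + 1)) :
    bd X k (.of x) = ∑ i : Fin (k + 2), (-1 : ℤ) ^ (i : ℕ) • .of (X.δ i x) := by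
  simp [bd]

@[simp]
lemma aug_of (X : SSet.{u}) (x : Sx X 0) : aug X (.of x) = 1 := by simp [aug]

@[simp]
lemma chMap_of {X Y : SSet.{u}} (f : X ⟶ Y) (k : ℕ) (x : Sx X k) :
    chMap f k (.of x) = .of (f.app (op (.mk k)) x) := by simp [chMap]

lemma chMap_comp {X Y Z : SSet.{u}} (f : X ⟶ Y) (g : Y ⟶ Z) (k : ℕ) (z : Ch X k) :
    chMap (f ≫ g) k z = chMap g k (chMap f k z) := by
  induction z using FreeAbelianGroup.induction_on with
  | zero => simp
  | of x => simp
  | neg x h => simp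
  | add a b ha hb => simp [ha, hb]

lemma chMap_id {X : SSet.{u}} (k : ℕ) (z : Ch X k) : chMap (𝟙 X) k z = z := by
  induction z using FreeAbelianGroup.induction_on with
  | zero => simp
  | of x => simp
  | neg x h => simp
  | add a b ha hb => simp [ha, hb]

lemma hom_sum_zsmul_apply {A B : AddCommGrpCat.{u}} {ι : Type*} (s : Finset ι) (n : ι → ℤ)
    (f : ι → (A ⟶ B)) (a : A) :
    (∑ i ∈ s, n i • f i).hom a = ∑ i ∈ s, n i • (f i).hom a := by
  change (AddMonoidHom.eval a) (AddCommGrpCat.homAddEquiv (∑ i ∈ s, n i • f i)) = _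
  rw [map_sum, map_sum]
  refine Finset.sum_congr rfl fun i _ => ?_
  rw [map_zsmul, map_zsmul]
  rfl

lemma bd_eq (X : SSet.{u}) (k : ℕ) :
    AlgebraicTopology.AlternatingFaceMapComplex.objD (chSimp.obj X) k =
      AddCommGrpCat.ofHom (bd X k) := by
  refine AddCommGrpCat.hom_ext (FreeAbelianGroup.lift_ext _ _ fun x => ?_)
  refine (hom_sum_zsmul_apply _ _ _ _).trans (Eq.trans ?_ (bd_of X k x).symm)
  refine Finset.sum_congr rfl fun i _ => ?_
  exact congrArg _ (FreeAbelianGroup.map_of_apply (f := X.δ i) x)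

lemma bd_bd (X : SSet.{u}) (k : ℕ) (z : Ch X (k + 2)) : bd X k (bd X (k + 1) z) = 0 := by
  have h := AlgebraicTopology.AlternatingFaceMapComplex.d_squared (chSimp.obj X) k
  rw [bd_eq, bd_eq] at h
  exact ConcreteCategory.congr_hom h z

lemma bd_chMap {X Y : SSet.{u}} (f : X ⟶ Y) (k : ℕ) (z : Ch X (k + 1)) :
    bd Y k (chMap f (k + 1) z) = chMap f k (bd X k z) := by
  induction z using FreeAbelianGroup.induction_on with
  | zero => simp
  | of x => simp [SSet.δ_naturality_apply]
  | neg x h => simp only [map_neg, h]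
  | add a b ha hb => simp only [map_add, ha, hb]

lemma aug_chMap {X Y : SSet.{u}} (f : X ⟶ Y) (z : Ch X 0) : aug Y (chMap f 0 z) = aug X z := by
  induction z using FreeAbelianGroup.induction_on with
  | zero => simp
  | of x => simp
  | neg x h => simp
  | add a b ha hb => simp [ha, hb]

lemma aug_bd (X : SSet.{u}) (z : Ch X 1) : aug X (bd X 0 z) = 0 := by
  induction z using FreeAbelianGroup.induction_on with
  | zero => simp
  | of x => simp [Fin.sum_univ_two]
  | neg x h => simp
  | add a b ha hb => simp [ha, hb]

/-- Cycles of the augmented chain complex. -/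
def redCycle (X : SSet.{u}) : (k : ℕ) → AddSubgroup (Ch X k)
  | 0 => (aug X).ker
  | k + 1 => (bd X k).ker

/-- Boundaries of the chain complex. -/
def bdry (X : SSet.{u}) (k : ℕ) : AddSubgroup (Ch X k) := (bd X k).range

lemma mem_redCycle_zero {X : SSet.{u}} {z : Ch X 0} : z ∈ redCycle X 0 ↔ aug X z = 0 := Iff.rfl

lemma mem_redCycle_succ {X : SSet.{u}} {k : ℕ} {z : Ch X (k + 1)} :
    z ∈ redCycle X (k + 1) ↔ bd X k z = 0 := Iff.rfl

lemma chMap_mem_redCycle {X Y : SSet.{u}} (f : X ⟶ Y) :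
    ∀ (k : ℕ) {z : Ch X k}, z ∈ redCycle X k → chMap f k z ∈ redCycle Y k
  | 0, z, hz => by rw [mem_redCycle_zero, aug_chMap]; exact hz
  | k + 1, z, hz => by
    rw [mem_redCycle_succ, bd_chMap, mem_redCycle_succ.1 hz, map_zero]

lemma chMap_mem_bdry {X Y : SSet.{u}} (f : X ⟶ Y) (k : ℕ) {z : Ch X k} (hz : z ∈ bdry X k) :
    chMap f k z ∈ bdry Y k := by
  obtain ⟨w, rfl⟩ := hz
  exact ⟨chMap f (k + 1) w, bd_chMap f k w⟩

/-- A simplicial set is acyclic if it is nonempty and its reduced homology vanishes. -/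
def IsAcyclic (X : SSet.{u}) : Prop :=
  Nonempty (Sx X 0) ∧ ∀ k, ∀ z ∈ redCycle X k, z ∈ bdry X k

/-- The chain homotopy gives f - g = ∂h + h∂, and h∂ vanishes on cycles; in degree 0 that term is
absent. -/
lemma homotopy_sub_mem_bdry {X Y : SSet.{u}} {f g : X ⟶ Y} (H : SSet.Homotopy f g) (k : ℕ)
    {z : Ch X k} (hz : z ∈ redCycle X k) : chMap f k z - chMap g k z ∈ bdry Y k := by
  let h := (H.toSimplicialObjectHomotopy.whiskerRight AddCommGrpCat.free.{u}).toChainHomotopy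
  have hbd : ∀ (W : SSet.{u}) (n : ℕ),
      ((AlgebraicTopology.alternatingFaceMapComplex _).obj (chSimp.obj W)).d (n + 1) n =
        AddCommGrpCat.ofHom (bd W n) := fun W n =>
    (AlgebraicTopology.alternatingFaceMapComplex_obj_d _ _).trans (bd_eq W n)
  cases k with
  | zero =>
    have h1 := h.comm 0
    rw [Homotopy.dNext_zero_chainComplex, Homotopy.prevD_chainComplex, zero_add] at h1
    refine ⟨(h.hom 0 1).hom z, ?_⟩
    rw [eq_sub_iff_add_eq]
    refine Eq.trans ?_ (ConcreteCategory.congr_hom h1 z).symm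
    exact congrArg (fun t : Ch Y 0 => t + chMap g 0 z)
      (ConcreteCategory.congr_hom (hbd Y 0).symm ((h.hom 0 1).hom z))
  | succ k =>
    have h1 := h.comm (k + 1)
    rw [Homotopy.dNext_succ_chainComplex, Homotopy.prevD_chainComplex] at h1
    refine ⟨(h.hom (k + 1) (k + 2)).hom z, ?_⟩
    rw [eq_sub_iff_add_eq]
    refine Eq.trans ?_ (ConcreteCategory.congr_hom h1 z).symm
    have h0 := ConcreteCategory.congr_hom (hbd X k) z
    have h2 : (h.hom k (k + 1)).hom ((AddCommGrpCat.ofHom (bd X k)).hom z) = 0 :=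
      (congrArg (h.hom k (k + 1)).hom (mem_redCycle_succ.1 hz)).trans (map_zero _)
    refine congrArg (fun t : Ch Y (k + 1) => t + chMap g (k + 1) z) ?_
    refine Eq.trans ?_ (congrArg (fun t : Ch Y (k + 1) => t + _)
      ((congrArg (h.hom k (k + 1)).hom h0).trans h2)).symm
    exact (ConcreteCategory.congr_hom (hbd Y (k + 1)).symm ((h.hom (k + 1) (k + 2)).hom z)).trans
      (zero_add _).symm

/-- A constant map sees only the coefficient sum of a chain, as a multiple of the degenerate simplex
on `y`. In positive degree the boundary of that simplex is the next lower one if the degree is even,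
and 0 if it is odd. So in odd degree the simplex is itself a boundary, and in even degree a reduced
cycle has coefficient sum 0. -/
lemma chMap_const_mem_bdry (X : SSet.{u}) {Y : SSet.{u}} (y : Sx Y 0) (k : ℕ)
    {z : Ch X k} (hz : z ∈ redCycle X k) : chMap (SSet.const y) k z ∈ bdry Y k := by
  let c : (j : ℕ) → Ch Y j := fun j => .of ((SSet.const (X := Y) y).app (op (.mk j))
    (Y.map (SimplexCategory.const (.mk j) (.mk 0) 0).op y))
  let s : (j : ℕ) → Ch X j →+ ℤ := fun j => FreeAbelianGroup.lift fun _ => 1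
  have hc : ∀ (j : ℕ) (w : Ch X j), chMap (SSet.const y) j w = s j w • c j := by
    intro j w
    induction w using FreeAbelianGroup.induction_on with
    | zero => simp
    | of x => simp [s, c]
    | neg x h => simp only [map_neg, h, neg_smul]
    | add a b ha hb => simp only [map_add, ha, hb, add_smul]
  have hsum : ∀ j : ℕ, ∑ i : Fin (j + 1), (-1 : ℤ) ^ (i : ℕ) = if Even j then 1 else 0 := by
    intro j
    rw [Fin.sum_univ_eq_sum_range (fun i => (-1 : ℤ) ^ i), neg_one_geom_sum]
    by_cases h : Even j <;> simp [Nat.even_add_one, h]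
  have hbd : ∀ j, bd Y j (c (j + 1)) = (if Even (j + 1) then (1 : ℤ) else 0) • c j := by
    intro j
    have : ∀ i : Fin (j + 2), Y.δ i ((SSet.const (X := Y) y).app (op (.mk (j + 1)))
        (Y.map (SimplexCategory.const (.mk (j + 1)) (.mk 0) 0).op y)) = (SSet.const (X := Y) y).app (op (.mk j))
        (Y.map (SimplexCategory.const (.mk j) (.mk 0) 0).op y) := by
      intro i
      rw [← SSet.δ_naturality_apply]
      simp
    simp only [c, bd_of, this]
    rw [← Finset.sum_smul, hsum]
  rw [hc]
  rcases Nat.even_or_odd k with hk | hk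
  · suffices s k z = 0 by rw [this, zero_smul]; exact zero_mem _
    cases k with
    | zero => exact hz
    | succ k =>
      have h1 := mem_redCycle_succ.1 (chMap_mem_redCycle (SSet.const y) _ hz)
      rw [hc, map_zsmul, hbd, if_pos hk, one_smul] at h1
      have h2 := congrArg (FreeAbelianGroup.lift (fun _ : Sx Y k => (1 : ℤ))) h1
      simpa [c] using h2
  · have := hbd k
    rw [if_pos (by exact hk.add_one), one_smul] at this
    rw [← this, ← map_zsmul]
    exact ⟨_, rfl⟩

end Chains

/-! ### Natural transformations as homotopies of nerves -/

section NerveHomotopy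

open MonoidalCategory

variable {E E' : Type u} [Category.{u} E] [Category.{u} E']

/-- A natural transformation induces a homotopy between maps of nerves. -/
def nerveHomotopy {F G : E ⥤ E'} (η : F ⟶ G) : SSet.Homotopy (nerveMap F) (nerveMap G) where
  h :=
    { app := fun n => ↾fun p => (Functor.prod' (p.1 : ComposableArrows E _)
        (SSet.stdSimplex.objEquiv p.2).toOrderHom.monotone.functor) ⋙
          Functor.uncurry.obj (ComposableArrows.mk₁ η).flip
      naturality := fun _ _ _ => rfl }
  h₀ := by
    ext n x
    refine CategoryTheory.Functor.ext (fun i => rfl) fun i j f => ?_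
    change F.map (x.map f) ≫ ((ComposableArrows.mk₁ η).map (𝟙 0)).app _ =
      𝟙 _ ≫ F.map (x.map f) ≫ 𝟙 _
    rw [CategoryTheory.Functor.map_id, Category.id_comp]
    rfl
  h₁ := by
    ext n x
    refine CategoryTheory.Functor.ext (fun i => rfl) fun i j f => ?_
    change G.map (x.map f) ≫ ((ComposableArrows.mk₁ η).map (𝟙 1)).app _ =
      𝟙 _ ≫ G.map (x.map f) ≫ 𝟙 _
    rw [CategoryTheory.Functor.map_id, Category.id_comp]
    rfl
  rel := by ext _ ⟨⟨_, ⟨⟩⟩, _⟩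

end NerveHomotopy

end

end CatDuality

namespace CatDuality

noncomputable section

/-! ### Acyclic models: chains on cosimplicial simplicial sets -/

section Models

/-- The alternating sum of the coface maps on the chains of a cosimplicial simplicial set. -/
def cobd (E : SimplexCategory ⥤ SSet.{u}) (m k : ℕ) :
    Ch (E.obj (.mk m)) k →+ Ch (E.obj (.mk (m + 1))) k :=
  ∑ i : Fin (m + 2), (-1 : ℤ) ^ (i : ℕ) • chMap (E.map (SimplexCategory.δ i)) k

lemma cobd_apply (E : SimplexCategory ⥤ SSet.{u}) (m k : ℕ) (z : Ch (E.obj (.mk m)) k) :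
    cobd E m k z = ∑ i : Fin (m + 2), (-1 : ℤ) ^ (i : ℕ) •
      chMap (E.map (SimplexCategory.δ i)) k z := by
  simp [cobd, AddMonoidHom.finsetSum_apply]

lemma cobd_cobd (E : SimplexCategory ⥤ SSet.{u}) (m k : ℕ) (z : Ch (E.obj (.mk m)) k) :
    cobd E (m + 1) k (cobd E m k z) = 0 := by
  let F : CosimplicialObject AddCommGrpCat.{u} :=
    E ⋙ (evaluation _ _).obj (op (SimplexCategory.mk k)) ⋙ AddCommGrpCat.free
  have h0 : ∀ n, AlgebraicTopology.AlternatingCofaceMapComplex.objD F n =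
      AddCommGrpCat.ofHom (cobd E n k) := fun n => by
    refine AddCommGrpCat.hom_ext (DFunLike.ext _ _ fun w => ?_)
    refine (hom_sum_zsmul_apply _ _ _ _).trans (Eq.trans ?_ (cobd_apply E n k w).symm)
    rfl
  have h := AlgebraicTopology.AlternatingCofaceMapComplex.d_squared F m
  rw [h0, h0] at h
  exact ConcreteCategory.congr_hom h z

lemma bd_cobd (E : SimplexCategory ⥤ SSet.{u}) (m k : ℕ) (z : Ch (E.obj (.mk m)) (k + 1)) :
    bd _ k (cobd E m (k + 1) z) = cobd E m k (bd _ k z) := by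
  simp only [cobd_apply, map_sum, map_zsmul, bd_chMap]

lemma chMap_cobd {E E' : SimplexCategory ⥤ SSet.{u}} (α : E ⟶ E') (m k : ℕ)
    (z : Ch (E.obj (.mk m)) k) :
    chMap (α.app (.mk (m + 1))) k (cobd E m k z) = cobd E' m k (chMap (α.app (.mk m)) k z) := by
  simp only [cobd_apply, map_sum, map_zsmul, ← chMap_comp, α.naturality]

/-- A sequence of chains which looks like the fundamental chains of the standard simplices,
up to degree `M`. -/
structure IsModel (E : SimplexCategory ⥤ SSet.{u}) (M : ℕ) (b : ∀ m, Ch (E.obj (.mk m)) m) :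
    Prop where
  aug_zero : aug _ (b 0) = 1
  bd_succ : ∀ m < M, bd _ m (b (m + 1)) = cobd E m m (b m)

/-- A homotopy between two models, up to degree `M`. -/
structure IsModelHtpy (E : SimplexCategory ⥤ SSet.{u}) (M : ℕ) (b b' : ∀ m, Ch (E.obj (.mk m)) m)
    (h : ∀ m, Ch (E.obj (.mk m)) (m + 1)) : Prop where
  bd_zero : bd _ 0 (h 0) = b 0 - b' 0
  bd_succ : ∀ m < M, bd _ (m + 1) (h (m + 1)) = b (m + 1) - b' (m + 1) - cobd E m (m + 1) (h m)

/-- A map which sends reduced cycles to boundaries, up to cosimplicial degree `M`. -/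
def Kills {E E' : SimplexCategory ⥤ SSet.{u}} (α : E ⟶ E') (M : ℕ) : Prop :=
  ∀ m ≤ M, ∀ k, ∀ z ∈ redCycle (E.obj (.mk m)) k, chMap (α.app (.mk m)) k z ∈ bdry _ k

variable {E E' : SimplexCategory ⥤ SSet.{u}}

/-- The image of a sequence of chains. -/
def mapModel (α : E ⟶ E') (b : ∀ m, Ch (E.obj (.mk m)) m) : ∀ m, Ch (E'.obj (.mk m)) m :=
  fun m => chMap (α.app (.mk m)) m (b m)

lemma IsModel.map_of_faces {M : ℕ} {b : ∀ m, Ch (E.obj (.mk m)) m} (hb : IsModel E M b)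
    (α : ∀ m, E.obj (.mk m) ⟶ E'.obj (.mk m))
    (hα : ∀ (m : ℕ) (i : Fin (m + 2)), E.map (SimplexCategory.δ i) ≫ α (m + 1) =
      α m ≫ E'.map (SimplexCategory.δ i)) :
    IsModel E' M fun m => chMap (α m) m (b m) where
  aug_zero := by rw [aug_chMap, hb.aug_zero]
  bd_succ m hm := by
    rw [bd_chMap, hb.bd_succ m hm]
    simp only [cobd_apply, map_sum, map_zsmul, ← chMap_comp, hα]

lemma IsModel.map {M : ℕ} {b : ∀ m, Ch (E.obj (.mk m)) m} (hb : IsModel E M b) (α : E ⟶ E') :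
    IsModel E' M (mapModel α b) :=
  hb.map_of_faces (fun m => α.app (.mk m)) fun _ _ => α.naturality _

/-- This is the obstruction to defining the next chain of the model. In degree 0 its augmentation
vanishes because the two cofaces enter with opposite signs. -/
lemma IsModel.cobd_mem_redCycle {M : ℕ} {b : ∀ m, Ch (E.obj (.mk m)) m} (hb : IsModel E M b)
    (m : ℕ) (hm : m ≤ M) : cobd E m m (b m) ∈ redCycle (E.obj (.mk (m + 1))) m := by
  cases m with
  | zero =>
    rw [mem_redCycle_zero, cobd_apply]
    simp [Fin.sum_univ_two, aug_chMap]
  | succ m => rw [mem_redCycle_succ, bd_cobd, hb.bd_succ m hm, cobd_cobd]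

/-- The obstruction bounds only after applying `α`, so each new degree costs one map of the system.
-/
lemma IsModel.exists_succ {M : ℕ} {b : ∀ m, Ch (E.obj (.mk m)) m} (hb : IsModel E M b)
    (α : E ⟶ E') {N : ℕ} (hα : Kills α N) (hN : M + 1 ≤ N) :
    ∃ b', IsModel E' (M + 1) b' := by
  obtain ⟨c, hc⟩ := hα (M + 1) hN M _ (hb.cobd_mem_redCycle M le_rfl)
  refine ⟨Function.update (mapModel α b) (M + 1) c, ⟨?_, fun m hm => ?_⟩⟩
  · rw [Function.update_of_ne (by omega)]
    exact (hb.map α).aug_zero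
  · rw [Function.update_of_ne (a := m) (by omega)]
    rcases Nat.lt_succ_iff_lt_or_eq.1 hm with h | rfl
    · rw [Function.update_of_ne (by omega)]
      exact (hb.map α).bd_succ m h
    · rw [Function.update_self, hc, chMap_cobd]
      rfl

lemma exists_isModel (E : ℕ → (SimplexCategory ⥤ SSet.{u})) (α : ∀ j, E j ⟶ E (j + 1)) (N : ℕ)
    (hα : ∀ j < N, Kills (α j) N) (x : Sx ((E 0).obj (.mk 0)) 0) :
    ∀ M ≤ N, ∃ b, IsModel (E M) M b
  | 0, _ => by
    classical
    -- The chains of positive degree are irrelevant to a model up to degree 0.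
    exact ⟨Function.update (fun m => 0) 0 (.of x), by simp, fun m hm => by omega⟩
  | M + 1, h => by
    obtain ⟨b, hb⟩ := exists_isModel E α N hα x M (by omega)
    exact hb.exists_succ (α M) (hα M (by omega)) h

/-- The difference of the two models, corrected by the coboundary of the homotopy so far, is a
cycle; again it is filled at the price of one map. -/
lemma IsModelHtpy.exists_succ {M N : ℕ} {b b' : ∀ m, Ch (E.obj (.mk m)) m}
    {h : ∀ m, Ch (E.obj (.mk m)) (m + 1)} (hh : IsModelHtpy E M b b' h) (hb : IsModel E N b)
    (hb' : IsModel E N b') (α : E ⟶ E') (hα : Kills α N) (hM : M + 1 ≤ N) :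
    ∃ h', IsModelHtpy E' (M + 1) (mapModel α b) (mapModel α b') h' := by
  have hcyc : b (M + 1) - b' (M + 1) - cobd E M (M + 1) (h M) ∈
      redCycle (E.obj (.mk (M + 1))) (M + 1) := by
    rw [mem_redCycle_succ, map_sub, map_sub, bd_cobd, hb.bd_succ M hM, hb'.bd_succ M hM]
    cases M with
    | zero => rw [hh.bd_zero, map_sub, sub_self]
    | succ M => rw [hh.bd_succ M (by omega), map_sub, map_sub, cobd_cobd, sub_zero, sub_self]
  obtain ⟨c, hc⟩ := hα (M + 1) hM (M + 1) _ hcyc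
  refine ⟨Function.update (fun m => chMap (α.app (.mk m)) (m + 1) (h m)) (M + 1) c,
    ⟨?_, fun m hm => ?_⟩⟩
  · rw [Function.update_of_ne (by omega), bd_chMap, hh.bd_zero, map_sub]
    rfl
  · rw [Function.update_of_ne (a := m) (by omega)]
    rcases Nat.lt_succ_iff_lt_or_eq.1 hm with hm' | rfl
    · rw [Function.update_of_ne (by omega), bd_chMap, hh.bd_succ m hm', map_sub, map_sub,
        chMap_cobd]
      rfl
    · rw [Function.update_self, hc, map_sub, map_sub, chMap_cobd]
      rfl

lemma exists_isModelHtpy_zero {N : ℕ} {b b' : ∀ m, Ch (E.obj (.mk m)) m} (hb : IsModel E N b)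
    (hb' : IsModel E N b') (α : E ⟶ E') (hα : Kills α N) :
    ∃ h, IsModelHtpy E' 0 (mapModel α b) (mapModel α b') h := by
  classical
  have hcyc : b 0 - b' 0 ∈ redCycle (E.obj (.mk 0)) 0 := by
    rw [mem_redCycle_zero, map_sub, hb.aug_zero, hb'.aug_zero, sub_self]
  obtain ⟨c, hc⟩ := hα 0 (by omega) 0 _ hcyc
  refine ⟨Function.update (fun m => 0) 0 c, ⟨?_, fun m hm => by omega⟩⟩
  rw [Function.update_self, hc, map_sub]
  rfl

lemma mapModel_comp {E'' : SimplexCategory ⥤ SSet.{u}} (α : E ⟶ E') (β : E' ⟶ E'')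
    (b : ∀ m, Ch (E.obj (.mk m)) m) : mapModel (α ≫ β) b = mapModel β (mapModel α b) := by
  funext m
  exact chMap_comp _ _ _ _

/-- Degrees 0 to `M` each use one map of the system, whence the shift by `M + 1`. -/
lemma exists_isModelHtpy (H : ℕ ⥤ (SimplexCategory ⥤ SSet.{u})) (a N : ℕ)
    (hα : ∀ j ≤ N, Kills (H.map (homOfLE (show a + j ≤ a + j + 1 by omega))) N)
    {b b' : ∀ m, Ch ((H.obj a).obj (.mk m)) m}
    (hb : IsModel (H.obj a) N b) (hb' : IsModel (H.obj a) N b') :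
    ∀ M ≤ N, ∃ h, IsModelHtpy (H.obj (a + M + 1)) M
      (mapModel (H.map (homOfLE (show a ≤ a + M + 1 by omega))) b)
      (mapModel (H.map (homOfLE (show a ≤ a + M + 1 by omega))) b') h
  | 0, _ => exists_isModelHtpy_zero hb hb' _ (hα 0 (by omega))
  | M + 1, h => by
    obtain ⟨g, hg⟩ := exists_isModelHtpy H a N hα hb hb' M (by omega)
    have := hg.exists_succ (hb.map _) (hb'.map _) _ (hα (M + 1) h) h
    rwa [← mapModel_comp, ← mapModel_comp, ← Functor.map_comp] at this

/-- A family of maps into `X` indexed by the simplices of `Y`, compatible with faces. -/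
structure FaceFamily (Y : SSet.{u}) (E : SimplexCategory ⥤ SSet.{u}) (X : SSet.{u}) where
  map : ∀ {m : ℕ}, Sx Y m → (E.obj (.mk m) ⟶ X)
  map_δ : ∀ {m : ℕ} (s : Sx Y (m + 1)) (i : Fin (m + 2)),
    map (Y.δ i s) = E.map (SimplexCategory.δ i) ≫ map s

namespace FaceFamily

variable {Y X : SSet.{u}}

/-- Precomposition of a family with a map of cosimplicial simplicial sets. -/
@[simps]
def precomp (ψ : FaceFamily Y E' X) (α : E ⟶ E') : FaceFamily Y E X where
  map s := α.app _ ≫ ψ.map s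
  map_δ s i := by rw [ψ.map_δ, ← Category.assoc, ← Category.assoc, α.naturality]

/-- Restriction of a family along a map of simplicial sets. -/
@[simps]
def restr {Y' : SSet.{u}} (ψ : FaceFamily Y E X) (f : Y' ⟶ Y) : FaceFamily Y' E X where
  map {m} s := ψ.map (f.app (op (.mk m)) s)
  map_δ {m} s i := by rw [← ψ.map_δ, SSet.δ_naturality_apply]

/-- The map on chains obtained from a family of maps and a sequence of chains. -/
def push (ψ : FaceFamily Y E X) {m k : ℕ} (b : Ch (E.obj (.mk m)) k) : Ch Y m →+ Ch X k :=
  FreeAbelianGroup.lift fun s => chMap (ψ.map s) k b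

@[simp]
lemma push_of (ψ : FaceFamily Y E X) {m k : ℕ} (b : Ch (E.obj (.mk m)) k) (s : Sx Y m) :
    ψ.push b (.of s) = chMap (ψ.map s) k b := by simp [push]

lemma push_sub (ψ : FaceFamily Y E X) {m k : ℕ} (b b' : Ch (E.obj (.mk m)) k) (z : Ch Y m) :
    ψ.push (b - b') z = ψ.push b z - ψ.push b' z := by
  induction z using FreeAbelianGroup.induction_on with
  | zero => simp
  | of x => simp
  | neg x h => rw [map_neg, map_neg, map_neg, h]; abel
  | add a b ha hb => rw [map_add, map_add, map_add, ha, hb]; abel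

lemma bd_push (ψ : FaceFamily Y E X) {m k : ℕ} (b : Ch (E.obj (.mk m)) (k + 1)) (z : Ch Y m) :
    bd X k (ψ.push b z) = ψ.push (bd _ k b) z := by
  induction z using FreeAbelianGroup.induction_on with
  | zero => simp
  | of x => simp [bd_chMap]
  | neg x h => simp only [map_neg, h]
  | add a b ha hb => simp only [map_add, ha, hb]

/-- Compatibility with faces trades the cofaces of the model for the boundary of the chain. Hence
models push to chain maps and homotopies of models to chain homotopies. -/
lemma push_cobd (ψ : FaceFamily Y E X) {m k : ℕ} (b : Ch (E.obj (.mk m)) k)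
    (z : Ch Y (m + 1)) : ψ.push (cobd E m k b) z = ψ.push b (bd Y m z) := by
  induction z using FreeAbelianGroup.induction_on with
  | zero => simp
  | of x =>
    rw [push_of, bd_of, cobd_apply, map_sum, map_sum]
    refine Finset.sum_congr rfl fun i _ => ?_
    rw [map_zsmul, map_zsmul, push_of, ψ.map_δ, chMap_comp]
  | neg x h => simp only [map_neg, h]
  | add a b ha hb => simp only [map_add, ha, hb]

lemma precomp_push (ψ : FaceFamily Y E' X) (α : E ⟶ E') {m k : ℕ} (b : Ch (E.obj (.mk m)) k)
    (z : Ch Y m) : (ψ.precomp α).push b z = ψ.push (chMap (α.app _) k b) z := by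
  simp only [push, precomp_map, chMap_comp]

lemma restr_push {Y' : SSet.{u}} (ψ : FaceFamily Y E X) (f : Y' ⟶ Y) {m k : ℕ}
    (b : Ch (E.obj (.mk m)) k) (z : Ch Y' m) :
    (ψ.restr f).push b z = ψ.push b (chMap f m z) := by
  induction z using FreeAbelianGroup.induction_on with
  | zero => simp
  | of x => simp
  | neg x h => simp only [map_neg, h]
  | add a b ha hb => simp only [map_add, ha, hb]

lemma chMap_push_eq {X' : SSet.{u}} {ψ : FaceFamily Y E X} {χ : FaceFamily Y E' X'} {f : X ⟶ X'}
    {m k : ℕ} {α : E.obj (.mk m) ⟶ E'.obj (.mk m)}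
    (h : ∀ s : Sx Y m, ψ.map s ≫ f = α ≫ χ.map s) (b : Ch (E.obj (.mk m)) k) (z : Ch Y m) :
    chMap f k (ψ.push b z) = χ.push (chMap α k b) z := by
  induction z using FreeAbelianGroup.induction_on with
  | zero => simp
  | of x => rw [push_of, push_of, ← chMap_comp, ← chMap_comp, h]
  | neg x h => simp only [map_neg, h]
  | add a b ha hb => simp only [map_add, ha, hb]

lemma push_mem_bdry (ψ : FaceFamily Y E X) {M : ℕ} {b : ∀ m, Ch (E.obj (.mk m)) m}
    (hb : IsModel E M b) {m : ℕ} (hm : m < M) {z : Ch Y m} (hz : z ∈ bdry Y m) :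
    ψ.push (b m) z ∈ bdry X m := by
  obtain ⟨w, rfl⟩ := hz
  exact ⟨ψ.push (b (m + 1)) w, by rw [bd_push, hb.bd_succ m hm, push_cobd]⟩

lemma push_sub_mem_bdry (ψ : FaceFamily Y E X) {M : ℕ} {b b' : ∀ m, Ch (E.obj (.mk m)) m}
    {h : ∀ m, Ch (E.obj (.mk m)) (m + 1)} (hh : IsModelHtpy E M b b' h) {m : ℕ} (hm : m ≤ M)
    {z : Ch Y m} (hz : z ∈ redCycle Y m) : ψ.push (b m) z - ψ.push (b' m) z ∈ bdry X m := by
  refine ⟨ψ.push (h m) z, ?_⟩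
  rw [bd_push]
  cases m with
  | zero => rw [hh.bd_zero, push_sub]
  | succ m =>
    rw [hh.bd_succ m hm, push_sub, push_sub, push_cobd, mem_redCycle_succ.1 hz, map_zero, sub_zero]

end FaceFamily

end Models

end

end CatDuality

namespace CatDuality

noncomputable section

/-! ### Nerves of preordered sets; standard simplices as models -/

section NervePreord

/-- The map of nerves induced by a monotone map. -/
abbrev nerveMono {P Q : Type u} [Preorder P] [Preorder Q] (f : P →o Q) : nerve P ⟶ nerve Q :=
  nerveMap f.monotone.functor

/-- The nerve of a preordered set. -/
def preordNerve : Preord.{u} ⥤ SSet.{u} where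
  obj P := nerve P
  map f := nerveMono (Preord.Hom.hom f)

/-- Comparable monotone maps induce homotopic maps of nerves. -/
def nerveMonoHomotopy {P Q : Type u} [Preorder P] [Preorder Q] {f g : P →o Q} (h : f ≤ g) :
    SSet.Homotopy (nerveMono f) (nerveMono g) :=
  nerveHomotopy { app := fun p => homOfLE (h p) }

lemma const_eq_nerveMono {P Q : Type u} [Preorder P] [Preorder Q] (q : Q) :
    (nerveMono (OrderHom.const P q) : nerve P ⟶ nerve Q) =
      SSet.const (ComposableArrows.mk₀ q : Sx (nerve Q) 0) := by
  refine NatTrans.ext (funext fun n => ConcreteCategory.hom_ext _ _ fun x => ?_)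
  exact nerve.ext_of_isThin (C := Q) rfl

lemma nerveMono_const_mem_bdry {P Q : Type u} [Preorder P] [Preorder Q] (q : Q) (k : ℕ)
    {z : Ch (nerve P) k} (hz : z ∈ redCycle (nerve P) k) :
    chMap (nerveMono (OrderHom.const P q)) k z ∈ bdry (nerve Q) k := by
  rw [const_eq_nerveMono]
  exact chMap_const_mem_bdry _ _ _ hz

/-- The identity lies below the constant map at the top element, so the two are homotopic. -/
lemma mem_bdry_of_orderTop {P : Type u} [Preorder P] [OrderTop P] (k : ℕ) {z : Ch (nerve P) k}
    (hz : z ∈ redCycle (nerve P) k) : z ∈ bdry (nerve P) k := by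
  have h : (OrderHom.id : P →o P) ≤ OrderHom.const P ⊤ := fun _ => le_top
  have h1 := homotopy_sub_mem_bdry (nerveMonoHomotopy h) k hz
  have h2 := nerveMono_const_mem_bdry (⊤ : P) k hz
  have h3 := add_mem h1 h2
  rw [sub_add_cancel] at h3
  have h4 : nerveMono (OrderHom.id : P →o P) = 𝟙 _ := rfl
  rwa [h4, chMap_id] at h3

/-- The finite ordinals, as a cosimplicial preordered set. -/
def ordPreord : SimplexCategory ⥤ Preord.{u} where
  obj n := Preord.of (ULift.{u} (Fin (n.len + 1)))
  map θ := Preord.ofHom ⟨fun i => ⟨θ.toOrderHom i.down⟩, fun _ _ h => θ.toOrderHom.monotone h⟩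

/-- The standard simplices, as nerves. -/
abbrev ordNerve : SimplexCategory ⥤ SSet.{u} := ordPreord ⋙ preordNerve

lemma kills_ordNerve (M : ℕ) : Kills (𝟙 ordNerve.{u}) M := by
  intro m _ k z hz
  rw [NatTrans.id_app, chMap_id]
  let _ : OrderTop (ULift.{u} (Fin (m + 1))) := { top := ⟨⊤⟩, le_top := fun a => Fin.le_last a.down }
  exact mem_bdry_of_orderTop (P := ULift.{u} (Fin (m + 1))) k hz

/-- The identity simplex of a standard simplex. -/
def ordFund (m : ℕ) : Sx (ordNerve.{u}.obj (.mk m)) m :=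
  (Monotone.functor (X := Fin (m + 1)) (Y := ULift.{u} (Fin (m + 1)))
    (f := ULift.up) fun _ _ h => h : Fin (m + 1) ⥤ ULift.{u} (Fin (m + 1)))

lemma isModel_ordFund (M : ℕ) : IsModel ordNerve.{u} M fun m => .of (ordFund m) where
  aug_zero := aug_of _ _
  bd_succ m _ := by
    rw [bd_of, cobd_apply]
    refine Finset.sum_congr rfl fun i _ => ?_
    rw [chMap_of]
    rfl

variable {X : SSet.{u}}

/-- The simplex `[k] ⟶ [m]` obtained from a monotone map `P → [m]` and a flag in `P`. -/
def flagHom {P : Type u} [Preorder P] {m : ℕ} (f : P →o Fin (m + 1)) {n : SimplexCategory}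
    (F : Fin (n.len + 1) ⥤ P) : n ⟶ SimplexCategory.mk m :=
  SimplexCategory.Hom.mk ⟨fun i => f (F.obj i), fun _ _ h => f.monotone (F.map (homOfLE h)).le⟩

/-- The map from the nerve of `P` to `X` given by a simplex of `X` and a monotone map from `P`
to its set of vertices. -/
def evalAlong {P : Type u} [Preorder P] {m : ℕ} (f : P →o Fin (m + 1)) (σ : Sx X m) :
    nerve P ⟶ X where
  app n := ↾fun F => X.map (flagHom f F).op σ
  naturality n n' g := by
    ext F
    exact CategoryTheory.Functor.map_comp_apply X (flagHom f F).op g σ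

lemma evalAlong_app {P : Type u} [Preorder P] {m : ℕ} (f : P →o Fin (m + 1)) (σ : Sx X m)
    (n : SimplexCategoryᵒᵖ) (F : (nerve P).obj n) :
    (evalAlong f σ).app n F = X.map (flagHom f (n := n.unop) F).op σ := rfl

lemma evalAlong_map {P : Type u} [Preorder P] {m m' : ℕ} (f : P →o Fin (m + 1)) (σ : Sx X m')
    (θ : SimplexCategory.mk m ⟶ SimplexCategory.mk m') :
    evalAlong f (X.map θ.op σ) = evalAlong (θ.toOrderHom.comp f) σ := by
  ext n F
  exact (CategoryTheory.Functor.map_comp_apply X θ.op (flagHom f F).op σ).symm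

/-- The order isomorphism from the standard simplex. -/
def ordDown (m : ℕ) : ULift.{u} (Fin (m + 1)) →o Fin (m + 1) := ⟨ULift.down, fun _ _ h => h⟩

lemma evalAlong_ordFund {m : ℕ} (σ : Sx X m) :
    (evalAlong (ordDown m) σ).app (op (.mk m)) (ordFund m) = σ :=
  (evalAlong_app (ordDown.{u} m) σ (op (.mk m)) (ordFund m)).trans
    (CategoryTheory.Functor.map_id_apply X _ σ)

variable (X) in
/-- The characteristic maps of the simplices of a simplicial set. -/
def charFamily : FaceFamily X ordNerve.{u} X where
  map {m} σ := evalAlong (ordDown m) σ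
  map_δ {m} s i := evalAlong_map (ordDown m) s (SimplexCategory.δ i)

lemma charFamily_push_ordFund {m : ℕ} (z : Ch X m) :
    (charFamily X).push (.of (ordFund m)) z = z := by
  induction z using FreeAbelianGroup.induction_on with
  | zero => simp
  | of x =>
    rw [FaceFamily.push_of, chMap_of]
    exact congrArg _ (evalAlong_ordFund x)
  | neg x h => simp only [map_neg, h]
  | add a b ha hb => simp only [map_add, ha, hb]

/-- The given chains and the fundamental simplices are two models in acyclic objects, hence
homotopic, and the fundamental simplices push to the identity. -/
lemma charFamily_push_sub_mem_bdry {M : ℕ} {b : ∀ m, Ch (ordNerve.{u}.obj (.mk m)) m}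
    (hb : IsModel ordNerve.{u} M b) {m : ℕ} (hm : m ≤ M) {z : Ch X m} (hz : z ∈ redCycle X m) :
    (charFamily X).push (b m) z - z ∈ bdry X m := by
  -- Standard simplices are already acyclic, so a constant system suffices.
  obtain ⟨h, hh⟩ := exists_isModelHtpy ((Functor.const ℕ).obj ordNerve.{u}) 0 M
    (fun _ _ => kills_ordNerve M) hb (isModel_ordFund M) M le_rfl
  have hid : ∀ c, mapModel (𝟙 ordNerve.{u}) c = c := fun c => funext fun m => chMap_id _ _
  change IsModelHtpy _ M (mapModel (𝟙 ordNerve.{u}) _) (mapModel (𝟙 ordNerve.{u}) _) h at hh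
  rw [hid, hid] at hh
  have := (charFamily X).push_sub_mem_bdry hh hm hz
  rwa [charFamily_push_ordFund] at this

end NervePreord

end

end CatDuality

namespace CatDuality

noncomputable section

open MeasureTheory

/-! ### Quantile functions of points of a standard simplex -/

section Quantile

variable {m m' : ℕ}

/-- The quantile function of a point of a standard simplex. -/
def quant (x : stdSimplex ℝ (Fin (m + 1))) (t : ℝ) : Fin (m + 1) :=
  (Finset.univ.filter fun i => t ≤ ∑ j ∈ Finset.Iic i, x j).inf id

lemma quant_le_iff (x : stdSimplex ℝ (Fin (m + 1))) {t : ℝ} (ht : t ≤ 1) (i : Fin (m + 1)) :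
    quant x t ≤ i ↔ t ≤ ∑ j ∈ Finset.Iic i, x j := by
  constructor
  · intro h
    have hne : (Finset.univ.filter fun i => t ≤ ∑ j ∈ Finset.Iic i, x j).Nonempty := by
      refine ⟨Fin.last m, Finset.mem_filter.2 ⟨Finset.mem_univ _, ?_⟩⟩
      have : Finset.Iic (Fin.last m) = Finset.univ := Finset.eq_univ_of_forall fun i =>
        Finset.mem_Iic.2 (Fin.le_last i)
      rw [this, stdSimplex.sum_eq_one]
      exact ht
    obtain ⟨j, hj, hj'⟩ := Finset.exists_mem_eq_inf _ hne id
    refine (Finset.mem_filter.1 hj).2.trans (Finset.sum_le_sum_of_subset_of_nonneg ?_ ?_)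
    · have h2 : j ≤ i := by
        rw [quant, hj'] at h
        exact h
      exact Finset.Iic_subset_Iic.2 h2
    · intro k _ _
      exact stdSimplex.zero_le x k
  · intro h
    exact Finset.inf_le (f := id) (Finset.mem_filter.2 ⟨Finset.mem_univ _, h⟩)

/-- A nonempty lower set is an initial segment. For the empty set the right side reads t ≤ 0, which
is why parameters must be positive. -/
lemma quant_mem_iff (x : stdSimplex ℝ (Fin (m + 1))) {t : ℝ} (h0 : 0 < t) (ht : t ≤ 1)
    (S : Finset (Fin (m + 1))) (hS : ∀ i ∈ S, ∀ j ≤ i, j ∈ S) :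
    quant x t ∈ S ↔ t ≤ ∑ j ∈ S, x j := by
  rcases S.eq_empty_or_nonempty with rfl | hne
  · simp [h0]
  · have : S = Finset.Iic (S.max' hne) := by
      ext i
      rw [Finset.mem_Iic]
      exact ⟨fun h => Finset.le_max' _ _ h, fun h => hS _ (Finset.max'_mem _ _) _ h⟩
    rw [this, ← quant_le_iff x ht, Finset.mem_Iic]

lemma map_apply_eq (f : Fin (m + 1) → Fin (m' + 1)) (x : stdSimplex ℝ (Fin (m + 1)))
    (i : Fin (m' + 1)) : stdSimplex.map f x i = ∑ j with f j = i, x j := by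
  have := FunOnFinite.linearMap_apply_apply ℝ ℝ f (x : Fin (m + 1) → ℝ) i
  rw [← stdSimplex.map_coe] at this
  exact this

/-- Pushing forward sums coordinates over fibres, and a monotone map pulls initial segments back to
lower sets. The preimage may be empty, so t > 0 is needed; this is the reason for the parameter
interval (0,1]. -/
lemma quant_map (f : Fin (m + 1) →o Fin (m' + 1)) (x : stdSimplex ℝ (Fin (m + 1))) {t : ℝ}
    (h0 : 0 < t) (ht : t ≤ 1) : quant (stdSimplex.map f x) t = f (quant x t) := by
  refine eq_of_forall_ge_iff fun i => ?_
  rw [quant_le_iff _ ht]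
  have h1 : ∑ j ∈ Finset.Iic i, stdSimplex.map f x j = ∑ j with f j ≤ i, x j := by
    simp_rw [map_apply_eq]
    rw [← Finset.sum_fiberwise_of_maps_to (s := Finset.univ.filter fun j => f j ≤ i)
      (t := Finset.Iic i) (g := f) (fun j hj => Finset.mem_Iic.2 (Finset.mem_filter.1 hj).2)]
    refine Finset.sum_congr rfl fun k hk => Finset.sum_congr ?_ fun _ _ => rfl
    ext j
    simp only [Finset.mem_filter, Finset.mem_univ, true_and]
    exact ⟨fun h => ⟨h ▸ Finset.mem_Iic.1 hk, h⟩, fun h => h.2⟩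
  rw [h1, ← quant_mem_iff x h0 ht]
  · simp
  · intro a ha b hb
    simp only [Finset.mem_filter, Finset.mem_univ, true_and] at ha ⊢
    exact (f.monotone hb).trans ha

lemma quant_mono (x : stdSimplex ℝ (Fin (m + 1))) {s t : ℝ} (h : s ≤ t) (ht : t ≤ 1) :
    quant x s ≤ quant x t := by
  rw [quant_le_iff x (h.trans ht)]
  exact h.trans ((quant_le_iff x ht _).1 le_rfl)

/-- The `ℓ¹`-distance on a standard simplex. -/
def dist1 (x y : stdSimplex ℝ (Fin (m + 1))) : ℝ := ∑ i, |x i - y i|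

lemma dist1_comm (x y : stdSimplex ℝ (Fin (m + 1))) : dist1 x y = dist1 y x :=
  Finset.sum_congr rfl fun _ _ => abs_sub_comm _ _

lemma dist1_self (x : stdSimplex ℝ (Fin (m + 1))) : dist1 x x = 0 := by simp [dist1]

lemma dist1_le_two (x y : stdSimplex ℝ (Fin (m + 1))) : dist1 x y ≤ 2 := by
  calc dist1 x y ≤ ∑ i, (x i + y i) := Finset.sum_le_sum fun i _ => by
        rw [abs_le]
        have := stdSimplex.zero_le x i
        have := stdSimplex.zero_le y i
        constructor <;> linarith
    _ = 2 := by
        rw [Finset.sum_add_distrib, stdSimplex.sum_eq_one, stdSimplex.sum_eq_one]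
        norm_num

lemma dist1_map_le (f : Fin (m + 1) → Fin (m' + 1)) (x y : stdSimplex ℝ (Fin (m + 1))) :
    dist1 (stdSimplex.map f x) (stdSimplex.map f y) ≤ dist1 x y := by
  unfold dist1
  rw [← Finset.sum_fiberwise (s := Finset.univ) (g := f)]
  refine Finset.sum_le_sum fun i _ => ?_
  rw [map_apply_eq, map_apply_eq, ← Finset.sum_sub_distrib]
  exact Finset.abs_sum_le_sum_abs _ _

/-- The set where the quantile functions of two points differ. -/
def qbad (x y : stdSimplex ℝ (Fin (m + 1))) : Set ℝ :=
  {t | t ∈ Set.Ioc (0 : ℝ) 1 ∧ quant x t ≠ quant y t}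

lemma qbad_map_subset (f : Fin (m + 1) →o Fin (m' + 1)) (x y : stdSimplex ℝ (Fin (m + 1))) :
    qbad (stdSimplex.map f x) (stdSimplex.map f y) ⊆ qbad x y := by
  rintro t ⟨ht, h⟩
  refine ⟨ht, fun h' => h ?_⟩
  rw [quant_map f _ ht.1 ht.2, quant_map f _ ht.1 ht.2, h']

/-- The quantiles differ at t only if, for some i, t separates the i-th partial sums of x and y.
These are m + 1 intervals, each no longer than the ℓ¹-distance. -/
lemma volume_qbad_le (x y : stdSimplex ℝ (Fin (m + 1))) :
    volume (qbad x y) ≤ ENNReal.ofReal ((m + 1) * dist1 x y) := by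
  have h1 : qbad x y ⊆ ⋃ i : Fin (m + 1), Set.uIoc (∑ j ∈ Finset.Iic i, x j)
      (∑ j ∈ Finset.Iic i, y j) := by
    rintro t ⟨ht, h⟩
    by_contra hcon
    apply h
    refine eq_of_forall_ge_iff fun i => ?_
    rw [quant_le_iff _ ht.2, quant_le_iff _ ht.2]
    by_contra h'
    apply hcon
    rw [Set.mem_iUnion]
    refine ⟨i, ?_⟩
    rw [Set.mem_uIoc]
    by_cases ha : t ≤ ∑ j ∈ Finset.Iic i, x j
    · right
      refine ⟨?_, ha⟩
      by_contra hb
      exact h' ⟨fun _ => not_lt.1 hb, fun _ => ha⟩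
    · left
      refine ⟨not_le.1 ha, ?_⟩
      by_contra hb
      exact h' ⟨fun h => absurd h ha, fun h => absurd h hb⟩
  refine (measure_mono h1).trans ((measure_iUnion_fintype_le _ _).trans ?_)
  have h2 : ∀ i : Fin (m + 1), volume (Set.uIoc (∑ j ∈ Finset.Iic i, x j)
      (∑ j ∈ Finset.Iic i, y j)) ≤ ENNReal.ofReal (dist1 x y) := by
    intro i
    rw [Set.uIoc, Real.volume_Ioc]
    refine ENNReal.ofReal_le_ofReal ?_
    rw [max_sub_min_eq_abs, ← Finset.sum_sub_distrib]
    refine (Finset.abs_sum_le_sum_abs _ _).trans ?_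
    rw [dist1_comm]
    exact Finset.sum_le_sum_of_subset_of_nonneg (Finset.subset_univ _) fun _ _ _ => abs_nonneg _
  refine (Finset.sum_le_sum fun i _ => h2 i).trans ?_
  rw [Finset.sum_const, Finset.card_univ, Fintype.card_fin, nsmul_eq_mul,
    ENNReal.ofReal_mul (by positivity)]
  gcongr
  rw [← Nat.cast_succ, ENNReal.ofReal_natCast]

/-- The point at time `l` on the segment from `x` to `y`. -/
def lerp (l : Set.Icc (0 : ℝ) 1) (x y : stdSimplex ℝ (Fin (m + 1))) :
    stdSimplex ℝ (Fin (m + 1)) :=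
  ⟨fun i => (1 - l.1) * x i + l.1 * y i, by
    refine convex_stdSimplex ℝ _ x.2 y.2 (sub_nonneg.2 l.2.2) l.2.1 (by ring)⟩

lemma lerp_apply (l : Set.Icc (0 : ℝ) 1) (x y : stdSimplex ℝ (Fin (m + 1))) (i : Fin (m + 1)) :
    lerp l x y i = (1 - l.1) * x i + l.1 * y i := rfl

lemma lerp_zero (x y : stdSimplex ℝ (Fin (m + 1))) (h : (0 : ℝ) ∈ Set.Icc (0 : ℝ) 1) :
    lerp ⟨0, h⟩ x y = x := by
  refine stdSimplex.ext (funext fun i => ?_)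
  simp [lerp_apply]

lemma lerp_one (x y : stdSimplex ℝ (Fin (m + 1))) (h : (1 : ℝ) ∈ Set.Icc (0 : ℝ) 1) :
    lerp ⟨1, h⟩ x y = y := by
  refine stdSimplex.ext (funext fun i => ?_)
  simp [lerp_apply]

lemma dist1_lerp_le (l l' : Set.Icc (0 : ℝ) 1) (x y z : stdSimplex ℝ (Fin (m + 1))) :
    dist1 (lerp l x z) (lerp l' y z) ≤ dist1 x y + 2 * |l.1 - l'.1| := by
  have h1 : dist1 (lerp l x z) (lerp l' y z) ≤ dist1 x y + |l.1 - l'.1| * dist1 y z := by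
    unfold dist1
    rw [Finset.mul_sum, ← Finset.sum_add_distrib]
    refine Finset.sum_le_sum fun i _ => ?_
    rw [lerp_apply, lerp_apply]
    have e : (1 - l.1) * x i + l.1 * z i - ((1 - l'.1) * y i + l'.1 * z i) =
        (1 - l.1) * (x i - y i) + - ((l.1 - l'.1) * (y i - z i)) := by ring
    rw [e]
    refine (abs_add_le _ _).trans ?_
    rw [abs_neg, abs_mul, abs_mul, abs_of_nonneg (sub_nonneg.2 l.2.2)]
    gcongr
    exact mul_le_of_le_one_left (abs_nonneg _) (by linarith [l.2.1])
  -- The constant 2 is a bound for the ℓ¹-diameter of the simplex.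
  have h2 := mul_le_mul_of_nonneg_left (dist1_le_two y z) (abs_nonneg (l.1 - l'.1))
  linarith

lemma dist1_le_mul_dist (x y : stdSimplex ℝ (Fin (m + 1))) : dist1 x y ≤ (m + 1) * dist x y := by
  have : ∀ i : Fin (m + 1), |x i - y i| ≤ dist x y := fun i =>
    dist_le_pi_dist (x : Fin (m + 1) → ℝ) y i
  refine (Finset.sum_le_sum fun i _ => this i).trans ?_
  simp

/-- The parameter interval. -/
abbrev UI : Type u := ULift.{u} (Set.Ioc (0 : ℝ) 1)

/-- The quantile function as a monotone map. -/
def quantHom (x : stdSimplex ℝ (Fin (m + 1))) : UI.{u} →o Fin (m + 1) :=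
  ⟨fun t => quant x t.down.1, fun _ t h => quant_mono x h t.down.2.2⟩

lemma quantHom_map (f : Fin (m + 1) →o Fin (m' + 1)) (x : stdSimplex ℝ (Fin (m + 1))) :
    quantHom.{u} (stdSimplex.map f x) = f.comp (quantHom x) :=
  OrderHom.ext _ _ (funext fun t => quant_map f x t.down.2.1 t.down.2.2)

end Quantile

end

end CatDuality

namespace CatDuality

noncomputable section

open MeasureTheory

/-! ### The space of maps from the nerve of (0,1] to X -/

section Agree

variable {X : SSet.{u}}

/-- Two maps `nerve UI ⟶ X` agree away from a set `A` of parameters. -/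
def Agree (A : Set ℝ) (ρ ρ' : nerve UI.{u} ⟶ X) : Prop :=
  ∀ (n : SimplexCategoryᵒᵖ) (F : Fin (n.unop.len + 1) ⥤ UI.{u}), (∀ i, (F.obj i).down.1 ∉ A) →
    ρ.app n F = ρ'.app n F

lemma Agree.refl (A : Set ℝ) (ρ : nerve UI.{u} ⟶ X) : Agree A ρ ρ := fun _ _ _ => rfl

lemma Agree.symm {A : Set ℝ} {ρ ρ' : nerve UI.{u} ⟶ X} (h : Agree A ρ ρ') : Agree A ρ' ρ :=
  fun n F hF => (h n F hF).symm

lemma Agree.mono {A B : Set ℝ} {ρ ρ' : nerve UI.{u} ⟶ X} (h : Agree A ρ ρ') (hAB : A ⊆ B) :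
    Agree B ρ ρ' :=
  fun n F hF => h n F fun i hi => hF i (hAB hi)

lemma Agree.trans {A B : Set ℝ} {ρ ρ' ρ'' : nerve UI.{u} ⟶ X} (h : Agree A ρ ρ')
    (h' : Agree B ρ' ρ'') : Agree (A ∪ B) ρ ρ'' :=
  fun n F hF => (h n F fun i hi => hF i (Or.inl hi)).trans
    (h' n F fun i hi => hF i (Or.inr hi))

variable (X) in
/-- The space of maps `nerve UI ⟶ X`, with the distance given by the measure of the set where
two maps differ. -/
def StepSpace : Type u := nerve UI.{u} ⟶ X

/-- The distance on the space of maps `nerve UI ⟶ X`. -/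
instance : PseudoEMetricSpace (StepSpace X) where
  edist ρ ρ' := ⨅ A : {A : Set ℝ // Agree A ρ ρ'}, volume A.1
  edist_self ρ := by
    refine le_antisymm (iInf_le_of_le ⟨∅, Agree.refl _ _⟩ ?_) zero_le
    simp
  edist_comm ρ ρ' := by
    refine le_antisymm ?_ ?_ <;>
    exact le_iInf fun A => iInf_le_of_le ⟨A.1, A.2.symm⟩ le_rfl
  edist_triangle ρ ρ' ρ'' := by
    rw [ENNReal.iInf_add]
    refine le_iInf fun A => ?_
    rw [ENNReal.add_iInf]
    refine le_iInf fun B => ?_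
    exact iInf_le_of_le ⟨A.1 ∪ B.1, A.2.trans B.2⟩ (measure_union_le _ _)

lemma edist_le_of_agree {A : Set ℝ} {ρ ρ' : StepSpace X} (h : Agree A ρ ρ') :
    edist ρ ρ' ≤ volume A :=
  iInf_le (fun A : {A : Set ℝ // Agree A ρ ρ'} => volume A.1) ⟨A, h⟩

lemma exists_agree {ρ ρ' : StepSpace X} {η : ENNReal} (h : edist ρ ρ' < η) :
    ∃ A, Agree A ρ ρ' ∧ volume A < η := by
  obtain ⟨A, hA⟩ := iInf_lt_iff.1 (show (⨅ A : {A : Set ℝ // Agree A ρ ρ'}, volume A.1) < η from h)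
  exact ⟨A.1, A.2, hA⟩

/-- The map `nerve UI ⟶ X` given by a simplex of `X` and a point of the standard simplex. -/
def stepPt {m : ℕ} (σ : Sx X m) (x : stdSimplex ℝ (Fin (m + 1))) : StepSpace X :=
  evalAlong (quantHom x) σ

lemma stepPt_map {m m' : ℕ} (θ : SimplexCategory.mk m ⟶ SimplexCategory.mk m') (σ : Sx X m')
    (x : stdSimplex ℝ (Fin (m + 1))) :
    stepPt (X.map θ.op σ) x = stepPt σ (stdSimplex.map θ.toOrderHom x) := by
  unfold stepPt
  rw [evalAlong_map, ← quantHom_map]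

lemma agree_stepPt {m : ℕ} (σ : Sx X m) (x y : stdSimplex ℝ (Fin (m + 1))) :
    Agree (qbad x y) (stepPt σ x) (stepPt σ y) := by
  intro n F hF
  refine (evalAlong_app _ _ _ _).trans (Eq.trans ?_ (evalAlong_app _ _ _ _).symm)
  have : flagHom (n := n.unop) (quantHom x) F = flagHom (quantHom y) F := by
    refine SimplexCategory.Hom.ext _ _ (OrderHom.ext _ _ (funext fun i => ?_))
    by_contra h
    exact hF i ⟨(F.obj i).down.2, h⟩
  rw [this]

lemma edist_stepPt_le {m : ℕ} (σ : Sx X m) (x y : stdSimplex ℝ (Fin (m + 1))) :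
    edist (stepPt σ x) (stepPt σ y) ≤ volume (qbad x y) :=
  edist_le_of_agree (agree_stepPt σ x y)

lemma continuous_stepPt {m : ℕ} (σ : Sx X m) : Continuous (stepPt σ) := by
  -- One factor counts the partial sums, the other compares the ℓ¹-distance with the sup-distance.
  have : LipschitzWith ((m + 1) * (m + 1)) (stepPt σ) := by
    intro x y
    refine (edist_stepPt_le σ x y).trans ((volume_qbad_le x y).trans ?_)
    rw [edist_dist, ← ENNReal.ofReal_coe_nnreal, ← ENNReal.ofReal_mul (by positivity)]
    refine ENNReal.ofReal_le_ofReal ?_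
    push_cast
    rw [mul_assoc]
    gcongr
    exact dist1_le_mul_dist x y
  exact this.continuous

variable (X) in
/-- The space of maps `nerve UI ⟶ X` as an object of `TopCat`. -/
abbrev StepTop : TopCat.{u} := TopCat.of (StepSpace X)

variable (X) in
/-- The canonical map from `X` to the singular simplicial set of the space of maps
`nerve UI ⟶ X`. -/
def toStep : X ⟶ TopCat.toSSet.obj (StepTop X) where
  app n := ↾fun σ => (TopCat.toSSetObjEquiv (StepTop X) n).symm
    ⟨stepPt (m := n.unop.len) σ, continuous_stepPt (m := n.unop.len) σ⟩
  naturality n n' g := by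
    ext σ
    refine (TopCat.toSSetObjEquiv (StepTop X) n').injective (ContinuousMap.ext fun x => ?_)
    exact stepPt_map (m := n'.unop.len) (m' := n.unop.len) g.unop σ x

/-- By the adjunction between realization and singular simplices, `toStep X` factors through Sing
|X|, where the contraction makes every reduced cycle bound. -/
lemma chMap_toStep_mem_bdry [ContractibleSpace (SSet.toTop.obj X)] {k : ℕ} {z : Ch X k}
    (hz : z ∈ redCycle X k) : chMap (toStep X) k z ∈ bdry _ k := by
  let Φ : SSet.toTop.obj X ⟶ StepTop X := (sSetTopAdj.homEquiv X (StepTop X)).symm (toStep X)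
  have hΦ : toStep X = sSetTopAdj.unit.app X ≫ TopCat.toSSet.map Φ := by
    refine Eq.trans ?_ (sSetTopAdj.homEquiv_unit (X := X) (Y := StepTop X) (f := Φ))
    exact (Equiv.apply_symm_apply _ _).symm
  obtain ⟨p, ⟨H⟩⟩ := (id_nullhomotopic (SSet.toTop.obj X))
  have H' : ContinuousMap.Homotopy (𝟙 (SSet.toTop.obj X) : SSet.toTop.obj X ⟶ _).hom
      (TopCat.const (X := SSet.toTop.obj X) p).hom := H
  have hz' := chMap_mem_redCycle (sSetTopAdj.unit.app X) k hz
  have h1 := homotopy_sub_mem_bdry (TopCat.Homotopy.toSSet H') k hz'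
  have h2 : chMap (TopCat.toSSet.map (TopCat.const (X := SSet.toTop.obj X)
      (Y := SSet.toTop.obj X) p)) k
      (chMap (sSetTopAdj.unit.app X) k z) ∈ bdry _ k := by
    rw [TopCat.toSSet_map_const]
    exact chMap_const_mem_bdry _ _ _ hz'
  have h3 := add_mem h1 h2
  rw [sub_add_cancel, CategoryTheory.Functor.map_id, chMap_id] at h3
  rw [hΦ, chMap_comp]
  exact chMap_mem_bdry _ k h3

end Agree

/-! ### Evaluating sets of almost equal maps at good parameters -/

section Points

variable (X : SSet.{u})

/-- A set of maps `nerve UI ⟶ X` which agree away from a set of parameters, together with a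
parameter not in this set. -/
def AgreePt : Type u :=
  {p : Set (StepSpace X) × Set ℝ × UI.{u} // p.1.Nonempty ∧
    (∀ ρ ∈ p.1, ∀ ρ' ∈ p.1, Agree p.2.1 ρ ρ') ∧ p.2.2.down.1 ∉ p.2.1}

instance : Preorder (AgreePt X) := inferInstanceAs (Preorder {p : Set (StepSpace X) × Set ℝ × UI.{u} //
  p.1.Nonempty ∧ (∀ ρ ∈ p.1, ∀ ρ' ∈ p.1, Agree p.2.1 ρ ρ') ∧ p.2.2.down.1 ∉ p.2.1})

variable {X}

/-- The parameter of a point. -/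
def AgreePt.param : AgreePt X →o UI.{u} := ⟨fun p => p.1.2.2, fun _ _ h => h.2.2⟩

lemma AgreePt.param_notMem {p q : AgreePt X} (h : p ≤ q) : (param q).down.1 ∉ p.1.2.1 :=
  fun hq => q.2.2.2 (h.2.1 hq)

/-- Evaluation at the parameters. -/
def AgreePt.evalApp (n : SimplexCategoryᵒᵖ) (F : Fin (n.unop.len + 1) ⥤ AgreePt X) : X.obj n :=
  ((F.obj 0).2.1.some : nerve UI.{u} ⟶ X).app n (F ⋙ AgreePt.param.monotone.functor)

/-- Bad sets grow along a flag and each member avoids its own, so all parameters avoid the bad set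
of the first member and the map chosen there is immaterial. A map may even come from a smaller point
`p`, which makes evaluation compatible with operators that change the first vertex. -/
lemma AgreePt.evalApp_eq (n : SimplexCategoryᵒᵖ) (F : Fin (n.unop.len + 1) ⥤ AgreePt X)
    {ρ : nerve UI.{u} ⟶ X} {p : AgreePt X} (hp : p ≤ F.obj 0) (hρ : ρ ∈ p.1.1) :
    AgreePt.evalApp n F = ρ.app n (F ⋙ AgreePt.param.monotone.functor) := by
  refine (F.obj 0).2.2.1 _ (F.obj 0).2.1.some_mem _ (hp.1 hρ) n _ fun i => ?_
  exact AgreePt.param_notMem (F.map (homOfLE (Fin.zero_le i))).le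

variable (X) in
/-- Evaluation at the parameters, as a map of simplicial sets. -/
def AgreePt.eval : nerve (AgreePt X) ⟶ X where
  app n := ↾AgreePt.evalApp n
  naturality n n' g := by
    refine ConcreteCategory.hom_ext _ _ fun F => ?_
    let F : Fin (n.unop.len + 1) ⥤ AgreePt X := F
    have h1 := AgreePt.evalApp_eq n' (g.unop.toOrderHom.monotone.functor ⋙ F)
      (p := F.obj 0) (F.map (homOfLE (Fin.zero_le _))).le (F.obj 0).2.1.some_mem
    refine h1.trans ?_
    exact ConcreteCategory.congr_hom (((F.obj 0).2.1.some : nerve UI.{u} ⟶ X).naturality g)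
      (F ⋙ AgreePt.param.monotone.functor)

end Points

end

end CatDuality

namespace CatDuality

noncomputable section

/-! ### Comparable families of monotone maps induce homologous chains -/

section MonoFamily

/-- The product of a preordered set with `{false < true}`. -/
def dblPreord : Preord.{u} ⥤ Preord.{u} where
  obj P := Preord.of (P × Bool)
  map f := Preord.ofHom (f.hom.prodMap OrderHom.id)

/-- The map f × id lies below (x, e) ↦ (f x, true), which factors through f. -/
lemma dbl_kills {P Q : Type u} [Preorder P] [Preorder Q] (f : P →o Q)
    (hf : ∀ k, ∀ z ∈ redCycle (nerve P) k, chMap (nerveMono f) k z ∈ bdry (nerve Q) k) (k : ℕ)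
    (z : Ch (preordNerve.obj (Preord.of (P × Bool))) k) (hz : z ∈ redCycle _ k) :
    chMap (preordNerve.map (Preord.ofHom (f.prodMap OrderHom.id))) k z ∈
      bdry (preordNerve.obj (Preord.of (Q × Bool))) k := by
  let i : Preord.of Q ⟶ Preord.of (Q × Bool) :=
    Preord.ofHom ⟨fun q => (q, true), fun _ _ h => ⟨h, le_rfl⟩⟩
  let p : Preord.of (P × Bool) ⟶ Preord.of P := Preord.ofHom OrderHom.fst
  have h1 : (Preord.ofHom (f.prodMap OrderHom.id) : Preord.of (P × Bool) ⟶ Preord.of (Q × Bool)).hom ≤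
      (p ≫ Preord.ofHom f ≫ i).hom := fun x => ⟨le_rfl, Bool.le_true _⟩
  have h2 := homotopy_sub_mem_bdry (nerveMonoHomotopy h1) k hz
  have h3 : chMap (preordNerve.map (p ≫ Preord.ofHom f ≫ i)) k z ∈ bdry _ k := by
    rw [Functor.map_comp, Functor.map_comp, chMap_comp, chMap_comp]
    exact chMap_mem_bdry _ _ (hf k _ (chMap_mem_redCycle _ _ hz))
  have h4 := add_mem h2 h3
  exact (congrArg (· ∈ bdry _ k) (sub_add_cancel _ _)).mp h4

/-- A family of monotone maps into `P` indexed by the simplices of `Y`, compatible with faces. -/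
structure MonoFamily (Y : SSet.{u}) (G : SimplexCategory ⥤ Preord.{u}) (P : Type u) [Preorder P] where
  map : ∀ {m : ℕ}, Sx Y m → (G.obj (.mk m) →o P)
  map_δ : ∀ {m : ℕ} (s : Sx Y (m + 1)) (i : Fin (m + 2)),
    map (Y.δ i s) = (map s).comp (G.map (SimplexCategory.δ i)).hom

namespace MonoFamily

variable {Y : SSet.{u}} {G : SimplexCategory ⥤ Preord.{u}} {P : Type u} [Preorder P]

/-- The family of maps of nerves given by a family of monotone maps. -/
@[simps]
def toFace (ψ : MonoFamily Y G P) : FaceFamily Y (G ⋙ preordNerve) (nerve P) where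
  map s := nerveMono (ψ.map s)
  map_δ s i := by
    rw [ψ.map_δ]
    rfl

/-- Restriction of a family along a map of simplicial sets. -/
def restr {Y' : SSet.{u}} (ψ : MonoFamily Y G P) (f : Y' ⟶ Y) : MonoFamily Y' G P where
  map {m} s := ψ.map (f.app (op (.mk m)) s)
  map_δ s i := (congrArg ψ.map (SSet.δ_naturality_apply f i s)).trans (ψ.map_δ _ i)

/-- Two comparable families, as a family on the double. -/
def dbl (ψ ψ' : MonoFamily Y G P) (h : ∀ {m : ℕ} (s : Sx Y m), ψ.map s ≤ ψ'.map s) :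
    MonoFamily Y (G ⋙ dblPreord) P where
  map s :=
    { toFun := fun x => bif x.2 then ψ'.map s x.1 else ψ.map s x.1
      monotone' := by
        rintro ⟨x, _ | _⟩ ⟨y, _ | _⟩ ⟨h1, h2⟩
        · exact (ψ.map s).monotone h1
        · exact ((ψ.map s).monotone h1).trans (h s y)
        · exact absurd h2 (show ¬ (true ≤ false) by decide)
        · exact (ψ'.map s).monotone h1 }
  map_δ s i := by
    refine OrderHom.ext _ _ (funext ?_)
    rintro ⟨x, _ | _⟩
    · exact DFunLike.congr_fun (ψ.map_δ s i) x
    · exact DFunLike.congr_fun (ψ'.map_δ s i) x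

/-- The two inclusions in the double. -/
def dblIncl (G : SimplexCategory ⥤ Preord.{u}) (e : Bool) : G ⟶ G ⋙ dblPreord where
  app n := Preord.ofHom ⟨fun x => (x, e), fun _ _ h => ⟨h, le_rfl⟩⟩

/-- Two comparable families are the two ends of one family on the double. The doubled system still
kills cycles, so the two copies of the model inside it become homotopic. -/
lemma push_sub_mem_bdry (G : ℕ ⥤ (SimplexCategory ⥤ Preord.{u})) (a N : ℕ)
    (hα : ∀ j ≤ N, Kills (Functor.whiskerRight (G.map (homOfLE (show a + j ≤ a + j + 1 by omega)))
      preordNerve) N)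
    {b : ∀ m, Ch ((G.obj a ⋙ preordNerve).obj (.mk m)) m}
    (hb : IsModel (G.obj a ⋙ preordNerve) N b) (ψ ψ' : MonoFamily Y (G.obj (a + N + 1)) P)
    (h : ∀ {m : ℕ} (s : Sx Y m), ψ.map s ≤ ψ'.map s) {m : ℕ} (hm : m ≤ N)
    {z : Ch Y m} (hz : z ∈ redCycle Y m) :
    ψ.toFace.push (mapModel (Functor.whiskerRight (G.map (homOfLE (show a ≤ a + N + 1 by omega)))
        preordNerve) b m) z -
      ψ'.toFace.push (mapModel (Functor.whiskerRight (G.map (homOfLE (show a ≤ a + N + 1 by omega)))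
        preordNerve) b m) z ∈ bdry (nerve P) m := by
  let H : ℕ ⥤ (SimplexCategory ⥤ SSet.{u}) :=
    G ⋙ (Functor.whiskeringRight _ _ _).obj (dblPreord ⋙ preordNerve)
  have hH : ∀ j ≤ N, Kills (H.map (homOfLE (show a + j ≤ a + j + 1 by omega))) N := by
    intro j hj m hm k z hz
    exact dbl_kills _ (fun k z hz => hα j hj m hm k z hz) k z hz
  let ι : Bool → (G.obj a ⋙ preordNerve ⟶ H.obj a) := fun e =>
    Functor.whiskerRight (dblIncl (G.obj a) e) preordNerve
  obtain ⟨g, hg⟩ := exists_isModelHtpy H a N hH (hb.map (ι false)) (hb.map (ι true)) N le_rfl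
  have h1 := (dbl ψ ψ' h).toFace.push_sub_mem_bdry hg hm hz
  rw [← mapModel_comp, ← mapModel_comp] at h1
  have h2 : ∀ e, (dbl ψ ψ' h).toFace.push (mapModel (ι e ≫ H.map (homOfLE (show a ≤ a + N + 1 by omega))) b m) z =
      (dbl ψ ψ' h).toFace.push (mapModel ((Functor.whiskerRight (G.map (homOfLE (show a ≤ a + N + 1 by omega)))
        preordNerve) ≫ Functor.whiskerRight (dblIncl (G.obj (a + N + 1)) e) preordNerve) b m) z :=
    fun e => rfl
  rw [h2, h2, mapModel_comp, mapModel_comp] at h1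
  have h3 : ∀ (e : Bool) (c : ∀ m, Ch ((G.obj (a + N + 1) ⋙ preordNerve).obj (.mk m)) m),
      (dbl ψ ψ' h).toFace.push (mapModel (Functor.whiskerRight (dblIncl (G.obj (a + N + 1)) e)
        preordNerve) c m) z = ((dbl ψ ψ' h).toFace.precomp (Functor.whiskerRight
          (dblIncl (G.obj (a + N + 1)) e) preordNerve)).push (c m) z := fun e c =>
    (FaceFamily.precomp_push _ _ _ _).symm
  rw [h3, h3] at h1
  exact h1

end MonoFamily

end MonoFamily

end

end CatDuality

namespace CatDuality

noncomputable section

open MeasureTheory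

/-! ### Posets of small sets of close points, as acyclic models -/

section CloseSets

variable {m : ℕ}

/-- Two points of a standard simplex are close. -/
def Close (δ : ℝ) (η : ENNReal) (x y : stdSimplex ℝ (Fin (m + 1))) : Prop :=
  dist1 x y < δ ∧ volume (qbad x y) < η

lemma Close.map {m' : ℕ} (f : Fin (m + 1) →o Fin (m' + 1)) {δ : ℝ} {η : ENNReal}
    {x y : stdSimplex ℝ (Fin (m + 1))} (h : Close δ η x y) :
    Close δ η (stdSimplex.map f x) (stdSimplex.map f y) :=
  ⟨(dist1_map_le f x y).trans_lt h.1, (measure_mono (qbad_map_subset f x y)).trans_lt h.2⟩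

lemma Close.mono {δ δ' : ℝ} (hδ : δ ≤ δ') {η : ENNReal} {x y : stdSimplex ℝ (Fin (m + 1))}
    (h : Close δ η x y) : Close δ' η x y := ⟨h.1.trans_le hδ, h.2⟩

lemma close_of_dist1_lt {δ : ℝ} {η : ENNReal} (hη : ENNReal.ofReal ((m + 1) * δ) < η)
    {x y : stdSimplex ℝ (Fin (m + 1))} (h : dist1 x y < δ) : Close δ η x y := by
  refine ⟨h, (volume_qbad_le x y).trans_lt (lt_of_le_of_lt (ENNReal.ofReal_le_ofReal ?_) hη)⟩
  gcongr

/-- The set of nonempty sets of at most `L` pairwise close points of a standard simplex. -/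
def CloseSet (δ : ℝ) (η : ENNReal) (L m : ℕ) : Type u :=
  ULift.{u} {F : Finset (stdSimplex ℝ (Fin (m + 1))) //
    F.Nonempty ∧ F.card ≤ L ∧ ∀ x ∈ F, ∀ y ∈ F, Close δ η x y}

variable {δ δ' : ℝ} {η : ENNReal} {L L' : ℕ}

/-- The underlying finite set. -/
def CloseSet.fin (F : CloseSet.{u} δ η L m) : Finset (stdSimplex ℝ (Fin (m + 1))) := F.down.1

instance : PartialOrder (CloseSet.{u} δ η L m) :=
  PartialOrder.lift CloseSet.fin fun _ _ h => ULift.ext _ _ (Subtype.ext h)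

lemma CloseSet.ext {F F' : CloseSet.{u} δ η L m} (h : F.fin = F'.fin) : F = F' :=
  ULift.ext _ _ (Subtype.ext h)

open Classical in
/-- The image of a set of close points. -/
def CloseSet.map {m' : ℕ} (f : Fin (m + 1) →o Fin (m' + 1)) :
    CloseSet.{u} δ η L m →o CloseSet.{u} δ η L m' where
  toFun F := ⟨F.fin.image (stdSimplex.map f), F.down.2.1.image _,
    Finset.card_image_le.trans F.down.2.2.1, by
      simp only [Finset.forall_mem_image]
      exact fun x hx y hy => (F.down.2.2.2 x hx y hy).map f⟩
  monotone' _ _ h := Finset.image_subset_image h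

lemma CloseSet.mem_map {m' : ℕ} (f : Fin (m + 1) →o Fin (m' + 1)) (F : CloseSet.{u} δ η L m)
    (y : stdSimplex ℝ (Fin (m' + 1))) :
    y ∈ (CloseSet.map f F).fin ↔ ∃ x ∈ F.fin, stdSimplex.map f x = y := by
  classical
  exact Finset.mem_image

/-- Weakening of the closeness conditions. -/
def CloseSet.incl (hδ : δ ≤ δ') (hL : L ≤ L') : CloseSet.{u} δ η L m →o CloseSet.{u} δ' η L' m where
  toFun F := ⟨F.fin, F.down.2.1, F.down.2.2.1.trans hL,
    fun x hx y hy => (F.down.2.2.2 x hx y hy).mono hδ⟩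
  monotone' _ _ h := h

open Classical in
/-- The union of the contractions at two times. -/
def CloseSet.contr (x₀ : stdSimplex ℝ (Fin (m + 1))) (hδ : 0 < δ) (hδ' : 2 * δ ≤ δ')
    (hη : ENNReal.ofReal ((m + 1) * δ') < η) (hL : 2 * L ≤ L') (l l' : Set.Icc (0 : ℝ) 1)
    (h : 2 * |l.1 - l'.1| < δ) : CloseSet.{u} δ η L m →o CloseSet.{u} δ' η L' m where
  toFun F := ⟨F.fin.image (fun x => lerp l x x₀) ∪ F.fin.image (fun x => lerp l' x x₀),
    (F.down.2.1.image _).mono Finset.subset_union_left, by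
      refine (Finset.card_union_le _ _).trans (le_trans ?_ hL)
      rw [two_mul]
      exact add_le_add (Finset.card_image_le.trans F.down.2.2.1)
        (Finset.card_image_le.trans F.down.2.2.1), by
      have key : ∀ (a b : Set.Icc (0 : ℝ) 1), 2 * |a.1 - b.1| < δ → ∀ x ∈ F.fin, ∀ y ∈ F.fin,
          Close δ' η (lerp a x x₀) (lerp b y x₀) := by
        intro a b hab x hx y hy
        refine close_of_dist1_lt hη ?_
        have h1 := dist1_lerp_le a b x y x₀
        have h2 := (F.down.2.2.2 x hx y hy).1
        linarith
      have h0 : ∀ a : Set.Icc (0 : ℝ) 1, 2 * |a.1 - a.1| < δ := fun a => by simpa using hδ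
      intro x hx y hy
      rw [Finset.mem_union, Finset.mem_image, Finset.mem_image] at hx hy
      rcases hx with ⟨x, hx, rfl⟩ | ⟨x, hx, rfl⟩ <;> rcases hy with ⟨y, hy, rfl⟩ | ⟨y, hy, rfl⟩
      · exact key l l (h0 l) x hx y hy
      · exact key l l' h x hx y hy
      · exact key l' l (by rwa [abs_sub_comm]) x hx y hy
      · exact key l' l' (h0 l') x hx y hy⟩
  monotone' _ _ h := Finset.union_subset_union (Finset.image_subset_image h)
    (Finset.image_subset_image h)

/-- Contract linearly to a vertex in steps so short that consecutive positions stay close. The union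
of two consecutive positions lies above both, which gives a zigzag of comparable maps from the
inclusion to a constant. Unions double the cardinality and the triangle inequality doubles δ, whence
the requirements on `L'` and `δ'`. -/
lemma CloseSet.incl_mem_bdry (hδ : 0 < δ) (hδ' : 2 * δ ≤ δ')
    (hη : ENNReal.ofReal ((m + 1) * δ') < η) (hL : 2 * L ≤ L') (h1 : δ ≤ δ') (h2 : L ≤ L') (k : ℕ)
    (z : Ch (nerve (CloseSet.{u} δ η L m)) k) (hz : z ∈ redCycle _ k) :
    chMap (nerveMono (CloseSet.incl h1 h2)) k z ∈ bdry (nerve (CloseSet.{u} δ' η L' m)) k := by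
  classical
  let x₀ : stdSimplex ℝ (Fin (m + 1)) := stdSimplex.vertex 0
  -- Steps of length 1/N move points by at most 2/N in ℓ¹, which must be less than δ.
  obtain ⟨N, hN⟩ := exists_nat_gt (2 / δ)
  have hN0 : (0 : ℝ) < N := (by positivity : (0 : ℝ) < 2 / δ).trans hN
  let t : ℕ → Set.Icc (0 : ℝ) 1 := fun i => Set.projIcc 0 1 zero_le_one (i / N : ℝ)
  have ht : ∀ i : ℕ, 2 * |(t i).1 - (t (i + 1)).1| < δ := by
    intro i
    have h3 : |(t i).1 - (t (i + 1)).1| ≤ |(i / N : ℝ) - ((i + 1 : ℕ) / N : ℝ)| := by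
      have := LipschitzWith.dist_le_mul (LipschitzWith.projIcc (zero_le_one (α := ℝ)))
        (i / N : ℝ) ((i + 1 : ℕ) / N : ℝ)
      rwa [NNReal.coe_one, one_mul, Real.dist_eq, Subtype.dist_eq, Real.dist_eq] at this
    have h4 : (i / N : ℝ) - ((i + 1 : ℕ) / N : ℝ) = - (1 / N) := by push_cast; ring
    rw [h4, abs_neg, abs_of_pos (one_div_pos.2 hN0)] at h3
    have h5 : 2 * (1 / (N : ℝ)) < δ := by
      rw [mul_one_div, div_lt_iff₀ hN0]
      rwa [div_lt_iff₀' hδ] at hN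
    linarith
  have ht' : ∀ i : ℕ, 2 * |(t i).1 - (t i).1| < δ := fun i => by simpa using hδ
  let f : ℕ → (CloseSet.{u} δ η L m →o CloseSet.{u} δ' η L' m) := fun i =>
    CloseSet.contr x₀ hδ hδ' hη hL (t i) (t i) (ht' i)
  let g : ℕ → (CloseSet.{u} δ η L m →o CloseSet.{u} δ' η L' m) := fun i =>
    CloseSet.contr x₀ hδ hδ' hη hL (t i) (t (i + 1)) (ht i)
  have hfg : ∀ i, f i ≤ g i := fun i F =>
    Finset.union_subset Finset.subset_union_left Finset.subset_union_left
  have hfg' : ∀ i, f (i + 1) ≤ g i := fun i F =>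
    Finset.union_subset Finset.subset_union_right Finset.subset_union_right
  have hstep : ∀ i, chMap (nerveMono (f 0)) k z - chMap (nerveMono (f i)) k z ∈ bdry _ k := by
    intro i
    induction i with
    | zero => rw [sub_self]; exact zero_mem _
    | succ i ih =>
      have h3 := homotopy_sub_mem_bdry (nerveMonoHomotopy (hfg i)) k hz
      have h4 := homotopy_sub_mem_bdry (nerveMonoHomotopy (hfg' i)) k hz
      have h5 := add_mem ih (sub_mem h3 h4)
      rwa [show ∀ a b c d : Ch (nerve (CloseSet.{u} δ' η L' m)) k,
        a - b + ((b - c) - (d - c)) = a - d from fun a b c d => by abel] at h5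
  have ht0 : t 0 = ⟨0, by simp⟩ := by
    refine Subtype.ext ?_
    simp [t, Set.projIcc]
  have htN : t N = ⟨1, by simp⟩ := by
    refine Subtype.ext ?_
    have : (N : ℝ) / N = 1 := div_self hN0.ne'
    simp [t, Set.projIcc, this]
  have hf0 : f 0 = CloseSet.incl h1 h2 := by
    refine OrderHom.ext _ _ (funext fun F => CloseSet.ext ?_)
    change F.fin.image (fun x => lerp (t 0) x x₀) ∪ F.fin.image (fun x => lerp (t 0) x x₀) = F.fin
    rw [Finset.union_self, ht0]
    refine Eq.trans (Finset.image_congr (g := id) fun x _ => ?_) Finset.image_id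
    exact lerp_zero _ _ _
  have hconst : Close δ' η x₀ x₀ := close_of_dist1_lt hη (by rw [dist1_self]; linarith)
  -- For L = 0 there are no sets at all. Otherwise `L'` is positive and the singleton of the vertex
  -- is admissible.
  by_cases hL0 : L = 0
  · have : IsEmpty (CloseSet.{u} δ η L m) := ⟨fun F => by
      have := F.down.2.1.card_pos
      have := F.down.2.2.1
      omega⟩
    have he : ∀ z : Ch (nerve (CloseSet.{u} δ η L m)) k, z = 0 := by
      intro z
      induction z using FreeAbelianGroup.induction_on with
      | zero => rfl
      | of x => exact this.elim ((x : Fin (k + 1) ⥤ CloseSet.{u} δ η L m).obj 0)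
      | neg x h => rw [h, neg_zero]
      | add a b ha hb => rw [ha, hb, add_zero]
    rw [he z, map_zero]
    exact zero_mem _
  let c₀ : CloseSet.{u} δ' η L' m := ⟨{x₀}, Finset.singleton_nonempty _, by
    rw [Finset.card_singleton]; omega, by
    simpa using hconst⟩
  have hfN : f N = OrderHom.const _ c₀ := by
    refine OrderHom.ext _ _ (funext fun F => CloseSet.ext ?_)
    change F.fin.image (fun x => lerp (t N) x x₀) ∪ F.fin.image (fun x => lerp (t N) x x₀) = {x₀}
    rw [Finset.union_self, htN]
    simp only [lerp_one]
    exact Finset.image_const F.down.2.1 _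
  have h6 := hstep N
  rw [hf0, hfN] at h6
  have h7 := add_mem h6 (nerveMono_const_mem_bdry c₀ k hz)
  rwa [sub_add_cancel] at h7

/-- The cosimplicial preordered set of sets of close points. -/
def closeLevel (δ : ℝ) (η : ENNReal) (L : ℕ) : SimplexCategory ⥤ Preord.{u} where
  obj n := Preord.of (CloseSet.{u} δ η L n.len)
  map {n n'} θ := Preord.ofHom (CloseSet.map.{u} (δ := δ) (η := η) (L := L) (m := n.len) (m' := n'.len)
    θ.toOrderHom)
  map_id n := by
    refine Preord.hom_ext (OrderHom.ext _ _ (funext fun F => CloseSet.ext (Finset.ext fun x => ?_)))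
    refine (CloseSet.mem_map _ _ _).trans ⟨?_, fun hx => ⟨x, hx, stdSimplex.map_id_apply x⟩⟩
    rintro ⟨y, hy, rfl⟩
    exact (congrArg (· ∈ F.fin) (stdSimplex.map_id_apply y)).mpr hy
  map_comp {n n' n''} θ θ' := by
    refine Preord.hom_ext (OrderHom.ext _ _ (funext fun F => CloseSet.ext (Finset.ext fun x => ?_)))
    have hc : ∀ y : stdSimplex ℝ (Fin (n.len + 1)),
        stdSimplex.map θ'.toOrderHom (stdSimplex.map θ.toOrderHom y) =
          stdSimplex.map (θ ≫ θ').toOrderHom y := fun y => stdSimplex.map_comp_apply _ _ y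
    refine (CloseSet.mem_map _ _ _).trans (Iff.trans ?_ (CloseSet.mem_map _ _ _).symm)
    constructor
    · rintro ⟨y, hy, rfl⟩
      exact ⟨_, (CloseSet.mem_map _ _ _).2 ⟨y, hy, rfl⟩, hc y⟩
    · rintro ⟨w, hw, rfl⟩
      obtain ⟨y, hy, rfl⟩ := (CloseSet.mem_map _ _ _).1 hw
      exact ⟨y, hy, (hc y).symm⟩

/-- Weakening of the closeness conditions. -/
def closeLevelMap (hδ : δ ≤ δ') (hL : L ≤ L') : closeLevel.{u} δ η L ⟶ closeLevel.{u} δ' η L' where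
  app _ := Preord.ofHom (CloseSet.incl hδ hL)
  naturality _ _ _ := Preord.hom_ext (OrderHom.ext _ _ (funext fun _ => CloseSet.ext rfl))

/-- The system of cosimplicial preordered sets of sets of close points. -/
def closeSys (δ : ℝ) (hδ : 0 ≤ δ) (η : ENNReal) : ℕ ⥤ (SimplexCategory ⥤ Preord.{u}) where
  obj j := closeLevel (2 ^ j * δ) η (2 ^ j)
  map {i j} h :=
    have h1 : (2 : ℝ) ^ i * δ ≤ 2 ^ j * δ :=
      mul_le_mul_of_nonneg_right (pow_le_pow_right₀ one_le_two h.le) hδ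
    have h2 : (2 : ℕ) ^ i ≤ 2 ^ j := Nat.pow_le_pow_right two_pos h.le
    closeLevelMap h1 h2
  map_id _ := rfl
  map_comp _ _ := rfl

lemma closeLevelMap_kills (hδ : 0 < δ) (hδ' : 2 * δ ≤ δ') (M : ℕ)
    (hη : ENNReal.ofReal ((M + 1) * δ') < η) (hL : 2 * L ≤ L') (h1 : δ ≤ δ') (h2 : L ≤ L') :
    Kills (Functor.whiskerRight (closeLevelMap.{u} (η := η) h1 h2) preordNerve) M := by
  intro m hm k z hz
  refine CloseSet.incl_mem_bdry hδ hδ' (lt_of_le_of_lt (ENNReal.ofReal_le_ofReal ?_) hη) hL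
    h1 h2 k z hz
  have : 0 ≤ δ' := by linarith
  gcongr

lemma closeSys_kills (hδ : 0 < δ) (M j : ℕ)
    (hη : ENNReal.ofReal ((M + 1) * (2 ^ (j + 1) * δ)) < η) :
    Kills (Functor.whiskerRight ((closeSys.{u} δ hδ.le η).map (homOfLE (Nat.le_succ j)))
      preordNerve) M :=
  closeLevelMap_kills (by positivity) (le_of_eq (by ring)) M hη (le_of_eq (pow_succ' 2 j).symm) _ _

lemma closeSys_exists_isModel (hδ : 0 < δ) (M : ℕ)
    (hη : ENNReal.ofReal ((M + 1) * (2 ^ M * δ)) < η) :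
    ∃ b, IsModel ((closeSys.{u} δ hδ.le η).obj M ⋙ preordNerve) M b := by
  classical
  -- The model starts with a singleton in the 0-simplex, admissible at the finest level.
  have h0 : ∀ x : stdSimplex ℝ (Fin 1), Close (2 ^ 0 * δ) η x x := fun x => by
    refine ⟨by rw [dist1_self]; positivity, ?_⟩
    have : qbad x x = ∅ := Set.eq_empty_iff_forall_notMem.2 fun t ht => ht.2 rfl
    rw [this, measure_empty]
    exact bot_le.trans_lt hη
  let c₀ : CloseSet.{u} (2 ^ 0 * δ) η (2 ^ 0) 0 :=
    ⟨{stdSimplex.vertex 0}, Finset.singleton_nonempty _, by simp, by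
      simpa only [Finset.mem_singleton, forall_eq] using h0 _⟩
  refine exists_isModel (fun j => (closeSys.{u} δ hδ.le η).obj j ⋙ preordNerve)
    (fun j => Functor.whiskerRight ((closeSys.{u} δ hδ.le η).map (homOfLE (Nat.le_succ j)))
      preordNerve) M ?_ (show Sx (nerve (CloseSet.{u} (2 ^ 0 * δ) η (2 ^ 0) 0)) 0 from
        ComposableArrows.mk₀ c₀) M le_rfl
  intro j hj
  refine closeSys_kills hδ M j (lt_of_le_of_lt (ENNReal.ofReal_le_ofReal ?_) hη)
  gcongr
  · norm_num
  · omega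

end CloseSets

end

end CatDuality

namespace CatDuality

noncomputable section

open MeasureTheory

/-! ### Choosing parameters in ordered slots -/

section Pick

/-- A parameter in the `j`-th of `K` slots which avoids the set `B`, if there is one. -/
def pick (K j : ℕ) (B : Set ℝ) : UI.{u} :=
  open Classical in
  if h : ∃ t : UI.{u}, ((j : ℝ) - 1) / K < t.down.1 ∧ t.down.1 ≤ j / K ∧ t.down.1 ∉ B then h.choose
  else ⟨⟨1, by simp⟩⟩

/-- A set of measure less than 1/K cannot cover a slot of length 1/K. -/
lemma pick_spec {K j : ℕ} (h1 : 1 ≤ j) (hj : j ≤ K) {B : Set ℝ}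
    (hB : volume B < ENNReal.ofReal (1 / K)) :
    ((j : ℝ) - 1) / K < (pick.{u} K j B).down.1 ∧ (pick.{u} K j B).down.1 ≤ j / K ∧
      (pick.{u} K j B).down.1 ∉ B := by
  have hK : (0 : ℝ) < K := by
    have : 0 < K := by omega
    exact_mod_cast this
  have h : ∃ t : UI.{u}, ((j : ℝ) - 1) / K < t.down.1 ∧ t.down.1 ≤ j / K ∧ t.down.1 ∉ B := by
    have hnot : ¬ Set.Ioc (((j : ℝ) - 1) / K) (j / K) ⊆ B := by
      intro hsub
      have := (measure_mono hsub).trans_lt hB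
      rw [Real.volume_Ioc, ← sub_div, sub_sub_cancel] at this
      exact this.false
    obtain ⟨t, ht, htB⟩ := Set.not_subset.1 hnot
    have h1' : (0 : ℝ) ≤ j - 1 := by
      rw [sub_nonneg]
      exact_mod_cast h1
    have h2' : (j : ℝ) / K ≤ 1 := by
      rw [div_le_one hK]
      exact_mod_cast hj
    exact ⟨⟨⟨t, (div_nonneg h1' hK.le).trans_lt ht.1, ht.2.trans h2'⟩⟩, ht.1, ht.2, htB⟩
  rw [pick, dif_pos h]
  exact h.choose_spec

/-- Parameters in different slots are ordered whatever sets they avoid, so choices made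
independently can still be monotone. -/
lemma pick_le_pick {K j j' : ℕ} (h1 : 1 ≤ j) (hj : j' ≤ K) (h : j < j') {B B' : Set ℝ}
    (hB : volume B < ENNReal.ofReal (1 / K)) (hB' : volume B' < ENNReal.ofReal (1 / K)) :
    pick.{u} K j B ≤ pick.{u} K j' B' := by
  have h2 := (pick_spec.{u} h1 (h.le.trans hj) hB).2.1
  have h3 := (pick_spec.{u} (h1.trans h.le) hj hB').1
  have h4 : (j : ℝ) / K ≤ ((j' : ℝ) - 1) / K := by
    gcongr
    rw [le_sub_iff_add_le]
    exact_mod_cast h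
  exact (h2.trans h4).trans h3.le

end Pick

/-! ### Families of points of the step space with small bad sets -/

section BadData

variable {Y X : SSet.{u}}

lemma stdSimplex_map_injective {m m' : ℕ} {f : Fin (m + 1) → Fin (m' + 1)}
    (hf : Function.Injective f) :
    Function.Injective (stdSimplex.map f : stdSimplex ℝ (Fin (m + 1)) → _) := by
  intro x y h
  have h1 := congrArg (stdSimplex.map (Function.invFun f)) h
  rwa [stdSimplex.map_comp_apply, stdSimplex.map_comp_apply, Function.invFun_comp hf,
    stdSimplex.map_id_apply, stdSimplex.map_id_apply] at h1

/-- The vertices of the `i`-th face of a standard simplex. -/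
abbrev faceHom {m : ℕ} (i : Fin (m + 2)) : Fin (m + 1) →o Fin (m + 2) :=
  (SimplexCategory.δ i).toOrderHom

lemma faceHom_injective {m : ℕ} (i : Fin (m + 2)) : Function.Injective (faceHom i) :=
  (SimplexCategory.mono_iff_injective (f := SimplexCategory.δ i)).1 inferInstance

/-- A family of maps from the standard simplices to the space of maps `nerve UI ⟶ X`, indexed by
the simplices of `Y`, together with small sets away from which the values at close points
agree. -/
structure BadData (Y X : SSet.{u}) (δ : ℝ) (η κ : ENNReal) where
  pt : ∀ {m : ℕ}, Sx Y m → stdSimplex ℝ (Fin (m + 1)) → StepSpace X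
  pt_δ : ∀ {m : ℕ} (s : Sx Y (m + 1)) (i : Fin (m + 2)) (x),
    pt (Y.δ i s) x = pt s (stdSimplex.map (faceHom i) x)
  bad : ∀ {m : ℕ}, Sx Y m → stdSimplex ℝ (Fin (m + 1)) → stdSimplex ℝ (Fin (m + 1)) → Set ℝ
  bad_δ : ∀ {m : ℕ} (s : Sx Y (m + 1)) (i : Fin (m + 2)) (x y),
    bad (Y.δ i s) x y = bad s (stdSimplex.map (faceHom i) x) (stdSimplex.map (faceHom i) y)
  agree : ∀ {m : ℕ} (s : Sx Y m) (x y), Close δ η x y → Agree (bad s x y) (pt s x) (pt s y)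
  volume_bad : ∀ {m : ℕ} (s : Sx Y m) (x y), Close δ η x y → volume (bad s x y) ≤ κ

namespace BadData

variable {δ : ℝ} {η κ : ENNReal} (d : BadData Y X δ η κ)

/-- The union of the sets where the values at the points of a finite set differ. -/
def union {m : ℕ} (s : Sx Y m) (F : Finset (stdSimplex ℝ (Fin (m + 1)))) : Set ℝ :=
  ⋃ x ∈ F, ⋃ y ∈ F, d.bad s x y

lemma bad_subset_union {m : ℕ} (s : Sx Y m) {F : Finset (stdSimplex ℝ (Fin (m + 1)))}
    {x y : stdSimplex ℝ (Fin (m + 1))} (hx : x ∈ F) (hy : y ∈ F) : d.bad s x y ⊆ d.union s F := by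
  intro t ht
  exact Set.mem_biUnion hx (Set.mem_biUnion hy ht)

lemma union_mono {m : ℕ} (s : Sx Y m) {F F' : Finset (stdSimplex ℝ (Fin (m + 1)))} (h : F ⊆ F') :
    d.union s F ⊆ d.union s F' :=
  Set.iUnion₂_subset fun _ hx => Set.iUnion₂_subset fun _ hy =>
    d.bad_subset_union s (h hx) (h hy)

variable {L K : ℕ}

/-- At most L² pairs of points contribute, each a set of measure at most κ. -/
lemma volume_union_lt (hK : (L * L : ENNReal) * κ < ENNReal.ofReal (1 / K)) {m : ℕ} (s : Sx Y m)
    (F : CloseSet.{u} δ η L m) : volume (d.union s F.fin) < ENNReal.ofReal (1 / K) := by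
  refine lt_of_le_of_lt ?_ hK
  have hc : (F.fin.card : ENNReal) ≤ L := by exact_mod_cast F.down.2.2.1
  calc volume (d.union s F.fin) ≤ ∑ x ∈ F.fin, volume (⋃ y ∈ F.fin, d.bad s x y) :=
        measure_biUnion_finset_le _ _
    _ ≤ ∑ x ∈ F.fin, ∑ y ∈ F.fin, volume (d.bad s x y) :=
        Finset.sum_le_sum fun x _ => measure_biUnion_finset_le _ _
    _ ≤ ∑ x ∈ F.fin, ∑ y ∈ F.fin, κ :=
        Finset.sum_le_sum fun x hx => Finset.sum_le_sum fun y hy =>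
          d.volume_bad s x y (F.down.2.2.2 x hx y hy)
    _ = F.fin.card * (F.fin.card * κ) := by simp
    _ ≤ L * (L * κ) := by gcongr
    _ = L * L * κ := by rw [mul_assoc]

/-- The parameter chosen for a set of close points. -/
def param (a K : ℕ) {m : ℕ} (s : Sx Y m) (F : CloseSet.{u} δ η L m) : UI.{u} :=
  pick K (a + F.fin.card) (d.union s F.fin)

lemma param_notMem {a : ℕ} (hK : (L * L : ENNReal) * κ < ENNReal.ofReal (1 / K)) (ha : a + L ≤ K)
    {m : ℕ} (s : Sx Y m) (F : CloseSet.{u} δ η L m) :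
    (d.param a K s F).down.1 ∉ d.union s F.fin := by
  have h1 := F.down.2.1.card_pos
  have h2 := F.down.2.2.1
  exact (pick_spec (by change 1 ≤ a + F.down.1.card; omega)
    (by change a + F.down.1.card ≤ K; omega) (d.volume_union_lt hK s F)).2.2

/-- A strictly larger set has more elements, hence a later slot. -/
lemma param_mono {a : ℕ} (hK : (L * L : ENNReal) * κ < ENNReal.ofReal (1 / K)) (ha : a + L ≤ K)
    {m : ℕ} (s : Sx Y m) {F F' : CloseSet.{u} δ η L m} (h : F ≤ F') :
    d.param a K s F ≤ d.param a K s F' := by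
  have hle : F.fin ⊆ F'.fin := h
  rcases hle.eq_or_ssubset with he | hs
  · rw [CloseSet.ext he]
  · have h1 := F.down.2.1.card_pos
    have h2 : F'.fin.card ≤ L := F'.down.2.2.1
    refine pick_le_pick (by change 1 ≤ a + F.down.1.card; omega) (by omega) ?_
      (d.volume_union_lt hK s F) (d.volume_union_lt hK s F')
    exact Nat.add_lt_add_left (Finset.card_lt_card hs) a

/-- Shifting the slots makes the parameters of two unrelated data comparable. -/
lemma param_le_param {Y' X' : SSet.{u}} (d' : BadData Y' X' δ η κ) {a a' : ℕ}
    (hK : (L * L : ENNReal) * κ < ENNReal.ofReal (1 / K)) (haa : a < a') (ha : a' + L ≤ K)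
    {m : ℕ} (s : Sx Y m) (s' : Sx Y' m) (F : CloseSet.{u} δ η L m) :
    d.param a K s F ≤ d'.param a' K s' F := by
  have h1 := F.down.2.1.card_pos
  have h2 : F.fin.card ≤ L := F.down.2.2.1
  exact pick_le_pick (by change 1 ≤ a + F.down.1.card; omega) (by omega) (by omega)
    (d.volume_union_lt hK s F) (d'.volume_union_lt hK s' F)

/-- Slots are indexed by cardinality, which injective maps preserve but degeneracies need not. This
is why families are only asked to respect faces. -/
lemma card_map {m : ℕ} (i : Fin (m + 2)) (F : CloseSet.{u} δ η L m) :
    (CloseSet.map (faceHom i) F).fin.card = F.fin.card := by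
  classical
  have : (CloseSet.map (faceHom i) F).fin = F.fin.image (stdSimplex.map (faceHom i)) := by
    ext y
    rw [CloseSet.mem_map, Finset.mem_image]
  rw [this]
  exact Finset.card_image_of_injective _ (stdSimplex_map_injective (faceHom_injective i))

lemma union_map {m : ℕ} (s : Sx Y (m + 1)) (i : Fin (m + 2)) (F : CloseSet.{u} δ η L m) :
    d.union s (CloseSet.map (faceHom i) F).fin = d.union (Y.δ i s) F.fin := by
  ext t
  simp only [union, Set.mem_iUnion, CloseSet.mem_map, exists_prop, exists_exists_and_eq_and,
    d.bad_δ]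

lemma param_map (a K : ℕ) {m : ℕ} (s : Sx Y (m + 1)) (i : Fin (m + 2)) (F : CloseSet.{u} δ η L m) :
    d.param a K s (CloseSet.map (faceHom i) F) = d.param a K (Y.δ i s) F := by
  rw [param, param, union_map, card_map]

/-- The family of monotone maps given by the data. -/
def mono (a K : ℕ) (hK : (L * L : ENNReal) * κ < ENNReal.ofReal (1 / K)) (ha : a + L ≤ K) :
    MonoFamily Y (closeLevel.{u} δ η L) (AgreePt X) where
  map {m} s :=
    { toFun := fun F : CloseSet.{u} δ η L m =>
        ⟨(d.pt s '' F.fin, d.union s F.fin, d.param a K s F), by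
          refine ⟨?_, ?_, d.param_notMem hK ha s F⟩
          · exact Set.Nonempty.image _ F.down.2.1
          · rintro _ ⟨x, hx, rfl⟩ _ ⟨y, hy, rfl⟩
            exact (d.agree s x y (F.down.2.2.2 x hx y hy)).mono (d.bad_subset_union s hx hy)⟩
      monotone' := fun F F' h =>
        ⟨Set.image_mono (Finset.coe_subset.2 h), d.union_mono s h, d.param_mono hK ha s h⟩ }
  map_δ {m} s i := by
    refine OrderHom.ext _ _ (funext fun F => Subtype.ext ?_)
    let F : CloseSet.{u} δ η L m := F
    refine Prod.ext ?_ (Prod.ext (d.union_map s i F).symm (d.param_map a K s i F).symm)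
    change d.pt (Y.δ i s) '' F.fin = d.pt s '' (CloseSet.map (faceHom i) F).fin
    ext ρ
    constructor
    · rintro ⟨x, hx, rfl⟩
      exact ⟨_, (CloseSet.mem_map _ _ _).2 ⟨x, hx, rfl⟩, (d.pt_δ s i x).symm⟩
    · rintro ⟨y, hy, rfl⟩
      obtain ⟨x, hx, rfl⟩ := (CloseSet.mem_map _ _ _).1 hy
      exact ⟨x, hx, d.pt_δ s i x⟩

end BadData

variable (X) in
/-- A set away from which two maps agree, small if possible. -/
def badSet (η : ENNReal) (ρ ρ' : StepSpace X) : Set ℝ :=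
  open Classical in
  if h : edist ρ ρ' < η then (exists_agree h).choose else Set.univ

lemma agree_badSet {η : ENNReal} {ρ ρ' : StepSpace X} (h : edist ρ ρ' < η) :
    Agree (badSet X η ρ ρ') ρ ρ' := by
  rw [badSet, dif_pos h]
  exact (exists_agree h).choose_spec.1

lemma volume_badSet_lt {η : ENNReal} {ρ ρ' : StepSpace X} (h : edist ρ ρ' < η) :
    volume (badSet X η ρ ρ') < η := by
  rw [badSet, dif_pos h]
  exact (exists_agree h).choose_spec.2

lemma qbad_map {m m' : ℕ} {f : Fin (m + 1) →o Fin (m' + 1)} (hf : Function.Injective f)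
    (x y : stdSimplex ℝ (Fin (m + 1))) :
    qbad (stdSimplex.map f x) (stdSimplex.map f y) = qbad x y := by
  refine Set.Subset.antisymm (qbad_map_subset f x y) ?_
  rintro t ⟨ht, h⟩
  refine ⟨ht, ?_⟩
  rw [quant_map f _ ht.1 ht.2, quant_map f _ ht.1 ht.2]
  exact hf.ne h

variable (X) in
/-- The simplices of the singular simplicial set which send close points to close points. -/
def fineSub (δ : ℝ) (η : ENNReal) : (TopCat.toSSet.obj (StepTop X)).Subcomplex where
  obj n := {s | ∀ x y : stdSimplex ℝ (Fin (n.unop.len + 1)), Close δ η x y →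
    edist (TopCat.toSSetObjEquiv (StepTop X) n s x : StepSpace X)
      (TopCat.toSSetObjEquiv (StepTop X) n s y : StepSpace X) < η}
  map g _ hs _ _ h := hs _ _ (h.map g.unop.toOrderHom)

variable (X) in
/-- The canonical map into the fine singular simplices. -/
def toFine (δ : ℝ) (η : ENNReal) : X ⟶ fineSub X δ η :=
  SSet.Subcomplex.lift (toStep X) (by
    rintro n _ ⟨σ, rfl⟩ x y h
    -- The measure clause of `Close` gives this bound with no constant depending on the dimension.
    exact (edist_stepPt_le (m := n.unop.len) σ x y).trans_lt h.2)

lemma toFine_ι (δ : ℝ) (η : ENNReal) : toFine X δ η ≫ (fineSub X δ η).ι = toStep X := rfl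

variable (X) in
/-- The tautological data on the fine singular simplices. -/
def fineData (δ : ℝ) (η : ENNReal) : BadData (fineSub X δ η) X δ η (η + η) where
  pt {m} s x := TopCat.toSSetObjEquiv (StepTop X) (op (.mk m)) s.1 x
  pt_δ _ _ _ := rfl
  bad {m} s x y := badSet X η (TopCat.toSSetObjEquiv (StepTop X) (op (.mk m)) s.1 x)
    (TopCat.toSSetObjEquiv (StepTop X) (op (.mk m)) s.1 y)
  bad_δ _ _ _ _ := rfl
  agree s x y h := agree_badSet (s.2 x y h)
  volume_bad s x y h := (volume_badSet_lt (s.2 x y h)).le.trans le_self_add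

variable (X) in
/-- The data on the simplices of `X`, with the larger bad sets. -/
def bothData (δ : ℝ) (η : ENNReal) : BadData X X δ η (η + η) where
  pt σ x := stepPt σ x
  pt_δ s i x := stepPt_map (SimplexCategory.δ i) s x
  bad σ x y := badSet X η (stepPt σ x) (stepPt σ y) ∪ qbad x y
  bad_δ s i x y := by
    rw [qbad_map (faceHom_injective i)]
    congr 2
    · exact stepPt_map (SimplexCategory.δ i) s x
    · exact stepPt_map (SimplexCategory.δ i) s y
  agree σ x y _ := (agree_stepPt σ x y).mono Set.subset_union_right
  volume_bad σ x y h := (measure_union_le _ _).trans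
    (add_le_add (volume_badSet_lt ((edist_stepPt_le σ x y).trans_lt h.2)).le h.2.le)

variable (X) in
/-- The data on the simplices of `X`, with the bad sets of the quantiles. -/
def quantData (δ : ℝ) (η : ENNReal) : BadData X X δ η (η + η) where
  pt σ x := stepPt σ x
  pt_δ s i x := stepPt_map (SimplexCategory.δ i) s x
  bad _ x y := qbad x y
  bad_δ _ i x y := (qbad_map (faceHom_injective i) x y).symm
  agree σ x y _ := agree_stepPt σ x y
  volume_bad _ _ _ h := h.2.le.trans le_self_add

end BadData

end

end CatDuality

namespace CatDuality

noncomputable section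

open MeasureTheory

/-! ### The quantile family factors through the characteristic maps -/

section QuantMono

variable {X : SSet.{u}} {δ : ℝ} {η : ENNReal} {L K : ℕ}

/-- The parameter chosen for a set of close points, with respect to the quantiles. -/
def quantParam (K : ℕ) {m : ℕ} (F : CloseSet.{u} δ η L m) : UI.{u} :=
  (quantData (ordNerve.{u}.obj (.mk m)) δ η).param 0 K (ordFund m) F

/-- The common value of the quantile functions of the points of a set of close points. -/
def quantVal (K : ℕ) {m : ℕ} (F : CloseSet.{u} δ η L m) : Fin (m + 1) :=
  quant F.down.2.1.choose (quantParam K F).down.1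

variable (hK : (L * L : ENNReal) * (η + η) < ENNReal.ofReal (1 / K)) (hL : 0 + L ≤ K)

include hK hL in
-- The chosen parameter avoids every set on which two members have different quantiles.
lemma quantVal_eq {m : ℕ} {F : CloseSet.{u} δ η L m} {x : stdSimplex ℝ (Fin (m + 1))}
    (hx : x ∈ F.fin) : quantVal K F = quant x (quantParam K F).down.1 := by
  by_contra h
  exact (quantData (ordNerve.{u}.obj (.mk m)) δ η).param_notMem hK hL (ordFund m) F
    ((quantData (ordNerve.{u}.obj (.mk m)) δ η).bad_subset_union (ordFund m)
      F.down.2.1.choose_spec hx ⟨(quantParam K F).down.2, h⟩)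

/-- The common value of the quantile functions, as a monotone map. -/
def quantMono (m : ℕ) : CloseSet.{u} δ η L m →o ULift.{u} (Fin (m + 1)) where
  toFun F := ⟨quantVal K F⟩
  monotone' F F' h := by
    change quantVal K F ≤ quantVal K F'
    have hx := F.down.2.1.choose_spec
    have hx' : F.down.2.1.choose ∈ F'.fin := h hx
    rw [quantVal_eq hK hL hx, quantVal_eq hK hL hx']
    exact quant_mono _ ((quantData _ δ η).param_mono hK hL (ordFund m) h)
      (quantParam K F').down.2.2

lemma quantMono_map {m : ℕ} (i : Fin (m + 2)) :
    (quantMono (δ := δ) hK hL (m + 1)).comp (CloseSet.map (faceHom i)) =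
      (ordPreord.{u}.map (SimplexCategory.δ i)).hom.comp (quantMono hK hL m) := by
  refine OrderHom.ext _ _ (funext fun F => ULift.ext _ _ ?_)
  change quantVal K (CloseSet.map (faceHom i) F) = faceHom i (quantVal K F)
  have hx := F.down.2.1.choose_spec
  -- The bad sets of `quantData` ignore the simplex, so the parameter for a face of `ordFund (m +
  -- 1)` is the one for `ordFund m`.
  have hp : quantParam K (CloseSet.map (faceHom i) F) = quantParam K F :=
    (quantData (ordNerve.{u}.obj (.mk (m + 1))) δ η).param_map 0 K (ordFund (m + 1)) i F
  rw [quantVal_eq hK hL ((CloseSet.mem_map _ _ _).2 ⟨_, hx, rfl⟩), quantVal_eq hK hL hx, hp,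
    quant_map _ _ (quantParam K F).down.2.1 (quantParam K F).down.2.2]

/-- The map of nerves given by the common value of the quantile functions. -/
def quantNerve (m : ℕ) : (closeLevel.{u} δ η L ⋙ preordNerve).obj (.mk m) ⟶ ordNerve.{u}.obj (.mk m) :=
  preordNerve.map (Preord.ofHom (quantMono hK hL m))

lemma quantNerve_δ (m : ℕ) (i : Fin (m + 2)) :
    (closeLevel.{u} δ η L ⋙ preordNerve).map (SimplexCategory.δ i) ≫ quantNerve hK hL (m + 1) =
      quantNerve hK hL m ≫ ordNerve.{u}.map (SimplexCategory.δ i) := by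
  have h : (closeLevel.{u} δ η L).map (SimplexCategory.δ i) ≫
      Preord.ofHom (quantMono hK hL (m + 1)) =
      Preord.ofHom (quantMono hK hL m) ≫ ordPreord.{u}.map (SimplexCategory.δ i) :=
    Preord.hom_ext (quantMono_map hK hL i)
  have h1 := congrArg (fun f => preordNerve.map f) h
  exact (preordNerve.map_comp _ _).symm.trans (h1.trans (preordNerve.map_comp _ _))

/-- Evaluating a step map at the chosen parameters reads off the common quantiles, so evaluation
passes through the vertices of Δᵐ. A model of close sets thereby becomes a model in the standard
simplices, where models are unique up to homotopy. -/
lemma quantData_eval {m : ℕ} (σ : Sx X m) :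
    nerveMono (((quantData X δ η).mono 0 K hK hL).map σ) ≫ AgreePt.eval X =
      quantNerve hK hL m ≫ evalAlong (ordDown m) σ := by
  refine NatTrans.ext (funext fun n => ConcreteCategory.hom_ext _ _ fun F => ?_)
  let F : Fin (n.unop.len + 1) ⥤ CloseSet.{u} δ η L m := F
  let P := ((quantData X δ η).mono 0 K hK hL).map σ
  have hx := (F.obj 0).down.2.1.choose_spec
  have h1 := AgreePt.evalApp_eq n (F ⋙ P.monotone.functor) (p := P (F.obj 0)) le_rfl
    (ρ := stepPt σ (F.obj 0).down.2.1.choose) ⟨_, hx, rfl⟩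
  refine h1.trans ?_
  refine (evalAlong_app _ _ _ _).trans (Eq.trans ?_ (evalAlong_app _ _ _ _).symm)
  refine congrArg (fun h : n.unop ⟶ SimplexCategory.mk m => X.map h.op σ) ?_
  refine SimplexCategory.Hom.ext _ _ (OrderHom.ext _ _ (funext fun i => ?_))
  have hx' : (F.obj 0).down.2.1.choose ∈ (F.obj i).fin :=
    (F.map (homOfLE (Fin.zero_le i))).le hx
  exact (quantVal_eq hK hL hx').symm

lemma quantData_push_sub_mem_bdry {M : ℕ}
    {b : ∀ m, Ch ((closeLevel.{u} δ η L ⋙ preordNerve).obj (.mk m)) m}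
    (hb : IsModel (closeLevel.{u} δ η L ⋙ preordNerve) M b) {m : ℕ} (hm : m ≤ M) {z : Ch X m}
    (hz : z ∈ redCycle X m) :
    chMap (AgreePt.eval X) m (((quantData X δ η).mono 0 K hK hL).toFace.push (b m) z) - z ∈
      bdry X m := by
  have h1 := charFamily_push_sub_mem_bdry (hb.map_of_faces (quantNerve hK hL) (quantNerve_δ hK hL)) hm hz
  rwa [FaceFamily.chMap_push_eq (χ := charFamily X) (α := quantNerve hK hL m)
    fun σ => quantData_eval hK hL σ]

end QuantMono

/-! ### Contractible realization implies acyclic chains -/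

section Contractible

lemma chMap_injective {X Y : SSet.{u}} (f : X ⟶ Y) (k : ℕ)
    (hf : Function.Injective (f.app (op (.mk k)))) : Function.Injective (chMap f k) := by
  classical
  let g : Ch Y k →+ Ch X k := FreeAbelianGroup.lift fun y =>
    if h : ∃ x, f.app (op (.mk k)) x = y then .of h.choose else 0
  have hg : ∀ z, g (chMap f k z) = z := by
    intro z
    induction z using FreeAbelianGroup.induction_on with
    | zero => simp
    | of x =>
      have h : ∃ x', f.app (op (.mk k)) x' = f.app (op (.mk k)) x := ⟨x, rfl⟩
      rw [chMap_of, FreeAbelianGroup.lift_apply_of, dif_pos h]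
      exact congrArg _ (hf h.choose_spec)
    | neg x h => simp only [map_neg, h]
    | add a b ha hb => simp only [map_add, ha, hb]
  exact Function.LeftInverse.injective hg

variable {X : SSet.{u}}

/-- The simplex is compact, so the singular simplex is uniformly continuous; the ℓ¹-distance
dominates the sup-distance. -/
lemma exists_fine {m : ℕ} (s : Sx (TopCat.toSSet.obj (StepTop X)) m) {η : ENNReal} (hη : 0 < η) :
    ∃ δ₀ > 0, ∀ δ ≤ δ₀, s ∈ (fineSub X δ η).obj (op (.mk m)) := by
  let g := TopCat.toSSetObjEquiv (StepTop X) (op (.mk m)) s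
  have hu : UniformContinuous (g : stdSimplex ℝ (Fin (m + 1)) → StepSpace X) :=
    CompactSpace.uniformContinuous_of_continuous g.continuous
  obtain ⟨ε, hε, h⟩ := EMetric.uniformContinuous_iff.1 hu η hη
  obtain ⟨r, hr, hr'⟩ : ∃ r : ℝ, 0 < r ∧ ENNReal.ofReal r < ε := by
    obtain ⟨r, hr, hr'⟩ := ENNReal.lt_iff_exists_nnreal_btwn.1 hε
    exact ⟨r, by exact_mod_cast hr, by simpa using hr'⟩
  refine ⟨r, hr, fun δ hδ x y hxy => h (lt_of_le_of_lt ?_ hr')⟩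
  rw [edist_dist]
  refine ENNReal.ofReal_le_ofReal (le_trans ?_ (hxy.1.le.trans hδ))
  refine (dist_pi_le_iff (Finset.sum_nonneg fun _ _ => abs_nonneg _)).2 fun i => ?_
  exact Finset.single_le_sum (f := fun i => |x i - y i|) (fun _ _ => abs_nonneg _)
    (Finset.mem_univ i)

lemma exists_fine_lift {m : ℕ} (w : Ch (TopCat.toSSet.obj (StepTop X)) m) {η : ENNReal}
    (hη : 0 < η) : ∃ δ₀ > 0, ∀ δ ≤ δ₀, ∃ w', chMap (fineSub X δ η).ι m w' = w := by
  induction w using FreeAbelianGroup.induction_on with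
  | zero => exact ⟨1, one_pos, fun _ _ => ⟨0, map_zero _⟩⟩
  | of s =>
    obtain ⟨δ₀, h0, h⟩ := exists_fine s hη
    exact ⟨δ₀, h0, fun δ hδ => ⟨.of ⟨s, h δ hδ⟩, chMap_of _ _ _⟩⟩
  | neg x h =>
    obtain ⟨δ₀, h0, h⟩ := h
    refine ⟨δ₀, h0, fun δ hδ => ?_⟩
    obtain ⟨w', hw'⟩ := h δ hδ
    exact ⟨-w', by rw [map_neg, hw']⟩
  | add a b ha hb =>
    obtain ⟨δ₀, h0, h⟩ := ha
    obtain ⟨δ₁, h1, h'⟩ := hb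
    refine ⟨min δ₀ δ₁, lt_min h0 h1, fun δ hδ => ?_⟩
    obtain ⟨w, hw⟩ := h δ (hδ.trans (min_le_left _ _))
    obtain ⟨w', hw'⟩ := h' δ (hδ.trans (min_le_right _ _))
    exact ⟨w + w', by rw [map_add, hw, hw']⟩

/-- A reduced cycle of a simplicial set with contractible geometric realization is a boundary. -/
lemma mem_bdry_of_contractibleSpace [ContractibleSpace (SSet.toTop.obj X)] {k : ℕ} {z : Ch X k}
    (hz : z ∈ redCycle X k) : z ∈ bdry X k := by
  obtain ⟨w, hw⟩ := chMap_toStep_mem_bdry hz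
  -- The bounding chain has degree k + 1, so the model must exist up to that degree.
  obtain ⟨M, hM⟩ : ∃ M, M = k + 1 := ⟨_, rfl⟩
  -- The system has M stages to build the model and M + 1 more for the homotopies; cardinalities
  -- double at each stage.
  obtain ⟨T, hT⟩ : ∃ T, T = M + M + 1 := ⟨_, rfl⟩
  obtain ⟨L, hL⟩ : ∃ L, L = 2 ^ T := ⟨_, rfl⟩
  have hLpos : (0 : ℝ) < L := by rw [hL]; positivity
  -- Chosen so that L² bad sets of measure at most 2r have total measure at most half a slot of
  -- length 1/(1 + L).
  obtain ⟨r, hr⟩ : ∃ r : ℝ, r = 1 / (4 * L * L * (1 + L)) := ⟨_, rfl⟩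
  have hrpos : 0 < r := by rw [hr]; positivity
  obtain ⟨η, hη⟩ : ∃ η, η = ENNReal.ofReal r := ⟨_, rfl⟩
  have hηpos : 0 < η := by rw [hη]; exact ENNReal.ofReal_pos.2 hrpos
  -- There is one slot more than the maximal cardinality, to allow a shift by one.
  have hK : (L * L : ENNReal) * (η + η) < ENNReal.ofReal (1 / (1 + L : ℕ)) := by
    rw [hη, ← ENNReal.ofReal_add hrpos.le hrpos.le, ← ENNReal.ofReal_natCast,
      ← ENNReal.ofReal_mul hLpos.le, ← ENNReal.ofReal_mul (by positivity),
      ENNReal.ofReal_lt_ofReal_iff (by positivity)]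
    have h1 : (L * L : ℝ) * (r + r) = 1 / (2 * (1 + L)) := by
      rw [hr]
      field_simp
      ring
    rw [h1]
    push_cast
    refine one_div_lt_one_div_of_lt (by positivity) (by linarith)
  obtain ⟨δ₁, hδ₁, hfine⟩ := exists_fine_lift w hηpos
  -- Even at the last, coarsest stage, close points must be fine for the simplices of `w`, and
  -- ℓ¹-closeness must imply closeness of quantiles in dimensions up to M.
  obtain ⟨δ, hδ, hδ1, hδ2⟩ : ∃ δ > 0, 2 ^ T * δ ≤ δ₁ ∧ (M + 1) * (2 ^ T * δ) < r := by
    have h1 : 0 < r / (2 * ((M : ℝ) + 1) * 2 ^ T) := by positivity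
    have h2 : 0 < δ₁ / 2 ^ T := by positivity
    refine ⟨_, lt_min h1 h2, ?_, ?_⟩
    · rw [← le_div_iff₀' (by positivity)]
      exact min_le_right _ _
    · have h3 := min_le_left (r / (2 * ((M : ℝ) + 1) * 2 ^ T)) (δ₁ / 2 ^ T)
      have h4 : ((M : ℝ) + 1) * (2 ^ T * (r / (2 * ((M : ℝ) + 1) * 2 ^ T))) = r / 2 := by
        field_simp
      calc _ ≤ ((M : ℝ) + 1) * (2 ^ T * (r / (2 * ((M : ℝ) + 1) * 2 ^ T))) := by gcongr
        _ < r := by rw [h4]; linarith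
  have hη' : ∀ j ≤ T, ENNReal.ofReal ((M + 1) * (2 ^ j * δ)) < η := by
    intro j hj
    rw [hη, ENNReal.ofReal_lt_ofReal_iff hrpos]
    refine lt_of_le_of_lt ?_ hδ2
    gcongr
    norm_num
  obtain ⟨b₀, hb₀⟩ := closeSys_exists_isModel.{u} hδ M (hη' M (by omega))
  have hkill : ∀ j ≤ M, Kills (Functor.whiskerRight ((closeSys.{u} δ hδ.le η).map
      (homOfLE (show M + j ≤ M + j + 1 by omega))) preordNerve) M := fun j hj =>
    closeSys_kills hδ M (M + j) (hη' _ (by omega))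
  subst hT hL
  let ι := Functor.whiskerRight ((closeSys.{u} δ hδ.le η).map
    (homOfLE (show M ≤ M + M + 1 by omega))) preordNerve
  let b := mapModel ι b₀
  have hb : IsModel (closeLevel.{u} (2 ^ (M + M + 1) * δ) η (2 ^ (M + M + 1)) ⋙ preordNerve) M b :=
    hb₀.map ι
  have hcast : (0 : ℕ) + 2 ^ (M + M + 1) ≤ 1 + 2 ^ (M + M + 1) := by omega
  let fam := (fineData X (2 ^ (M + M + 1) * δ) η).mono 0 (1 + 2 ^ (M + M + 1)) hK hcast
  let famB := (bothData X (2 ^ (M + M + 1) * δ) η).mono 1 (1 + 2 ^ (M + M + 1)) hK le_rfl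
  let famQ := (quantData X (2 ^ (M + M + 1) * δ) η).mono 0 (1 + 2 ^ (M + M + 1)) hK hcast
  let famS := fam.restr (toFine X (2 ^ (M + M + 1) * δ) η)
  -- The bad sets of `bothData` contain those of the two other data and its slots are shifted by
  -- one, so it dominates both; this gives a zigzag between them.
  have hS : ∀ {m : ℕ} (s : Sx X m), famS.map s ≤ famB.map s := by
    intro m s F
    refine ⟨le_rfl, ?_, ?_⟩
    · exact Set.iUnion₂_mono fun x _ => Set.iUnion₂_mono fun y _ => Set.subset_union_left
    · exact BadData.param_le_param (fineData X (2 ^ (M + M + 1) * δ) η)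
        (bothData X (2 ^ (M + M + 1) * δ) η) hK one_pos le_rfl _ s F
  have hQ : ∀ {m : ℕ} (s : Sx X m), famQ.map s ≤ famB.map s := by
    intro m s F
    refine ⟨le_rfl, ?_, ?_⟩
    · exact Set.iUnion₂_mono fun x _ => Set.iUnion₂_mono fun y _ => Set.subset_union_right
    · exact BadData.param_le_param (quantData X (2 ^ (M + M + 1) * δ) η)
        (bothData X (2 ^ (M + M + 1) * δ) η) hK one_pos le_rfl s s F
  have hkM : k ≤ M := by omega
  have hSB := MonoFamily.push_sub_mem_bdry (closeSys.{u} δ hδ.le η) M M hkill hb₀ famS famB hS hkM hz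
  have hQB := MonoFamily.push_sub_mem_bdry (closeSys.{u} δ hδ.le η) M M hkill hb₀ famQ famB hQ hkM hz
  have hQz := quantData_push_sub_mem_bdry hK hcast hb hkM hz
  obtain ⟨w', hw'⟩ := hfine _ hδ1
  have hbd : bd _ k w' = chMap (toFine X (2 ^ (M + M + 1) * δ) η) k z := by
    refine chMap_injective (fineSub X (2 ^ (M + M + 1) * δ) η).ι k Subtype.val_injective ?_
    rw [← bd_chMap, hw', hw, ← chMap_comp, toFine_ι]
  -- On fine simplices the image of z is the boundary of the lift of `w`, and pushing the model
  -- preserves boundaries.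
  have hSz : famS.toFace.push (b k) z ∈ bdry _ k := by
    have h1 := fam.toFace.push_mem_bdry hb (m := k) (by omega) (z := bd _ k w') ⟨w', rfl⟩
    rw [hbd] at h1
    exact (FaceFamily.restr_push fam.toFace _ (b k) z).symm ▸ h1
  have hmem : ∀ {A : Type u} [AddCommGroup A] (H : AddSubgroup A) {x y w : A}, x ∈ H → x - y ∈ H →
      w - y ∈ H → w ∈ H := by
    intro A _ H x y w h1 h2 h3
    have h4 := add_mem (sub_mem h1 h2) h3
    rwa [sub_sub_cancel, add_sub_cancel] at h4
  -- The zigzag makes the quantile push of z a boundary, and its evaluation in X is homologous to z.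
  have h1 := chMap_mem_bdry (AgreePt.eval X) k (hmem _ hSz hSB hQB)
  have h2 := sub_mem h1 hQz
  exact (congrArg (· ∈ bdry X k) (sub_sub_cancel _ _)).mp h2

/-- If X had no vertex it would be empty and map to the singular set of the empty space; by
adjunction |X| would be empty. -/
lemma nonempty_of_contractibleSpace (X : SSet.{u}) [ContractibleSpace (SSet.toTop.obj X)] :
    Nonempty (Sx X 0) := by
  by_contra h
  have hX : ∀ n : SimplexCategoryᵒᵖ, IsEmpty (X.obj n) := fun n =>
    ⟨fun x => h ⟨X.map (SimplexCategory.const (.mk 0) n.unop 0).op x⟩⟩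
  let f : X ⟶ TopCat.toSSet.obj (TopCat.of PEmpty.{u + 1}) :=
    { app := fun n => ↾fun x => (hX n).elim x
      naturality := fun n _ _ => ConcreteCategory.hom_ext _ _ fun x => (hX n).elim x }
  obtain ⟨p⟩ : Nonempty (SSet.toTop.obj X) := inferInstance
  exact ((sSetTopAdj.homEquiv X (TopCat.of PEmpty.{u + 1})).symm f p : PEmpty).elim

end Contractible

end

end CatDuality

namespace CatDuality

noncomputable section

/-! ### Pointwise exactness and projective resolutions -/

section ModuleExact

variable {C : Type u} [SmallCategory C]

lemma LMod.exact_iff {S : ShortComplex (LMod C)} :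
    S.Exact ↔ ∀ (x : C) (b : S.X₂.obj x), S.g.app x b = 0 → ∃ a, S.f.app x a = b := by
  have h : S.Exact ↔ ∀ x, (S.map ((evaluation C AddCommGrpCat.{u}).obj x)).Exact := by
    refine ⟨fun h x => h.map _, fun h => ?_⟩
    rw [S.exact_iff_isZero_homology, Functor.isZero_iff]
    intro x
    exact ((ShortComplex.exact_iff_isZero_homology _).1 (h x)).of_iso
      (S.mapHomologyIso ((evaluation C AddCommGrpCat.{u}).obj x)).symm
  rw [h]
  exact forall_congr' fun x => ShortComplex.ab_exact_iff _

lemma LMod.epi_iff {F G : LMod C} (f : F ⟶ G) :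
    Epi f ↔ ∀ x, Function.Surjective (f.app x) := by
  rw [NatTrans.epi_iff_epi_app]
  exact forall_congr' fun x => AddCommGrpCat.epi_iff_surjective _

lemma LMod.mono_iff {F G : LMod C} (f : F ⟶ G) :
    Mono f ↔ ∀ x, Function.Injective (f.app x) := by
  rw [NatTrans.mono_iff_mono_app]
  exact forall_congr' fun x => AddCommGrpCat.mono_iff_injective _

/-- A projective resolution from an exact sequence. -/
def mkResolution {A : Type*} [Category* A] [Abelian A] {Z : A} (K : ChainComplex A ℕ)
    (hK : ∀ m, Projective (K.X m)) (ε : K.X 0 ⟶ Z) (w : K.d 1 0 ≫ ε = 0) (hε : Epi ε)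
    (h0 : (ShortComplex.mk _ _ w).Exact)
    (hs : ∀ k, (ShortComplex.mk _ _ (K.d_comp_d (k + 2) (k + 1) k)).Exact) :
    ProjectiveResolution Z where
  complex := K
  projective := hK
  π := (ChainComplex.toSingle₀Equiv _ _).symm ⟨ε, w⟩
  quasiIso := ⟨fun n => by
    cases n with
    | zero =>
      rw [ChainComplex.quasiIsoAt₀_iff, ShortComplex.quasiIso_iff_of_zeros']
      · refine (ShortComplex.exact_and_epi_g_iff_of_iso ?_).2 ⟨h0, hε⟩
        exact ShortComplex.isoMk (Iso.refl _) (Iso.refl _) (Iso.refl _)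
          ((Category.id_comp _).trans (Category.comp_id _).symm)
          ((Category.id_comp _).trans ((ChainComplex.toSingle₀Equiv_symm_apply_f_zero ε w).symm.trans
            (Category.comp_id _).symm))
      all_goals first | rfl | exact K.shape 0 0 (by simp)
    | succ n =>
      rw [quasiIsoAt_iff_exactAt']
      · rw [HomologicalComplex.exactAt_iff' _ (n + 2) (n + 1) n (by simp) (by simp)]
        exact hs n
      · apply ChainComplex.exactAt_succ_single_obj⟩

end ModuleExact

/-! ### The bar complex of a functor -/

section Bar

variable {C D : Type u} [SmallCategory C] [SmallCategory D] (φ : C ⥤ D)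

/-- The nerves of the categories `φ|d`. -/
def commaNerve : D ⥤ SSet.{u} := CostructuredArrow.functor φ ⋙ nerveFunctor

/-- The module `d ↦ ℤ[N_m(φ|d)]`. -/
def barObj (m : ℕ) : LMod D where
  obj d := AddCommGrpCat.of (Ch ((commaNerve φ).obj d) m)
  map f := AddCommGrpCat.ofHom (chMap ((commaNerve φ).map f) m)
  map_id _ := by
    refine AddCommGrpCat.hom_ext (DFunLike.ext _ _ fun z => ?_)
    rw [CategoryTheory.Functor.map_id]
    exact chMap_id _ _
  map_comp f g := by
    refine AddCommGrpCat.hom_ext (DFunLike.ext _ _ fun z => ?_)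
    rw [CategoryTheory.Functor.map_comp]
    exact chMap_comp _ _ _ _

/-- The differential of the bar complex. -/
def barD (m : ℕ) : barObj φ (m + 1) ⟶ barObj φ m where
  app _ := AddCommGrpCat.ofHom (bd _ m)
  naturality _ _ f := AddCommGrpCat.hom_ext (DFunLike.ext _ _ fun z =>
    bd_chMap ((commaNerve φ).map f) m z)

lemma barD_barD (m : ℕ) : barD φ (m + 1) ≫ barD φ m = 0 := by
  refine NatTrans.ext (funext fun d => AddCommGrpCat.hom_ext (DFunLike.ext _ _ fun z => ?_))
  exact bd_bd _ m z

/-- The augmentation of the bar complex. -/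
def barε : barObj φ 0 ⟶ constZ D where
  app _ := AddCommGrpCat.ofHom (AddEquiv.ulift.symm.toAddMonoidHom.comp (aug _))
  naturality _ _ f := AddCommGrpCat.hom_ext (DFunLike.ext _ _ fun z =>
    congrArg ULift.up (aug_chMap ((commaNerve φ).map f) z))

lemma barD_barε : barD φ 0 ≫ barε φ = 0 := by
  refine NatTrans.ext (funext fun d => AddCommGrpCat.hom_ext (DFunLike.ext _ _ fun z => ?_))
  exact congrArg ULift.up (aug_bd _ z)

/-- The bar complex. -/
def bar : ChainComplex (LMod D) ℕ := ChainComplex.of (barObj φ) (barD φ) (barD_barD φ)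

lemma bar_d (m : ℕ) : (bar φ).d (m + 1) m = barD φ m := ChainComplex.of_d _ _ _

variable {φ}

/-- The functor to `φ|d` given by a functor `s` and a compatible family of maps to `d`. -/
def overMk {E : Type*} [Category* E] {d : D} (s : E ⥤ C) (a : ∀ i, φ.obj (s.obj i) ⟶ d)
    (w : ∀ i j (f : i ⟶ j), φ.map (s.map f) ≫ a j = a i) : E ⥤ CostructuredArrow φ d where
  obj i := CostructuredArrow.mk (a i)
  map f := CostructuredArrow.homMk (s.map f) (w _ _ f)
  map_id i := by ext; simp
  map_comp f g := by ext; simp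

/-- Fixing the underlying functor to C reduces equality of functors to equality of structure maps,
with no transport. -/
lemma overMk_congr {E : Type*} [Category* E] {d : D} (s : E ⥤ C) {a b : ∀ i, φ.obj (s.obj i) ⟶ d}
    (h : ∀ i, a i = b i) {w : ∀ i j (f : i ⟶ j), φ.map (s.map f) ≫ a j = a i}
    {w' : ∀ i j (f : i ⟶ j), φ.map (s.map f) ≫ b j = b i} : overMk s a w = overMk s b w' := by
  obtain rfl := funext h
  rfl

/-- The flag in `φ|d` given by a flag `s` in `C` and a map `φ(s_m) ⟶ d`. -/
def flagOver {m : ℕ} (s : Fin (m + 1) ⥤ C) {d : D} (h : φ.obj (s.obj (Fin.last m)) ⟶ d) :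
    Fin (m + 1) ⥤ CostructuredArrow φ d :=
  overMk s (fun i => φ.map (s.map (homOfLE (Fin.le_last i))) ≫ h) fun i j f => by
    rw [← Category.assoc, ← φ.map_comp, ← s.map_comp]
    rfl

lemma overMk_proj {E : Type*} [Category* E] {d : D} (F : E ⥤ CostructuredArrow φ d) :
    overMk (F ⋙ CostructuredArrow.proj φ d) (fun i => (F.obj i).hom)
      (fun _ _ f => CostructuredArrow.w (F.map f)) = F := rfl

/-- A flag in φ|d is a flag s in C together with a map from φ of its last object to d. So the bar
module is the direct sum over s of ℤ[Hom(φ(s_m), -)], and is projective. -/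
lemma flagOver_eq {m : ℕ} {d : D} (F : Fin (m + 1) ⥤ CostructuredArrow φ d) :
    flagOver (F ⋙ CostructuredArrow.proj φ d) (F.obj (Fin.last m)).hom = F :=
  (overMk_congr _ fun i => CostructuredArrow.w (F.map (homOfLE (Fin.le_last i)))).trans
    (overMk_proj F)

lemma flagOver_map {m : ℕ} (s : Fin (m + 1) ⥤ C) {d d' : D}
    (h : φ.obj (s.obj (Fin.last m)) ⟶ d) (h' : d ⟶ d') :
    flagOver s h ⋙ CostructuredArrow.map h' = flagOver s (h ≫ h') :=
  (overMk_proj _).symm.trans (overMk_congr s fun _ => Category.assoc _ _ _)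

variable (φ) in
/-- The generator of the bar complex given by a flag in `C`. -/
def barGen {m : ℕ} (s : Fin (m + 1) ⥤ C) : (barObj φ m).obj (φ.obj (s.obj (Fin.last m))) :=
  (FreeAbelianGroup.of (flagOver s (𝟙 _)) : FreeAbelianGroup
    (Fin (m + 1) ⥤ CostructuredArrow φ (φ.obj (s.obj (Fin.last m)))))

lemma barObj_map_gen {m : ℕ} (s : Fin (m + 1) ⥤ C) {d : D} (h : φ.obj (s.obj (Fin.last m)) ⟶ d) :
    (barObj φ m).map h (barGen φ s) = (FreeAbelianGroup.of (flagOver s h) : FreeAbelianGroup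
      (Fin (m + 1) ⥤ CostructuredArrow φ d)) := by
  refine (FreeAbelianGroup.map_of_apply _).trans (congrArg _ ?_)
  exact (flagOver_map s _ h).trans (congrArg _ (Category.id_comp h))

lemma barObj_hom_ext {m : ℕ} {G : LMod D} {α β : barObj φ m ⟶ G}
    (h : ∀ s : Fin (m + 1) ⥤ C, α.app _ (barGen φ s) = β.app _ (barGen φ s)) : α = β := by
  refine NatTrans.ext (funext fun d => AddCommGrpCat.hom_ext (FreeAbelianGroup.lift_ext _ _ ?_))
  intro F
  let F : Fin (m + 1) ⥤ CostructuredArrow φ d := F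
  have h1 := barObj_map_gen (F ⋙ CostructuredArrow.proj φ d) (F.obj (Fin.last m)).hom
  rw [flagOver_eq] at h1
  have h2 : ∀ γ : barObj φ m ⟶ G, γ.app d (FreeAbelianGroup.of F : FreeAbelianGroup
      (Fin (m + 1) ⥤ CostructuredArrow φ d)) = G.map (F.obj (Fin.last m)).hom
        (γ.app _ (barGen φ (F ⋙ CostructuredArrow.proj φ d))) := by
    intro γ
    rw [← h1]
    exact ConcreteCategory.congr_hom (γ.naturality _) _
  exact (h2 α).trans ((congrArg _ (h (F ⋙ CostructuredArrow.proj φ d))).trans (h2 β).symm)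

/-- A morphism from a module of the bar complex is given by the images of the generators. -/
def barDesc {m : ℕ} {G : LMod D} (g : ∀ s : Fin (m + 1) ⥤ C, G.obj (φ.obj (s.obj (Fin.last m)))) :
    barObj φ m ⟶ G where
  app d := AddCommGrpCat.ofHom (FreeAbelianGroup.lift
    fun F : Fin (m + 1) ⥤ CostructuredArrow φ d =>
      G.map (F.obj (Fin.last m)).hom (g (F ⋙ CostructuredArrow.proj φ d)))
  naturality d _ f := by
    refine AddCommGrpCat.hom_ext (FreeAbelianGroup.lift_ext _ _ fun F => ?_)
    let F : Fin (m + 1) ⥤ CostructuredArrow φ d := F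
    refine (congrArg (FreeAbelianGroup.lift _) (FreeAbelianGroup.map_of_apply _)).trans ?_
    refine (FreeAbelianGroup.lift_apply_of _ _).trans (Eq.trans ?_
      (congrArg (G.map f) (FreeAbelianGroup.lift_apply_of _ _)).symm)
    exact CategoryTheory.Functor.map_comp_apply G (F.obj (Fin.last m)).hom f _

lemma barDesc_gen {m : ℕ} {G : LMod D} (g : ∀ s : Fin (m + 1) ⥤ C, G.obj (φ.obj (s.obj (Fin.last m))))
    (s : Fin (m + 1) ⥤ C) : (barDesc g).app _ (barGen φ s) = g s :=
  (FreeAbelianGroup.lift_apply_of _ _).trans (by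
    change G.map (φ.map (s.map (𝟙 _)) ≫ 𝟙 _) (g s) = g s
    rw [s.map_id, φ.map_id, Category.comp_id, G.map_id]
    rfl)

instance barObj_projective (m : ℕ) : Projective (barObj φ m) where
  factors {E X} f e he := by
    have h := (LMod.epi_iff e).1 he
    choose g hg using fun s : Fin (m + 1) ⥤ C => h _ (f.app _ (barGen φ s))
    refine ⟨barDesc g, barObj_hom_ext fun s => ?_⟩
    refine Eq.trans ?_ (hg s)
    exact congrArg (e.app _) (barDesc_gen g s)

/-- The bar resolution. -/
def barResolution (h : ∀ d, IsAcyclic ((commaNerve φ).obj d)) : ProjectiveResolution (constZ D) :=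
  mkResolution (bar φ) (fun m => barObj_projective m) (barε φ)
    ((congrArg (· ≫ barε φ) (bar_d φ 0)).trans (barD_barε φ))
    ((LMod.epi_iff (barε φ)).2 (by
      rintro d ⟨n⟩
      obtain ⟨x⟩ := (h d).1
      refine ⟨n • .of x, ?_⟩
      refine congrArg ULift.up ((map_zsmul (aug _) n _).trans ?_)
      rw [aug_of, smul_eq_mul, mul_one]))
    (LMod.exact_iff.2 (by
      intro d b hb
      obtain ⟨a, ha⟩ := (h d).2 0 b (congrArg ULift.down hb)
      refine ⟨a, Eq.trans ?_ ha⟩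
      exact ConcreteCategory.congr_hom (NatTrans.congr_app (bar_d φ 0) d) a))
    (fun k => LMod.exact_iff.2 (by
      intro d b hb
      obtain ⟨a, ha⟩ := (h d).2 (k + 1) b
        ((ConcreteCategory.congr_hom (NatTrans.congr_app (bar_d φ k) d) b).symm.trans hb)
      refine ⟨a, Eq.trans ?_ ha⟩
      exact ConcreteCategory.congr_hom (NatTrans.congr_app (bar_d φ (k + 1)) d) a))

end Bar

/-! ### Comparing the bar complexes of C and of φ -/

section Compare

variable {C D : Type u} [SmallCategory C] [SmallCategory D] (φ : C ⥤ D)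

/-- The map of nerves induced by `C|c ⥤ φ|φ(c)`. -/
def commaPost (c : C) : (commaNerve (𝟭 C)).obj c ⟶ (commaNerve φ).obj (φ.obj c) :=
  nerveMap (CostructuredArrow.post (𝟭 C) φ c)

lemma commaPost_naturality {c c' : C} (f : c ⟶ c') :
    (commaNerve (𝟭 C)).map f ≫ commaPost φ c' = commaPost φ c ≫ (commaNerve φ).map (φ.map f) := by
  have h : CostructuredArrow.map (S := 𝟭 C) f ⋙ CostructuredArrow.post (𝟭 C) φ c' =
      CostructuredArrow.post (𝟭 C) φ c ⋙ CostructuredArrow.map (φ.map f) :=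
    (overMk_proj _).symm.trans ((overMk_congr (CostructuredArrow.proj (𝟭 C) c)
      fun _ => φ.map_comp _ _).trans
        (overMk_proj (CostructuredArrow.post (𝟭 C) φ c ⋙ CostructuredArrow.map (φ.map f))))
  exact congrArg (fun g : CostructuredArrow (𝟭 C) c ⥤ CostructuredArrow φ (φ.obj c') =>
    nerveMap g) h

/-- The comparison map from the bar complex of `C` to the restriction of the bar complex of `φ`. -/
def barCompare (m : ℕ) : barObj (𝟭 C) m ⟶ φ ⋙ barObj φ m where
  app c := AddCommGrpCat.ofHom (chMap (commaPost φ c) m)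
  naturality c c' f := by
    refine AddCommGrpCat.hom_ext (DFunLike.ext _ _ fun z => ?_)
    have h := congrArg (fun g => chMap g m z) (commaPost_naturality φ f)
    exact (chMap_comp _ _ m z).symm.trans (h.trans (chMap_comp _ _ m z))

lemma barCompare_d (m : ℕ) :
    barD (𝟭 C) m ≫ barCompare φ m = barCompare φ (m + 1) ≫ Functor.whiskerLeft φ (barD φ m) :=
  NatTrans.ext (funext fun c => AddCommGrpCat.hom_ext (DFunLike.ext _ _ fun z =>
    (bd_chMap (commaPost φ c) m z).symm))

lemma barCompare_gen {m : ℕ} (s : Fin (m + 1) ⥤ C) :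
    (barCompare φ m).app _ (barGen (𝟭 C) s) = barGen φ s := by
  refine (FreeAbelianGroup.map_of_apply _).trans (congrArg _ ?_)
  have h : flagOver (φ := 𝟭 C) s (𝟙 _) ⋙ CostructuredArrow.post (𝟭 C) φ _ =
      flagOver (φ := φ) s (𝟙 _) :=
    (overMk_proj _).symm.trans (overMk_congr s fun i => (congrArg φ.map (Category.comp_id _)).trans
      (Category.comp_id _).symm)
  exact h

end Compare

end

end CatDuality

namespace CatDuality

noncomputable section

/-! ### Acyclicity of the comma categories -/

section Terminal

variable {E : Type u} [Category.{u} E]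

/-- The maps to the terminal object form a natural transformation from the identity to a constant
functor, hence a homotopy. -/
lemma isAcyclic_nerve_of_isTerminal {t : E} (ht : IsTerminal t) : IsAcyclic (nerve E) := by
  let y : Sx (nerve E) 0 := ComposableArrows.mk₀ t
  refine ⟨⟨y⟩, fun k z hz => ?_⟩
  let η : 𝟭 E ⟶ (Functor.const E).obj t :=
    { app := fun x => ht.from x
      naturality := fun _ _ _ => ht.hom_ext _ _ }
  have h1 := homotopy_sub_mem_bdry (nerveHomotopy η) k hz
  have h2 : nerveMap ((Functor.const E).obj t) = SSet.const y := by
    ext n x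
    refine CategoryTheory.Functor.ext (fun i => rfl) fun i j f => ?_
    exact ht.hom_ext _ _
  have h3 := chMap_const_mem_bdry (nerve E) y k hz
  have h4 := add_mem h1 (h2 ▸ h3)
  rw [sub_add_cancel] at h4
  exact (chMap_id k z) ▸ h4

end Terminal

section Acyclic

variable {C D : Type u} [SmallCategory C] [SmallCategory D] (φ : C ⥤ D)

lemma isAcyclic_commaNerve (hφ : ∀ d, IsContractible (CostructuredArrow φ d)) (d : D) :
    IsAcyclic ((commaNerve φ).obj d) := by
  have : ContractibleSpace (SSet.toTop.obj ((commaNerve φ).obj d)) := hφ d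
  exact ⟨nonempty_of_contractibleSpace _, fun _ _ hz => mem_bdry_of_contractibleSpace hz⟩

lemma isAcyclic_commaNerve_id (c : C) : IsAcyclic ((commaNerve (𝟭 C)).obj c) :=
  isAcyclic_nerve_of_isTerminal (E := CostructuredArrow (𝟭 C) c)
    (CostructuredArrow.mkIdTerminal (S := 𝟭 C) (Y := c))

end Acyclic

/-! ### Induction along φ and type FP -/

section Lan

variable {C D : Type u} [SmallCategory C] [SmallCategory D] (φ : C ⥤ D)

/-- Induction along `φ`. -/
def ind : LMod C ⥤ LMod D := φ.lan

/-- Induction is left adjoint to restriction. -/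
def indAdj : ind φ ⊣ (Functor.whiskeringLeft C D AddCommGrpCat.{u}).obj φ :=
  φ.lanAdjunction AddCommGrpCat.{u}

instance : (ind φ).Additive := (indAdj φ).left_adjoint_additive

instance : (ind φ).IsLeftAdjoint := (indAdj φ).isLeftAdjoint

/-- The transpose of a morphism to a restricted module. -/
def indDesc {F : LMod C} {G : LMod D} (f : F ⟶ φ ⋙ G) : (ind φ).obj F ⟶ G :=
  ((indAdj φ).homEquiv F G).symm f

/-- The unit of the adjunction between induction and restriction. -/
def indUnit (F : LMod C) : F ⟶ φ ⋙ (ind φ).obj F := (indAdj φ).unit.app F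

lemma indUnit_desc {F : LMod C} {G : LMod D} (f : F ⟶ φ ⋙ G) :
    indUnit φ F ≫ Functor.whiskerLeft φ (indDesc φ f) = f :=
  ((indAdj φ).homEquiv_unit _ _ _).symm.trans (((indAdj φ).homEquiv F G).apply_symm_apply f)

lemma indDesc_unit {F : LMod C} {G : LMod D} (f : F ⟶ φ ⋙ G) (c : C) (a : F.obj c) :
    (indDesc φ f).app (φ.obj c) ((indUnit φ F).app c a) = f.app c a :=
  ConcreteCategory.congr_hom (NatTrans.congr_app (indUnit_desc φ f) c) a

lemma indDesc_comp_eq_id {F : LMod C} {G : LMod D} (f : F ⟶ φ ⋙ G) (g : G ⟶ (ind φ).obj F)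
    (h : f ≫ Functor.whiskerLeft φ g = indUnit φ F) : indDesc φ f ≫ g = 𝟙 _ := by
  refine ((indAdj φ).homEquiv _ _).injective ?_
  refine ((indAdj φ).homEquiv_naturality_right _ _).trans ?_
  refine (congrArg (· ≫ _) (Equiv.apply_symm_apply _ _)).trans ?_
  exact h.trans ((indAdj φ).homEquiv_id _).symm

/-- The isomorphism between the bar complex of `φ` and the induced bar complex of `C`. -/
def indBarObj (m : ℕ) : (ind φ).obj (barObj (𝟭 C) m) ≅ barObj φ m where
  hom := indDesc φ (barCompare φ m)
  inv := barDesc fun s => (indUnit φ (barObj (𝟭 C) m)).app _ (barGen (𝟭 C) s)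
  hom_inv_id := by
    -- Both modules are free on the flags of C, and the two maps exchange generators.
    refine indDesc_comp_eq_id φ _ _ (barObj_hom_ext fun s => ?_)
    exact (congrArg (NatTrans.app (barDesc (φ := φ) fun s =>
      (indUnit φ (barObj (𝟭 C) m)).app _ (barGen (𝟭 C) s)) _)
        (barCompare_gen φ s)).trans (barDesc_gen _ s)
  inv_hom_id := by
    refine barObj_hom_ext fun s => ?_
    refine Eq.trans (congrArg (NatTrans.app (indDesc φ (barCompare φ m)) _)
      (barDesc_gen (φ := φ) (fun s => (indUnit φ (barObj (𝟭 C) m)).app _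
        (barGen (𝟭 C) s)) s)) ?_
    exact (indDesc_unit φ (barCompare φ m) _ (barGen (𝟭 C) s)).trans (barCompare_gen φ s)

lemma indBarObj_d (m : ℕ) :
    (ind φ).map (barD (𝟭 C) m) ≫ (indBarObj φ m).hom = (indBarObj φ (m + 1)).hom ≫ barD φ m := by
  refine ((indAdj φ).homEquiv_naturality_left_symm _ _).symm.trans (Eq.trans ?_
    ((indAdj φ).homEquiv_naturality_right_symm _ _))
  exact congrArg _ (barCompare_d φ m)

/-- The isomorphism between the bar complex of `φ` and the induced bar complex of `C`. -/
def indBar : ((ind φ).mapHomologicalComplex _).obj (bar (𝟭 C)) ≅ bar φ :=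
  HomologicalComplex.Hom.isoOfComponents (indBarObj φ) (by
    rintro i j h
    obtain rfl : j + 1 = i := h
    refine (congrArg ((indBarObj φ (j + 1)).hom ≫ ·) (bar_d φ j)).trans ?_
    refine (indBarObj_d φ j).symm.trans ?_
    exact congrArg (fun g => (ind φ).map g ≫ (indBarObj φ j).hom) (bar_d (𝟭 C) j).symm)

instance ind_projective (P : LMod C) [Projective P] : Projective ((ind φ).obj P) :=
  (indAdj φ).map_projective P inferInstance

/-- Induction of a projective resolution of the constant module. -/
def indResolution (hφ : ∀ d, IsContractible (CostructuredArrow φ d))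
    (P : ProjectiveResolution (constZ C)) : ProjectiveResolution (constZ D) where
  complex := ((ind φ).mapHomologicalComplex _).obj P.complex
  projective m := ind_projective φ (P.complex.X m)
  π := ((ind φ).mapHomologicalComplex _).map (ProjectiveResolution.homotopyEquiv P
    (barResolution fun c => isAcyclic_commaNerve_id c)).hom ≫ (indBar φ).hom ≫
      (barResolution (isAcyclic_commaNerve φ hφ)).π
  quasiIso := by
    -- Exactness after induction is known only for the bar resolution. Additive functors preserve
    -- homotopy equivalences, so `P` inherits it.
    let e := (ind φ).mapHomotopyEquiv (ProjectiveResolution.homotopyEquiv P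
      (barResolution fun c => isAcyclic_commaNerve_id c))
    have h1 : QuasiIso e.hom := inferInstance
    have h2 : QuasiIso (indBar φ).hom := inferInstance
    have h3 := (barResolution (isAcyclic_commaNerve φ hφ)).quasiIso
    exact quasiIso_comp (hφ := h1) (hφ' := quasiIso_comp (hφ := h2) (hφ' := h3))

/-- The generator of a standard projective. -/
def stdGen (x : C) : ((stdProj C).obj (op x)).obj x := stdProjEquiv x _ (𝟙 _)

lemma stdProjEquiv_apply (x : C) {F : LMod C} (g : (stdProj C).obj (op x) ⟶ F) :
    stdProjEquiv x F g = g.app x (stdGen x) :=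
  (congrArg (stdProjEquiv x F) (Category.id_comp g)).symm.trans (stdProjEquiv_comp x (𝟙 _) g)

lemma stdProj_hom_ext {x : C} {F : LMod C} {f g : (stdProj C).obj (op x) ⟶ F}
    (h : f.app x (stdGen x) = g.app x (stdGen x)) : f = g :=
  (stdProjEquiv x F).injective
    ((stdProjEquiv_apply x f).trans (h.trans (stdProjEquiv_apply x g).symm))

/-- The morphism from a standard projective given by an element. -/
def stdDesc {x : C} {F : LMod C} (a : F.obj x) : (stdProj C).obj (op x) ⟶ F :=
  (stdProjEquiv x F).symm a

lemma stdDesc_gen {x : C} {F : LMod C} (a : F.obj x) : (stdDesc a).app x (stdGen x) = a :=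
  (stdProjEquiv_apply x _).symm.trans ((stdProjEquiv x F).apply_symm_apply a)

/-- The map of standard projectives induced by `φ`. -/
def stdRes (x : C) : (stdProj C).obj (op x) ⟶ φ ⋙ (stdProj D).obj (op (φ.obj x)) :=
  stdDesc (F := φ ⋙ (stdProj D).obj (op (φ.obj x))) (stdGen (φ.obj x))

lemma stdRes_gen (x : C) : (stdRes φ x).app x (stdGen x) = stdGen (φ.obj x) :=
  stdDesc_gen (F := φ ⋙ (stdProj D).obj (op (φ.obj x))) (stdGen (φ.obj x))

/-- The generator of an induced standard projective. -/
def indGen (x : C) : ((ind φ).obj ((stdProj C).obj (op x))).obj (φ.obj x) :=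
  (indUnit φ ((stdProj C).obj (op x))).app x (stdGen x)

/-- Induction preserves standard projectives. -/
def indStdProj (x : C) : (ind φ).obj ((stdProj C).obj (op x)) ≅ (stdProj D).obj (op (φ.obj x)) where
  hom := indDesc φ (stdRes φ x)
  inv := stdDesc (indGen φ x)
  hom_inv_id := by
    refine indDesc_comp_eq_id φ _ _ (stdProj_hom_ext ?_)
    exact (congrArg (NatTrans.app (stdDesc (indGen φ x)) _) (stdRes_gen φ x)).trans (stdDesc_gen _)
  inv_hom_id := by
    refine stdProj_hom_ext ?_
    refine Eq.trans (congrArg (NatTrans.app (indDesc φ (stdRes φ x)) _) (stdDesc_gen (indGen φ x))) ?_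
    exact (indDesc_unit φ (stdRes φ x) x (stdGen x)).trans (stdRes_gen φ x)

/-- As a left adjoint, induction preserves epimorphisms and coproducts, and it sends P_x to P_φ(x).
-/
lemma isFiniteType_ind {F : LMod C} (hF : IsFiniteType F) : IsFiniteType ((ind φ).obj F) := by
  obtain ⟨k, x, p, hp⟩ := hF
  let e : ∀ j, (ind φ).obj ((stdProj C).obj (op (x j))) ≅ (stdProj D).obj (op (φ.obj (x j))) :=
    fun j => indStdProj φ (x j)
  refine ⟨k, fun j => φ.obj (x j), (Sigma.mapIso e).inv ≫
    (PreservesCoproduct.iso (ind φ) _).inv ≫ (ind φ).map p, ?_⟩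
  exact epi_comp _ _

lemma isTypeFP_ind (hφ : ∀ d, IsContractible (CostructuredArrow φ d)) (h : IsTypeFP (constZ C)) :
    IsTypeFP (constZ D) := by
  obtain ⟨P, h1, N, h2⟩ := h
  exact ⟨indResolution φ hφ P, fun m => isFiniteType_ind φ (h1 m), N, fun m hm =>
    (ind φ).map_isZero (h2 m hm)⟩

end Lan

end

end CatDuality

namespace CatDuality

noncomputable section

/-! ### Transfer of Ext vanishing from C to D -/

section Transfer

variable {C D : Type u} [SmallCategory C] [SmallCategory D] (φ : C ⥤ D)

/-- Since φ|d is nonempty, some φ(a) maps to d, and g at d is determined by g at φ(a). -/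
lemma constZ_hom_eq_zero (hφ : ∀ d, IsContractible (CostructuredArrow φ d)) {G : LMod D}
    (h : ∀ f : constZ C ⟶ φ ⋙ G, f = 0) (g : constZ D ⟶ G) : g = 0 := by
  refine NatTrans.ext (funext fun d => AddCommGrpCat.hom_ext (DFunLike.ext _ _ fun z => ?_))
  obtain ⟨x⟩ := (isAcyclic_commaNerve φ hφ d).1
  let y : CostructuredArrow φ d := (x : ComposableArrows (CostructuredArrow φ d) 0).obj 0
  have h1 := ConcreteCategory.congr_hom (g.naturality y.hom) z
  have h2 := ConcreteCategory.congr_hom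
    (NatTrans.congr_app (h (Functor.whiskerLeft φ g : constZ C ⟶ φ ⋙ G)) y.left) z
  exact h1.trans ((congrArg (G.map y.hom) h2).trans (map_zero (G.map y.hom).hom))

lemma ind_homEquiv_zero {F : LMod C} {G : LMod D} : (indAdj φ).homEquiv F G 0 = 0 :=
  ((indAdj φ).homEquiv_unit _ _ _).trans comp_zero

/-- Maps from the induced resolution to G are maps from P to φ*G, and this matches cocycles and
coboundaries. Degree 0, where there are no coboundaries, is handled with morphisms. -/
lemma ext_eq_zero_of_restrict (hφ : ∀ d, IsContractible (CostructuredArrow φ d))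
    (P : ProjectiveResolution (constZ C)) {G : LMod D} (i : ℕ)
    (h : ∀ x : Abelian.Ext (constZ C) (φ ⋙ G : LMod C) i, x = 0)
    (x : Abelian.Ext (constZ D) G i) : x = 0 := by
  cases i with
  | zero =>
    obtain ⟨f, rfl⟩ := (Abelian.Ext.mk₀_bijective (constZ D) G).2 x
    rw [constZ_hom_eq_zero φ hφ (fun f => ?_) f, Abelian.Ext.mk₀_zero]
    exact (Abelian.Ext.mk₀_bijective _ _).1 ((h _).trans (Abelian.Ext.mk₀_zero _ _).symm)
  | succ i =>
    obtain ⟨f, hf, rfl⟩ := (indResolution φ hφ P).extMk_surjective x (i + 2) rfl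
    let f : (ind φ).obj (P.complex.X (i + 1)) ⟶ G := f
    have hf : (ind φ).map (P.complex.d (i + 2) (i + 1)) ≫ f = 0 := hf
    have hf' : P.complex.d (i + 2) (i + 1) ≫ (indAdj φ).homEquiv _ _ f = 0 :=
      ((indAdj φ).homEquiv_naturality_left _ _).symm.trans
        ((congrArg _ hf).trans (ind_homEquiv_zero φ))
    obtain ⟨g, hg⟩ := (P.extMk_eq_zero_iff _ (i + 2) rfl hf' i rfl).1 (h _)
    refine ((indResolution φ hφ P).extMk_eq_zero_iff _ (i + 2) rfl _ i rfl).2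
      ⟨((indAdj φ).homEquiv _ _).symm g, ?_⟩
    refine ((indAdj φ).homEquiv_naturality_left_symm _ _).symm.trans ?_
    exact (congrArg _ hg).trans (Equiv.symm_apply_apply _ _)

end Transfer

/-! ### The tensor-hom adjunction over C -/

section TensorAdjunction

variable {C : Type u} [SmallCategory C] (F : RMod C)

/-- The left module `x ↦ Hom(F(x), A)`. -/
def homMod : AddCommGrpCat.{u} ⥤ LMod C where
  obj A :=
    { obj := fun x => AddCommGrpCat.of (F.obj (op x) →+ A)
      map := fun f => AddCommGrpCat.ofHom (AddMonoidHom.compHom.flip (F.map f.op).hom)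
      map_id := fun x => by
        refine AddCommGrpCat.hom_ext (DFunLike.ext _ _ fun z => DFunLike.ext _ _ fun a => ?_)
        exact congrArg z (ConcreteCategory.congr_hom (F.map_id (op x)) a)
      map_comp := fun f g => by
        refine AddCommGrpCat.hom_ext (DFunLike.ext _ _ fun z => DFunLike.ext _ _ fun a => ?_)
        exact congrArg z (ConcreteCategory.congr_hom (F.map_comp g.op f.op) a) }
  map g :=
    { app := fun x => AddCommGrpCat.ofHom (AddMonoidHom.compHom g.hom)
      naturality := fun _ _ _ => rfl }
  map_id _ := rfl
  map_comp _ _ := rfl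

variable {F} {G : LMod C} {A : AddCommGrpCat.{u}}

variable (F) in
open Classical in
/-- The class of `a ⊗ b` in `F ⊗_C G`. -/
def tmk {x : C} (a : F.obj (op x)) (b : G.obj x) : (tensorFunctor F).obj G :=
  QuotientAddGroup.mk' (tensorRel F G)
    (DirectSum.of (fun x : C => F.obj (op x) ⊗[ℤ] G.obj x) x (a ⊗ₜ b))

lemma tmk_add_left {x : C} (a a' : F.obj (op x)) (b : G.obj x) :
    tmk F (a + a') b = tmk F a b + tmk F a' b := by
  simp only [tmk, TensorProduct.add_tmul, map_add]
  rfl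

lemma tmk_add_right {x : C} (a : F.obj (op x)) (b b' : G.obj x) :
    tmk F a (b + b') = tmk F a b + tmk F a b' := by
  simp only [tmk, TensorProduct.tmul_add, map_add]
  rfl

lemma tmk_map {x y : C} (f : x ⟶ y) (a : F.obj (op y)) (b : G.obj x) :
    tmk F (F.map f.op a) b = tmk F a (G.map f b) := by
  refine QuotientAddGroup.eq_iff_sub_mem.2 (AddSubgroup.subset_closure ?_)
  exact ⟨x, y, f, a, b, rfl⟩

lemma tensorFunctor_map_tmk {G' : LMod C} (g : G ⟶ G') {x : C} (a : F.obj (op x)) (b : G.obj x) :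
    (tensorFunctor F).map g (tmk F a b) = tmk F a (g.app x b) := by
  classical
  refine congrArg (QuotientAddGroup.mk' (tensorRel F G')) ?_
  exact DirectSum.map_of (fun x => (LinearMap.lTensor (F.obj (op x))
    (g.app x).hom.toIntLinearMap).toAddMonoidHom) x (a ⊗ₜ b)

lemma tensor_induction {p : (tensorFunctor F).obj G → Prop} (z : (tensorFunctor F).obj G)
    (zero : p 0) (add : ∀ z w, p z → p w → p (z + w))
    (tmk : ∀ x (a : F.obj (op x)) (b : G.obj x), p (tmk F a b)) : p z := by
  classical
  obtain ⟨z, rfl⟩ := QuotientAddGroup.mk'_surjective (tensorRel F G) z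
  induction z using DirectSum.induction_on with
  | zero => exact zero
  | add z w hz hw => exact add _ _ hz hw
  | of x z =>
    induction z using TensorProduct.induction_on with
    | zero => rw [map_zero]; exact zero
    | add z w hz hw => rw [map_add]; exact add _ _ hz hw
    | tmul a b => exact tmk x a b

lemma tensor_hom_ext {f g : (tensorFunctor F).obj G ⟶ A}
    (h : ∀ x (a : F.obj (op x)) (b : G.obj x), f (tmk F a b) = g (tmk F a b)) : f = g := by
  refine AddCommGrpCat.hom_ext (DFunLike.ext _ _ fun z => ?_)
  refine tensor_induction (p := fun z => f.hom z = g.hom z) z ?_ ?_ h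
  · rw [map_zero, map_zero]
  · intro z w hz hw
    rw [map_add, map_add, hz, hw]

/-- A family of biadditive maps, compatible with the relations of the tensor product. -/
def IsBalanced (f : ∀ x, G.obj x →+ F.obj (op x) →+ A) : Prop :=
  ∀ x y (g : x ⟶ y) (a : F.obj (op y)) (b : G.obj x),
    f x b (F.map g.op a) = f y (G.map g b) a

open Classical in
/-- The map on the direct sum given by a family of biadditive maps. -/
def tensorPreDesc (f : ∀ x, G.obj x →+ F.obj (op x) →+ A) :
    (⨁ x : C, F.obj (op x) ⊗[ℤ] G.obj x) →+ A :=
  DirectSum.toAddMonoid fun x => TensorProduct.liftAddHom (f x).flip (by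
    intro r a b
    rw [map_zsmul, map_zsmul]
    rfl)

lemma tensorRel_le_ker (f : ∀ x, G.obj x →+ F.obj (op x) →+ A) (hf : IsBalanced f) :
    tensorRel F G ≤ (tensorPreDesc f).ker := by
  rw [tensorRel, AddSubgroup.closure_le]
  rintro _ ⟨x, y, g, a, b, rfl⟩
  simp [tensorPreDesc, hf x y g a b]

/-- The map from a tensor product given by a compatible family of biadditive maps. -/
def tensorDesc (f : ∀ x, G.obj x →+ F.obj (op x) →+ A) (hf : IsBalanced f) :
    (tensorFunctor F).obj G ⟶ A :=
  AddCommGrpCat.ofHom (QuotientAddGroup.lift (tensorRel F G) (tensorPreDesc f)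
    (tensorRel_le_ker f hf))

open Classical in
lemma tensorDesc_tmk (f : ∀ x, G.obj x →+ F.obj (op x) →+ A) (hf : IsBalanced f) {x : C}
    (a : F.obj (op x)) (b : G.obj x) : tensorDesc f hf (tmk F a b) = f x b a := by
  have h : tensorPreDesc f (DirectSum.of (fun x : C => F.obj (op x) ⊗[ℤ] G.obj x) x (a ⊗ₜ b)) =
      f x b a := by
    rw [tensorPreDesc, DirectSum.toAddMonoid_of]
    rfl
  exact h

/-- The biadditive maps given by a map from a tensor product. -/
def tensorCurry (f : (tensorFunctor F).obj G ⟶ A) : G ⟶ (homMod F).obj A where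
  app x := AddCommGrpCat.ofHom (AddMonoidHom.mk' (fun b : G.obj x =>
    AddMonoidHom.mk' (fun a => f (tmk F a b)) fun a a' =>
      (congrArg f (tmk_add_left a a' b)).trans (map_add f.hom _ _)) fun b b' =>
        AddMonoidHom.ext fun a => (congrArg f (tmk_add_right a b b')).trans (map_add f.hom _ _))
  naturality x y g := by
    refine AddCommGrpCat.hom_ext (AddMonoidHom.ext fun b => AddMonoidHom.ext fun a => ?_)
    exact congrArg f (tmk_map g a b).symm

lemma isBalanced_of_hom (g : G ⟶ (homMod F).obj A) :
    IsBalanced (F := F) fun x => (g.app x).hom := fun _ y h a b =>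
  (congrArg (fun t : F.obj (op y) →+ A => t a)
    (ConcreteCategory.congr_hom (g.naturality h) b)).symm

lemma tensorDesc_curry (f : (tensorFunctor F).obj G ⟶ A) :
    tensorDesc _ (isBalanced_of_hom (tensorCurry f)) = f :=
  tensor_hom_ext fun _ a b => tensorDesc_tmk _ _ a b

lemma tensorCurry_desc (g : G ⟶ (homMod F).obj A) :
    tensorCurry (tensorDesc _ (isBalanced_of_hom g)) = g := by
  refine NatTrans.ext (funext fun x => AddCommGrpCat.hom_ext (AddMonoidHom.ext fun b => ?_))
  let t : F.obj (op x) →+ A := g.app x b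
  let t' : F.obj (op x) →+ A := (tensorCurry (tensorDesc _ (isBalanced_of_hom g))).app x b
  have h : t' = t := AddMonoidHom.ext fun a =>
    tensorDesc_tmk (fun x => (g.app x).hom) (isBalanced_of_hom g) a b
  exact h

variable (F) in
/-- The tensor-hom adjunction. -/
def tensorAdj : tensorFunctor F ⊣ homMod F :=
  Adjunction.mkOfHomEquiv
    { homEquiv := fun _ _ => ⟨tensorCurry, fun g => tensorDesc _ (isBalanced_of_hom g),
        tensorDesc_curry, tensorCurry_desc⟩
      homEquiv_naturality_left_symm := fun f g => tensor_hom_ext fun _ a b =>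
        (tensorDesc_tmk _ (isBalanced_of_hom (f ≫ g)) a b).trans
          ((congrArg (tensorDesc _ (isBalanced_of_hom g)) (tensorFunctor_map_tmk f a b)).trans
            (tensorDesc_tmk _ (isBalanced_of_hom g) a _)).symm
      homEquiv_naturality_right := fun _ _ => rfl }

instance : (tensorFunctor F).IsLeftAdjoint := (tensorAdj F).isLeftAdjoint

end TensorAdjunction

end

end CatDuality

namespace CatDuality

noncomputable section

/-! ### Induction along d|φ → C and the projection formula -/

section ArrowInduction

variable {C D : Type u} [SmallCategory C] [SmallCategory D] (φ : C ⥤ D) (d : D)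

open Classical in
/-- The map of direct sums of values of a module on `d|φ` induced by a morphism of `C`. -/
def arrowIndMap (M : LMod (StructuredArrow d φ)) {c c' : C} (g : c ⟶ c') :
    (⨁ f : d ⟶ φ.obj c, M.obj (StructuredArrow.mk f)) →+
      (⨁ f : d ⟶ φ.obj c', M.obj (StructuredArrow.mk f)) :=
  DirectSum.toAddMonoid fun f =>
    (DirectSum.of (fun f : d ⟶ φ.obj c' => M.obj (StructuredArrow.mk f)) (f ≫ φ.map g)).comp
      (M.map (StructuredArrow.homMk g rfl : StructuredArrow.mk f ⟶ StructuredArrow.mk _)).hom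

open Classical in
/-- The element of the direct sum given by an element of `M`. -/
def arrowIndOf (M : LMod (StructuredArrow d φ)) (x : StructuredArrow d φ) :
    M.obj x →+ (⨁ f : d ⟶ φ.obj x.right, M.obj (StructuredArrow.mk f)) :=
  DirectSum.of (fun f : d ⟶ φ.obj x.right => M.obj (StructuredArrow.mk f)) x.hom

variable {φ d}

open Classical in
lemma arrowIndMap_of (M : LMod (StructuredArrow d φ)) {x y : StructuredArrow d φ} (h : x ⟶ y)
    (m : M.obj x) : arrowIndMap φ d M h.right (arrowIndOf φ d M x m) =
      arrowIndOf φ d M y (M.map h m) := by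
  -- Treating the structure map of the target as a variable lets the triangle identity be
  -- substituted.
  have key : ∀ (f : d ⟶ φ.obj y.right) (hf : x.hom ≫ φ.map h.right = f),
      arrowIndMap φ d M h.right (arrowIndOf φ d M x m) =
        arrowIndOf φ d M (StructuredArrow.mk f)
          (M.map (StructuredArrow.homMk h.right hf : x ⟶ StructuredArrow.mk f) m) := by
    rintro _ rfl
    exact DirectSum.toAddMonoid_of (β := fun f : d ⟶ φ.obj x.right =>
      M.obj (StructuredArrow.mk f)) _ x.hom m
  exact key y.hom (StructuredArrow.w h)

lemma arrowInd_hom_ext {M : LMod (StructuredArrow d φ)} {c : C} {A : Type*} [AddCommMonoid A]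
    {f g : (⨁ f : d ⟶ φ.obj c, M.obj (StructuredArrow.mk f)) →+ A}
    (h : ∀ (k : d ⟶ φ.obj c) (m : M.obj (StructuredArrow.mk k)),
      f (arrowIndOf φ d M (StructuredArrow.mk k) m) =
        g (arrowIndOf φ d M (StructuredArrow.mk k) m)) : f = g := by
  classical
  exact DirectSum.addHom_ext h

/-- The map of direct sums induced by a morphism of modules. -/
def arrowIndHom {M N : LMod (StructuredArrow d φ)} (α : M ⟶ N) (c : C) :
    (⨁ f : d ⟶ φ.obj c, M.obj (StructuredArrow.mk f)) →+
      (⨁ f : d ⟶ φ.obj c, N.obj (StructuredArrow.mk f)) :=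
  DirectSum.map fun f => (α.app (StructuredArrow.mk f)).hom

lemma arrowIndHom_of {M N : LMod (StructuredArrow d φ)} (α : M ⟶ N) (x : StructuredArrow d φ)
    (m : M.obj x) : arrowIndHom α x.right (arrowIndOf φ d M x m) =
      arrowIndOf φ d N x (α.app x m) := by
  classical
  exact DirectSum.map_of (fun f => (α.app (StructuredArrow.mk f)).hom) x.hom m

variable (φ d)

/-- Induction along the forgetful functor `d|φ ⥤ C`. -/
def arrowInd : LMod (StructuredArrow d φ) ⥤ LMod C where
  obj M :=
    { obj := fun c => AddCommGrpCat.of (⨁ f : d ⟶ φ.obj c, M.obj (StructuredArrow.mk f))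
      map := fun g => AddCommGrpCat.ofHom (arrowIndMap φ d M g)
      map_id := fun c => by
        refine AddCommGrpCat.hom_ext (arrowInd_hom_ext fun k m => ?_)
        refine (arrowIndMap_of M (𝟙 (StructuredArrow.mk k)) m).trans ?_
        exact congrArg _ (ConcreteCategory.congr_hom (M.map_id _) m)
      map_comp := fun {c c' c''} f g => by
        refine AddCommGrpCat.hom_ext (arrowInd_hom_ext fun k m => ?_)
        let f' : StructuredArrow.mk k ⟶ StructuredArrow.mk (k ≫ φ.map f) :=
          StructuredArrow.homMk f rfl
        let g' : StructuredArrow.mk (k ≫ φ.map f) ⟶ StructuredArrow.mk ((k ≫ φ.map f) ≫ φ.map g) :=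
          StructuredArrow.homMk g rfl
        refine (arrowIndMap_of M (f' ≫ g') m).trans ?_
        refine Eq.trans (congrArg _ (ConcreteCategory.congr_hom (M.map_comp f' g') m)) ?_
        refine (arrowIndMap_of M g' (M.map f' m)).symm.trans ?_
        exact congrArg (arrowIndMap φ d M g) (arrowIndMap_of M f' m).symm }
  map α :=
    { app := fun c => AddCommGrpCat.ofHom (arrowIndHom α c)
      naturality := fun c c' f => by
        refine AddCommGrpCat.hom_ext (arrowInd_hom_ext fun k m => ?_)
        let f' : StructuredArrow.mk k ⟶ StructuredArrow.mk (k ≫ φ.map f) :=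
          StructuredArrow.homMk f rfl
        refine (congrArg (arrowIndHom α c') (arrowIndMap_of _ f' m)).trans ?_
        refine (arrowIndHom_of α (StructuredArrow.mk (k ≫ φ.map f)) _).trans ?_
        refine (congrArg _ (ConcreteCategory.congr_hom (α.naturality f') m)).trans ?_
        refine (arrowIndMap_of _ f' _).symm.trans ?_
        exact congrArg (arrowIndMap φ d _ f) (arrowIndHom_of α (StructuredArrow.mk k) m).symm }
  map_id M := by
    refine NatTrans.ext (funext fun c => AddCommGrpCat.hom_ext (arrowInd_hom_ext fun k m => ?_))
    exact arrowIndHom_of (𝟙 M) (StructuredArrow.mk k) m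
  map_comp α β := by
    refine NatTrans.ext (funext fun c => AddCommGrpCat.hom_ext (arrowInd_hom_ext fun k m => ?_))
    refine (arrowIndHom_of (α ≫ β) (StructuredArrow.mk k) m).trans ?_
    exact ((congrArg (arrowIndHom β c) (arrowIndHom_of α (StructuredArrow.mk k) m)).trans
      (arrowIndHom_of β (StructuredArrow.mk k) _)).symm

variable {φ d}

open Classical in
/-- The map from a direct sum of values of `M` given by a morphism to a restricted module. -/
def arrowDescApp {M : LMod (StructuredArrow d φ)} {G : LMod C}
    (α : M ⟶ StructuredArrow.proj d φ ⋙ G) (c : C) :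
    (⨁ f : d ⟶ φ.obj c, M.obj (StructuredArrow.mk f)) →+ G.obj c :=
  DirectSum.toAddMonoid (β := fun f : d ⟶ φ.obj c => M.obj (StructuredArrow.mk f)) fun f =>
    ((α.app (StructuredArrow.mk f)).hom : M.obj (StructuredArrow.mk f) →+ G.obj c)

open Classical in
lemma arrowDescApp_of {M : LMod (StructuredArrow d φ)} {G : LMod C}
    (α : M ⟶ StructuredArrow.proj d φ ⋙ G) (x : StructuredArrow d φ) (m : M.obj x) :
    arrowDescApp α x.right (arrowIndOf φ d M x m) = α.app x m :=
  DirectSum.toAddMonoid_of (γ := G.obj x.right)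
    (β := fun f : d ⟶ φ.obj x.right => M.obj (StructuredArrow.mk f)) (fun f => ((α.app (StructuredArrow.mk f)).hom :
      M.obj (StructuredArrow.mk f) →+ G.obj x.right)) x.hom m

/-- The morphism from an induced module given by a morphism to a restricted module. -/
def arrowDesc {M : LMod (StructuredArrow d φ)} {G : LMod C}
    (α : M ⟶ StructuredArrow.proj d φ ⋙ G) : (arrowInd φ d).obj M ⟶ G where
  app c := AddCommGrpCat.ofHom (arrowDescApp α c)
  naturality c c' f := by
    refine AddCommGrpCat.hom_ext (arrowInd_hom_ext fun k m => ?_)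
    let f' : StructuredArrow.mk k ⟶ StructuredArrow.mk (k ≫ φ.map f) :=
      StructuredArrow.homMk f rfl
    refine (congrArg (arrowDescApp α c') (arrowIndMap_of _ f' m)).trans ?_
    refine (arrowDescApp_of α _ _).trans ?_
    refine (ConcreteCategory.congr_hom (α.naturality f') m).trans ?_
    exact congrArg (G.map f) (arrowDescApp_of α (StructuredArrow.mk k) m).symm

lemma arrowDesc_of {M : LMod (StructuredArrow d φ)} {G : LMod C}
    (α : M ⟶ StructuredArrow.proj d φ ⋙ G) (x : StructuredArrow d φ) (m : M.obj x) :
    (arrowDesc α).app x.right (arrowIndOf φ d M x m) = α.app x m :=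
  arrowDescApp_of α x m

/-- The morphism to a restricted module given by a morphism from an induced module. -/
def arrowCurry {M : LMod (StructuredArrow d φ)} {G : LMod C} (α : (arrowInd φ d).obj M ⟶ G) :
    M ⟶ StructuredArrow.proj d φ ⋙ G where
  app x := AddCommGrpCat.ofHom ((α.app x.right).hom.comp (arrowIndOf φ d M x))
  naturality x y f := by
    refine AddCommGrpCat.hom_ext (AddMonoidHom.ext fun m => ?_)
    refine Eq.trans (congrArg (α.app y.right) (arrowIndMap_of M f m).symm) ?_
    exact ConcreteCategory.congr_hom (α.naturality f.right) (arrowIndOf φ d M x m)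

variable (φ d)

/-- Induction along `d|φ ⥤ C` is left adjoint to restriction. -/
def arrowAdj : arrowInd φ d ⊣
    (Functor.whiskeringLeft (StructuredArrow d φ) C AddCommGrpCat.{u}).obj
      (StructuredArrow.proj d φ) :=
  Adjunction.mkOfHomEquiv
    { homEquiv := fun _ _ =>
        { toFun := arrowCurry
          invFun := arrowDesc
          left_inv := fun α => NatTrans.ext (funext fun _ => AddCommGrpCat.hom_ext
            (arrowInd_hom_ext fun k m => arrowDesc_of (arrowCurry α) (StructuredArrow.mk k) m))
          right_inv := fun α => NatTrans.ext (funext fun x => AddCommGrpCat.hom_ext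
            (AddMonoidHom.ext fun m => arrowDesc_of α x m)) }
      homEquiv_naturality_left_symm := fun α β => NatTrans.ext (funext fun c =>
        AddCommGrpCat.hom_ext (arrowInd_hom_ext fun k m =>
          (arrowDesc_of (α ≫ β) (StructuredArrow.mk k) m).trans
            ((congrArg ((arrowDesc β).app c) (arrowIndHom_of α (StructuredArrow.mk k) m)).trans
              (arrowDesc_of β (StructuredArrow.mk k) _)).symm))
      homEquiv_naturality_right := fun _ _ => rfl }

instance : (arrowInd φ d).Additive := (arrowAdj φ d).left_adjoint_additive

instance : (arrowInd φ d).IsLeftAdjoint := (arrowAdj φ d).isLeftAdjoint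

variable {φ d}

/-- Values of the induced module are direct sums of values of M, so preimages can be chosen
componentwise on the finite support. -/
lemma arrowInd_exact {S : ShortComplex (LMod (StructuredArrow d φ))} (hS : S.Exact) :
    (S.map (arrowInd φ d)).Exact := by
  classical
  rw [LMod.exact_iff] at hS ⊢
  intro c b hb
  let b : ⨁ f : d ⟶ φ.obj c, S.X₂.obj (StructuredArrow.mk f) := b
  have hb' : ∀ k, S.g.app (StructuredArrow.mk k) (b k) = 0 := fun k =>
    (DirectSum.map_apply (fun f => (S.g.app (StructuredArrow.mk f)).hom) k b).symm.trans
      (congrArg (fun t : ⨁ f : d ⟶ φ.obj c, S.X₃.obj (StructuredArrow.mk f) => t k) hb)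
  choose a ha using fun k => hS _ (b k) (hb' k)
  refine ⟨DirectSum.mk _ b.support fun k => a k, DFinsupp.ext fun k => ?_⟩
  refine (DirectSum.map_apply (fun f => (S.f.app (StructuredArrow.mk f)).hom) k _).trans ?_
  by_cases hk : k ∈ b.support
  · rw [DirectSum.mk_apply_of_mem hk]
    exact ha k
  · rw [DirectSum.mk_apply_of_notMem hk, map_zero]
    exact (DFinsupp.notMem_support_iff.1 hk).symm

/-- Induction of a projective resolution along `d|φ ⥤ C`. -/
def arrowIndResolution {Z : LMod (StructuredArrow d φ)} (P : ProjectiveResolution Z) :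
    ProjectiveResolution ((arrowInd φ d).obj Z) :=
  mkResolution (((arrowInd φ d).mapHomologicalComplex _).obj P.complex)
    (fun m => (arrowAdj φ d).map_projective (P.complex.X m) inferInstance)
    ((arrowInd φ d).map (P.π.f 0 : P.complex.X 0 ⟶ Z))
    (((arrowInd φ d).map_comp _ _).symm.trans ((congrArg _ P.complex_d_comp_π_f_zero).trans
      ((arrowInd φ d).map_zero _ _)))
    (by
      have : Epi (P.π.f 0 : P.complex.X 0 ⟶ Z) := inferInstanceAs (Epi (P.π.f 0))
      exact (arrowInd φ d).map_epi (P.π.f 0 : P.complex.X 0 ⟶ Z))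
    (arrowInd_exact P.exact₀) (fun k => arrowInd_exact (P.exact_succ k))

/-- The projection formula. -/
def arrowTensorIso (F : RMod C) :
    arrowInd φ d ⋙ tensorFunctor F ≅ tensorFunctor ((StructuredArrow.proj d φ).op ⋙ F) :=
  -- Both functors are left adjoint to A ↦ Hom(F(-), A) restricted to d|φ.
  Adjunction.leftAdjointUniq ((arrowAdj φ d).comp (tensorAdj F))
    (tensorAdj ((StructuredArrow.proj d φ).op ⋙ F))

/-- Inducing a projective resolution over d|φ gives one over C, and the projection formula
identifies the two tensored complexes. -/
lemma isZero_leftDerived_arrowInd {F : RMod C} {Z : LMod (StructuredArrow d φ)} (k : ℕ)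
    (h : IsZero (((tensorFunctor ((StructuredArrow.proj d φ).op ⋙ F)).leftDerived k).obj Z)) :
    IsZero (((tensorFunctor F).leftDerived k).obj ((arrowInd φ d).obj Z)) := by
  let P := projectiveResolution Z
  have h1 := h.of_iso (P.isoLeftDerivedObj _ k).symm
  refine IsZero.of_iso ?_ ((arrowIndResolution P).isoLeftDerivedObj _ k)
  refine h1.of_iso ?_
  exact (HomologicalComplex.homologyFunctor _ _ k).mapIso
    ((NatIso.mapHomologicalComplex (arrowTensorIso (φ := φ) (d := d) F) _).app P.complex)

variable (φ d)

/-- The elements of a restricted standard projective given by the morphisms `d ⟶ φ(c)`. -/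
def constZToStd : constZ (StructuredArrow d φ) ⟶
    StructuredArrow.proj d φ ⋙ φ ⋙ (stdProj D).obj (op d) where
  app x := AddCommGrpCat.ofHom (((zmultiplesHom (FreeAbelianGroup (d ⟶ φ.obj x.right)))
    (.of x.hom)).comp AddEquiv.ulift.toAddMonoidHom)
  naturality x y f := by
    refine AddCommGrpCat.hom_ext (AddMonoidHom.ext fun ⟨n⟩ => ?_)
    refine Eq.trans ?_ (map_zsmul (FreeAbelianGroup.map (fun k => k ≫ φ.map f.right)) n
      (.of x.hom)).symm
    refine congrArg (fun t : FreeAbelianGroup (d ⟶ φ.obj y.right) => n • t) ?_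
    exact (congrArg FreeAbelianGroup.of (StructuredArrow.w f).symm).trans
      (FreeAbelianGroup.map_of_apply _).symm

/-- The inverse of the isomorphism between induced constant module and restricted projective. -/
def stdToArrowInd (c : C) : FreeAbelianGroup (d ⟶ φ.obj c) →+
    ⨁ f : d ⟶ φ.obj c, (constZ (StructuredArrow d φ)).obj (StructuredArrow.mk f) :=
  FreeAbelianGroup.lift fun f =>
    arrowIndOf φ d (constZ (StructuredArrow d φ)) (StructuredArrow.mk f) (ULift.up (1 : ℤ))

lemma stdToArrowInd_of (c : C) (k : d ⟶ φ.obj c) : stdToArrowInd φ d c (.of k) =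
    arrowIndOf φ d (constZ (StructuredArrow d φ)) (StructuredArrow.mk k) (ULift.up (1 : ℤ)) :=
  FreeAbelianGroup.lift_apply_of _ k

instance (c : C) : IsIso ((arrowDesc (constZToStd φ d)).app c) := by
  refine ⟨AddCommGrpCat.ofHom (stdToArrowInd φ d c), ?_, ?_⟩
  · refine AddCommGrpCat.hom_ext (arrowInd_hom_ext fun k m => ?_)
    obtain ⟨n⟩ := m
    refine (congrArg (stdToArrowInd φ d c)
      (arrowDesc_of (constZToStd φ d) (StructuredArrow.mk k) ⟨n⟩)).trans ?_
    refine (map_zsmul (stdToArrowInd φ d c) n (.of k)).trans ?_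
    refine (congrArg (n • ·) (stdToArrowInd_of φ d c k)).trans ?_
    refine (map_zsmul (arrowIndOf φ d (constZ (StructuredArrow d φ)) (StructuredArrow.mk k)) n
      (ULift.up (1 : ℤ))).symm.trans ?_
    refine congrArg (arrowIndOf φ d (constZ (StructuredArrow d φ)) (StructuredArrow.mk k)) ?_
    exact congrArg ULift.up ((smul_eq_mul n 1).trans (mul_one n))
  · refine AddCommGrpCat.hom_ext (FreeAbelianGroup.lift_ext _ _ fun k => ?_)
    refine (congrArg ((arrowDesc (constZToStd φ d)).app c)
      (stdToArrowInd_of φ d c k)).trans ?_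
    refine (arrowDesc_of (constZToStd φ d) (StructuredArrow.mk k) ⟨1⟩).trans ?_
    exact one_zsmul _

instance : IsIso (arrowDesc (constZToStd φ d)) := NatIso.isIso_of_isIso_app _

/-- The module induced by the constant module is a restricted standard projective. -/
def arrowIndConstZ : (arrowInd φ d).obj (constZ (StructuredArrow d φ)) ≅
    φ ⋙ (stdProj D).obj (op d) :=
  asIso (arrowDesc (constZToStd φ d))

end ArrowInduction

end

end CatDuality

namespace CatDuality

noncomputable section

/-! ### Vanishing of Ext into standard projectives of D -/

section Vanishing

variable {C D : Type u} [SmallCategory C] [SmallCategory D] (φ : C ⥤ D)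

lemma isZero_tor_arrowInd {F : RMod C} {d : D} {Z : LMod (StructuredArrow d φ)} :
    ∀ k : ℤ, IsZero ((Tor ((StructuredArrow.proj d φ).op ⋙ F) k).obj Z) →
      IsZero ((Tor F k).obj ((arrowInd φ d).obj Z))
  | Int.ofNat k, h => isZero_leftDerived_arrowInd k h
  -- In negative degrees both Tor groups are the same trivial group by definition.
  | Int.negSucc _, h => h

/-- Extⁱ_D(ℤ, P_d) is controlled by Extⁱ_C(ℤ, φ*P_d), which duality for C turns into Tor with
coefficients in φ*P_d; that module is induced from the constant module on d|φ. -/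
lemma ext_stdProj_eq_zero {n : ℕ} (hC : IsDualityCategoryOfDim C n)
    (hφ : ∀ d : D, IsContractible (CostructuredArrow φ d)) {d : D} {i : ℕ}
    (h : IsZero ((Tor ((StructuredArrow.proj d φ).op ⋙ dualizingFunctor C n)
      ((n : ℤ) - (i : ℤ))).obj (constZ (StructuredArrow d φ))))
    (x : Abelian.Ext (constZ D) ((stdProj D).obj (op d)) i) : x = 0 := by
  obtain ⟨P, -⟩ := hC.1
  refine ext_eq_zero_of_restrict φ hφ P i (fun y => ?_) x
  obtain ⟨e⟩ := hC.2 i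
  have h1 := (isZero_tor_arrowInd φ _ h).of_iso
    ((Tor (dualizingFunctor C n) ((n : ℤ) - (i : ℤ))).mapIso (arrowIndConstZ φ d).symm)
  have h2 := h1.of_iso (e.app (φ ⋙ (stdProj D).obj (op d)))
  have h3 := AddCommGrpCat.subsingleton_of_isZero h2
  exact h3.elim y 0

end Vanishing

/-! ### Free modules and their finite truncations -/

section Free

variable {C : Type u} [SmallCategory C] {I : Type u} (x : I → C)

/-- The free module on generators in degrees `x`. -/
def freeObj : LMod C where
  obj y := AddCommGrpCat.of (FreeAbelianGroup (Σ s, x s ⟶ y))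
  map f := AddCommGrpCat.ofHom (FreeAbelianGroup.map fun p => ⟨p.1, p.2 ≫ f⟩)
  map_id y := by
    refine AddCommGrpCat.hom_ext (FreeAbelianGroup.lift_ext _ _ fun p => ?_)
    refine (FreeAbelianGroup.map_of_apply _).trans ?_
    rw [Category.comp_id]
    rfl
  map_comp f g := by
    refine AddCommGrpCat.hom_ext (FreeAbelianGroup.lift_ext _ _ fun p => ?_)
    refine (FreeAbelianGroup.map_of_apply _).trans ?_
    rw [← Category.assoc]
    exact ((congrArg (FreeAbelianGroup.map _) (FreeAbelianGroup.map_of_apply _)).trans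
      (FreeAbelianGroup.map_of_apply _)).symm

/-- The generators of a free module. -/
def freeGen (s : I) : (freeObj x).obj (x s) :=
  (FreeAbelianGroup.of ⟨s, 𝟙 (x s)⟩ : FreeAbelianGroup (Σ t, x t ⟶ x s))

variable {x}

lemma freeObj_map_gen {s : I} {y : C} (f : x s ⟶ y) :
    (freeObj x).map f (freeGen x s) = (FreeAbelianGroup.of ⟨s, f⟩ :
      FreeAbelianGroup (Σ t, x t ⟶ y)) := by
  refine (FreeAbelianGroup.map_of_apply _).trans ?_
  rw [Category.id_comp]

lemma freeObj_induction {y : C} {p : (freeObj x).obj y → Prop} (b : (freeObj x).obj y)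
    (zero : p 0) (add : ∀ b b', p b → p b' → p (b + b')) (neg : ∀ b, p b → p (-b))
    (gen : ∀ (s : I) (f : x s ⟶ y), p ((freeObj x).map f (freeGen x s))) : p b := by
  let b : FreeAbelianGroup (Σ s, x s ⟶ y) := b
  have hg : ∀ q : Σ s, x s ⟶ y, p (FreeAbelianGroup.of q :
      FreeAbelianGroup (Σ s, x s ⟶ y)) := fun q => (freeObj_map_gen q.2) ▸ gen q.1 q.2
  exact FreeAbelianGroup.induction_on (motive := p) b zero hg (fun q h => neg _ h)
    fun b b' => add b b'

lemma freeObj_hom_ext {G : LMod C} {α β : freeObj x ⟶ G}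
    (h : ∀ s, α.app _ (freeGen x s) = β.app _ (freeGen x s)) : α = β := by
  refine NatTrans.ext (funext fun y => AddCommGrpCat.hom_ext (AddMonoidHom.ext fun b => ?_))
  refine freeObj_induction (p := fun b => (α.app y).hom b = (β.app y).hom b) b ?_ ?_ ?_ ?_
  · rw [map_zero, map_zero]
  · intro b b' hb hb'
    rw [map_add, map_add, hb, hb']
  · intro b hb
    rw [map_neg, map_neg, hb]
  · intro s f
    exact (ConcreteCategory.congr_hom (α.naturality f) _).trans ((congrArg (G.map f) (h s)).trans
      (ConcreteCategory.congr_hom (β.naturality f) _).symm)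

/-- The morphism from a free module given by the images of the generators. -/
def freeDesc {G : LMod C} (a : ∀ s, G.obj (x s)) : freeObj x ⟶ G where
  app y := AddCommGrpCat.ofHom (FreeAbelianGroup.lift fun p : Σ s, x s ⟶ y => G.map p.2 (a p.1))
  naturality y y' f := by
    refine AddCommGrpCat.hom_ext (FreeAbelianGroup.lift_ext _ _ fun p => ?_)
    refine (congrArg (FreeAbelianGroup.lift _) (FreeAbelianGroup.map_of_apply _)).trans ?_
    refine (FreeAbelianGroup.lift_apply_of _ _).trans (Eq.trans ?_
      (congrArg (G.map f) (FreeAbelianGroup.lift_apply_of _ _)).symm)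
    exact CategoryTheory.Functor.map_comp_apply G p.2 f _

lemma freeDesc_gen {G : LMod C} (a : ∀ s, G.obj (x s)) (s : I) :
    (freeDesc a).app _ (freeGen x s) = a s :=
  (FreeAbelianGroup.lift_apply_of _ _).trans (CategoryTheory.Functor.map_id_apply G (x s) (a s))

instance freeObj_projective : Projective (freeObj x) where
  factors {E X} f e he := by
    have h := (LMod.epi_iff e).1 he
    choose g hg using fun s => h _ (f.app _ (freeGen x s))
    refine ⟨freeDesc g, freeObj_hom_ext fun s => ?_⟩
    exact (congrArg (e.app _) (freeDesc_gen g s)).trans (hg s)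

variable (x) in
/-- The inclusion of a standard projective in a free module. -/
def freeι (s : I) : (stdProj C).obj (op (x s)) ⟶ freeObj x := stdDesc (freeGen x s)

variable (x) in
open Classical in
/-- The projection of a free module to a standard projective. -/
def freeπ (s : I) : freeObj x ⟶ (stdProj C).obj (op (x s)) :=
  freeDesc fun t => if h : s = t then h ▸ stdGen (x s) else 0

lemma freeι_gen (s : I) : (freeι x s).app _ (stdGen (x s)) = freeGen x s := stdDesc_gen _

lemma freeι_π_self (s : I) : freeι x s ≫ freeπ x s = 𝟙 _ := by
  refine stdProj_hom_ext ?_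
  refine (congrArg ((freeπ x s).app _) (freeι_gen s)).trans ?_
  exact (freeDesc_gen _ s).trans (dif_pos rfl)

lemma freeι_π_of_ne {s t : I} (h : t ≠ s) : freeι x s ≫ freeπ x t = 0 := by
  refine stdProj_hom_ext ?_
  refine (congrArg ((freeπ x t).app _) (freeι_gen s)).trans ?_
  exact (freeDesc_gen _ s).trans (dif_neg h)

variable (x) in
/-- The projection to the part of a free module generated by a finite set of generators. -/
def freeTrunc (S : Finset I) : freeObj x ⟶ freeObj x := ∑ s ∈ S, freeπ x s ≫ freeι x s

lemma freeι_trunc {S : Finset I} {s : I} (hs : s ∈ S) : freeι x s ≫ freeTrunc x S = freeι x s := by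
  rw [freeTrunc, Preadditive.comp_sum, Finset.sum_eq_single s]
  · rw [← Category.assoc, freeι_π_self, Category.id_comp]
  · intro t _ ht
    rw [← Category.assoc, freeι_π_of_ne ht, zero_comp]
  · exact fun h => absurd hs h

lemma freeTrunc_gen {S : Finset I} {s : I} (hs : s ∈ S) :
    (freeTrunc x S).app _ (freeGen x s) = freeGen x s :=
  (congrArg ((freeTrunc x S).app _) (freeι_gen s)).symm.trans
    ((ConcreteCategory.congr_hom (NatTrans.congr_app (freeι_trunc hs) _) (stdGen (x s))).trans
      (freeι_gen s))

/-- An element involves finitely many generators. Allowing every larger set lets finitely many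
elements be treated at once. -/
lemma exists_freeTrunc_apply {y : C} (b : (freeObj x).obj y) :
    ∃ S : Finset I, ∀ S', S ⊆ S' → (freeTrunc x S').app y b = b := by
  classical
  refine freeObj_induction (p := fun b => ∃ S : Finset I, ∀ S', S ⊆ S' →
    (freeTrunc x S').app y b = b) b ⟨∅, fun S' _ => map_zero _⟩ ?_ ?_ ?_
  · rintro b b' ⟨S, hS⟩ ⟨S', hS'⟩
    refine ⟨S ∪ S', fun T hT => ?_⟩
    rw [map_add, hS T (Finset.union_subset_left hT), hS' T (Finset.union_subset_right hT)]
  · rintro b ⟨S, hS⟩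
    refine ⟨S, fun T hT => ?_⟩
    rw [map_neg, hS T hT]
  · intro s f
    refine ⟨{s}, fun T hT => ?_⟩
    exact (ConcreteCategory.congr_hom ((freeTrunc x T).naturality f) (freeGen x s)).trans
      (congrArg ((freeObj x).map f) (freeTrunc_gen (hT (Finset.mem_singleton_self s))))

/-- The map is determined by the images of finitely many generators. -/
lemma IsFiniteType.exists_comp_freeTrunc {P : LMod C} (hP : IsFiniteType P) (f : P ⟶ freeObj x) :
    ∃ S, f ≫ freeTrunc x S = f := by
  classical
  obtain ⟨k, y, p, hp⟩ := hP
  choose S hS using fun j => exists_freeTrunc_apply ((Sigma.ι (fun j => (stdProj C).obj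
    (op (y j))) j ≫ p ≫ f).app _ (stdGen (y j)))
  refine ⟨Finset.univ.biUnion S, (cancel_epi p).1 (Sigma.hom_ext _ _ fun j => ?_)⟩
  refine stdProj_hom_ext ?_
  exact hS j _ (Finset.subset_biUnion_of_mem S (Finset.mem_univ j))

end Free

/-! ### Ext of modules of type FP -/

section ExtFree

variable {C : Type u} [SmallCategory C]

/-- A cocycle starts from a module of finite type, so it has values in a finite part of the free
module. This replaces commutation of Ext with direct sums. -/
lemma IsTypeFP.exists_ext_freeTrunc {F : LMod C} (hF : IsTypeFP F) {I : Type u} (x : I → C) {i : ℕ}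
    (a : ((Abelian.extFunctor i).obj (op F)).obj (freeObj x)) :
    ∃ S, ((Abelian.extFunctor i).obj (op F)).map (freeTrunc x S) a = a := by
  obtain ⟨P, hP, -⟩ := hF
  let a : Abelian.Ext F (freeObj x) i := a
  obtain ⟨f, hf, ha⟩ := P.extMk_surjective a (i + 1) rfl
  obtain ⟨S, hS⟩ := (hP i).exists_comp_freeTrunc f
  refine ⟨S, ?_⟩
  change a.comp (Abelian.Ext.mk₀ (freeTrunc x S)) (add_zero i) = a
  rw [← ha, P.extMk_comp_mk₀]
  congr 1

lemma IsTypeFP.exists_ext_eq_zero {F : LMod C} (hF : IsTypeFP F) :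
    ∃ N : ℕ, ∀ i, N < i → ∀ (G : LMod C) (a : Abelian.Ext F G i), a = 0 := by
  obtain ⟨P, -, N, hN⟩ := hF
  refine ⟨N, fun i hi G a => ?_⟩
  obtain ⟨f, hf, rfl⟩ := P.extMk_surjective a (i + 1) rfl
  have : f = 0 := (hN i hi).eq_of_src _ _
  subst this
  exact P.extMk_zero _ _

end ExtFree

end

end CatDuality

namespace CatDuality

noncomputable section

/-! ### Functorial free covers and syzygies -/

section FreeCover

variable {C : Type u} [SmallCategory C]

/-- The free module on the elements of a module. -/
abbrev coverObj (G : LMod C) : LMod C := freeObj (I := Σ x : C, G.obj x) Sigma.fst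

/-- The generators of the free cover. -/
def coverGen (G : LMod C) (s : Σ x : C, G.obj x) : (coverObj G).obj s.1 :=
  freeGen (I := Σ x : C, G.obj x) Sigma.fst s

lemma coverObj_hom_ext {G H : LMod C} {α β : coverObj G ⟶ H}
    (h : ∀ s, α.app _ (coverGen G s) = β.app _ (coverGen G s)) : α = β :=
  freeObj_hom_ext h

/-- The map of free covers induced by a morphism. -/
def coverMap {G G' : LMod C} (α : G ⟶ G') : coverObj G ⟶ coverObj G' :=
  freeDesc fun s => coverGen G' ⟨s.1, α.app s.1 s.2⟩

lemma coverMap_gen {G G' : LMod C} (α : G ⟶ G') (s : Σ x : C, G.obj x) :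
    (coverMap α).app _ (coverGen G s) = coverGen G' ⟨s.1, α.app s.1 s.2⟩ :=
  freeDesc_gen _ s

/-- The projection of the free cover. -/
def coverπ (G : LMod C) : coverObj G ⟶ G := freeDesc fun s => s.2

lemma coverπ_gen (G : LMod C) (s : Σ x : C, G.obj x) :
    (coverπ G).app s.1 (coverGen G s) = s.2 :=
  freeDesc_gen _ s

lemma coverMap_comp {G G' G'' : LMod C} (α : G ⟶ G') (β : G' ⟶ G'') :
    coverMap (α ≫ β) = coverMap α ≫ coverMap β := by
  refine coverObj_hom_ext fun s => (coverMap_gen (α ≫ β) s).trans ?_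
  refine (coverMap_gen β ⟨s.1, α.app s.1 s.2⟩).symm.trans ?_
  exact congrArg ((coverMap β).app s.1) (coverMap_gen α s).symm

lemma coverMap_π {G G' : LMod C} (α : G ⟶ G') : coverMap α ≫ coverπ G' = coverπ G ≫ α := by
  refine coverObj_hom_ext fun s => ?_
  refine (congrArg ((coverπ G').app s.1) (coverMap_gen α s)).trans ?_
  refine (coverπ_gen G' ⟨s.1, α.app s.1 s.2⟩).trans ?_
  exact congrArg (α.app s.1) (coverπ_gen G s).symm

variable (C) in
/-- The functorial cover of a module by a free module. -/
def freeCover : LMod C ⥤ LMod C where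
  obj G := coverObj G
  map α := coverMap α
  map_id G := coverObj_hom_ext fun s => coverMap_gen (𝟙 G) s
  map_comp α β := coverMap_comp α β

variable (C) in
/-- The projection of the free cover. -/
def freeCoverπ : freeCover C ⟶ 𝟭 (LMod C) where
  app G := coverπ G
  naturality _ _ α := coverMap_π α

instance (G : LMod C) : Epi ((freeCoverπ C).app G) :=
  (LMod.epi_iff _).2 fun x b => ⟨_, coverπ_gen G ⟨x, b⟩⟩

instance (G : LMod C) : Projective ((freeCover C).obj G) :=
  inferInstanceAs (Projective (coverObj G))

variable (C) in
/-- The functorial first syzygy of a module. -/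
def syz : LMod C ⥤ LMod C where
  obj G := kernel ((freeCoverπ C).app G)
  map α := kernel.map _ _ ((freeCover C).map α) α ((freeCoverπ C).naturality α).symm
  map_id G := by
    rw [← cancel_mono (kernel.ι _), kernel.lift_ι, CategoryTheory.Functor.map_id,
      Category.comp_id, Category.id_comp]
  map_comp α β := by
    rw [← cancel_mono (kernel.ι _), kernel.lift_ι, Category.assoc, kernel.lift_ι,
      kernel.lift_ι_assoc, CategoryTheory.Functor.map_comp, Category.assoc]

variable (C) in
/-- The inclusion of the first syzygy. -/
def syzι : syz C ⟶ freeCover C where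
  app G := kernel.ι ((freeCoverπ C).app G)
  naturality _ _ _ := kernel.lift_ι _ _ _

instance (G : LMod C) : Mono ((syzι C).app G) :=
  inferInstanceAs (Mono (kernel.ι ((freeCoverπ C).app G)))

lemma syzι_π (G : LMod C) : (syzι C).app G ≫ (freeCoverπ C).app G = 0 := kernel.condition _

/-- The short exact sequence of the free cover. -/
def syzSeq (G : LMod C) : ShortComplex (LMod C) := ShortComplex.mk _ _ (syzι_π G)

lemma syzSeq_shortExact (G : LMod C) : (syzSeq G).ShortExact where
  exact := ShortComplex.exact_kernel _
  mono_f := inferInstanceAs (Mono ((syzι C).app G))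
  epi_g := inferInstanceAs (Epi ((freeCoverπ C).app G))

end FreeCover

/-! ### An Eilenberg–Watts theorem -/

section Coend

variable {C : Type u} [SmallCategory C]

lemma stdProj_map_gen {x y : C} (g : x ⟶ y) :
    ((stdProj C).map g.op).app y (stdGen y) = ((stdProj C).obj (op x)).map g (stdGen x) := by
  refine (FreeAbelianGroup.map_of_apply (f := fun k : y ⟶ y => g ≫ k) (𝟙 y)).trans ?_
  refine Eq.trans ?_ (FreeAbelianGroup.map_of_apply (f := fun k : x ⟶ x => k ≫ g) (𝟙 x)).symm
  rw [Category.comp_id, Category.id_comp]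

lemma stdDesc_comp {x : C} {G G' : LMod C} (b : G.obj x) (α : G ⟶ G') :
    stdDesc b ≫ α = stdDesc (α.app x b) :=
  stdProj_hom_ext ((congrArg (α.app x) (stdDesc_gen b)).trans (stdDesc_gen _).symm)

lemma stdDesc_add {x : C} {G : LMod C} (b b' : G.obj x) :
    stdDesc (b + b') = stdDesc b + stdDesc b' := by
  refine stdProj_hom_ext ((stdDesc_gen (b + b')).trans ?_)
  exact (congrArg₂ (· + ·) (stdDesc_gen b) (stdDesc_gen b')).symm

lemma stdProj_map_desc {x y : C} (g : x ⟶ y) {G : LMod C} (b : G.obj x) :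
    (stdProj C).map g.op ≫ stdDesc b = stdDesc (G.map g b) := by
  refine stdProj_hom_ext ?_
  refine (congrArg ((stdDesc b).app y) (stdProj_map_gen g)).trans ?_
  refine (ConcreteCategory.congr_hom ((stdDesc b).naturality g) (stdGen x)).trans ?_
  exact (congrArg (G.map g) (stdDesc_gen b)).trans (stdDesc_gen (G.map g b)).symm

lemma stdDesc_stdGen (x : C) : stdDesc (stdGen x) = 𝟙 ((stdProj C).obj (op x)) :=
  stdProj_hom_ext (stdDesc_gen _)

variable (T : LMod C ⥤ AddCommGrpCat.{u}) [T.Additive]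

/-- The biadditive maps `T(P_x) × G(x) → T(G)`. -/
def coendPairing (G : LMod C) (x : C) :
    G.obj x →+ (stdProj C ⋙ T).obj (op x) →+ T.obj G :=
  AddMonoidHom.mk' (fun b => (T.map (stdDesc b)).hom) fun b b' => by
    rw [stdDesc_add, T.map_add]
    rfl

lemma isBalanced_coendPairing (G : LMod C) :
    IsBalanced (F := stdProj C ⋙ T) (coendPairing T G) := fun x y g a b => by
  refine (ConcreteCategory.congr_hom (T.map_comp ((stdProj C).map g.op) (stdDesc b)) a).symm.trans ?_
  rw [stdProj_map_desc]
  rfl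

/-- The natural map `T(P) ⊗_C G ⟶ T(G)`. -/
def coendMap : tensorFunctor (stdProj C ⋙ T) ⟶ T where
  app G := tensorDesc (coendPairing T G) (isBalanced_coendPairing T G)
  naturality G G' α := tensor_hom_ext fun x a b => by
    refine (congrArg (tensorDesc (coendPairing T G') (isBalanced_coendPairing T G'))
      (tensorFunctor_map_tmk α a b)).trans ?_
    refine (tensorDesc_tmk _ (isBalanced_coendPairing T G') a _).trans ?_
    refine Eq.trans ?_ (congrArg (T.map α)
      (tensorDesc_tmk _ (isBalanced_coendPairing T G) a b)).symm
    refine Eq.trans ?_ (ConcreteCategory.congr_hom (T.map_comp (stdDesc b) α) a)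
    rw [stdDesc_comp]
    rfl

lemma coendMap_tmk (G : LMod C) {x : C} (a : (stdProj C ⋙ T).obj (op x)) (b : G.obj x) :
    (coendMap T).app G (tmk _ a b) = T.map (stdDesc b) a :=
  tensorDesc_tmk _ (isBalanced_coendPairing T G) a b

variable {T}

lemma tmk_zero_left {F : RMod C} {G : LMod C} {x : C} (b : G.obj x) : tmk F 0 b = 0 := by
  have h := tmk_add_left (F := F) 0 0 b
  rw [add_zero] at h
  exact left_eq_add.1 h

lemma tmk_zero_right {F : RMod C} {G : LMod C} {x : C} (a : F.obj (op x)) :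
    tmk F a (0 : G.obj x) = 0 := by
  have h := tmk_add_right (G := G) a 0 0
  rw [add_zero] at h
  exact left_eq_add.1 h

lemma tmk_neg_left {F : RMod C} {G : LMod C} {x : C} (a : F.obj (op x)) (b : G.obj x) :
    tmk F (-a) b = -tmk F a b := by
  have h := tmk_add_left (-a) a b
  rw [neg_add_cancel, tmk_zero_left] at h
  exact eq_neg_of_add_eq_zero_left h.symm

lemma tmk_neg_right {F : RMod C} {G : LMod C} {x : C} (a : F.obj (op x)) (b : G.obj x) :
    tmk F a (-b) = -tmk F a b := by
  have h := tmk_add_right a (-b) b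
  rw [neg_add_cancel, tmk_zero_right] at h
  exact eq_neg_of_add_eq_zero_left h.symm

lemma exists_tmk_stdGen {F : RMod C} {y : C} (z : (tensorFunctor F).obj ((stdProj C).obj (op y))) :
    ∃ a, z = tmk F a (stdGen y) := by
  refine tensor_induction (p := fun z => ∃ a, z = tmk F a (stdGen y)) z
    ⟨0, (tmk_zero_left _).symm⟩ ?_ fun x a b => ?_
  · rintro _ _ ⟨a, rfl⟩ ⟨a', rfl⟩
    exact ⟨a + a', (tmk_add_left a a' _).symm⟩
  · let b : FreeAbelianGroup (y ⟶ x) := b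
    refine FreeAbelianGroup.induction_on (motive := fun b : FreeAbelianGroup (y ⟶ x) =>
      ∃ a', tmk F (G := (stdProj C).obj (op y)) a b = tmk F a' (stdGen y)) b ?_ ?_ ?_ ?_
    · exact ⟨0, (tmk_zero_right a).trans (tmk_zero_left _).symm⟩
    · intro f
      refine ⟨F.map f.op a, Eq.trans ?_ (tmk_map f a (stdGen y)).symm⟩
      refine congrArg (tmk F a) ?_
      refine Eq.trans ?_ (FreeAbelianGroup.map_of_apply (f := fun k : y ⟶ y => k ≫ f) (𝟙 y)).symm
      rw [Category.id_comp]
    · rintro f ⟨a', h⟩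
      exact ⟨-a', (tmk_neg_right a _).trans ((congrArg (- ·) h).trans (tmk_neg_left a' _).symm)⟩
    · rintro b b' ⟨c, h⟩ ⟨c', h'⟩
      exact ⟨c + c', (tmk_add_right a _ _).trans ((congrArg₂ (· + ·) h h').trans
        (tmk_add_left c c' _).symm)⟩

/-- Moving morphisms across the tensor sign writes every element as a ⊗ 1, and a ⊗ 1 is sent back to
a. -/
lemma coendMap_stdProj_injective (y : C) :
    Function.Injective ((coendMap T).app ((stdProj C).obj (op y))) := by
  intro z z' h
  obtain ⟨a, rfl⟩ := exists_tmk_stdGen z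
  obtain ⟨a', rfl⟩ := exists_tmk_stdGen z'
  have key : ∀ a, (coendMap T).app ((stdProj C).obj (op y)) (tmk _ a (stdGen y)) = a := by
    intro a
    refine (coendMap_tmk T _ a _).trans ?_
    rw [stdDesc_stdGen, T.map_id]
    rfl
  exact congrArg (fun a => tmk _ a (stdGen y)) ((key a).symm.trans (h.trans (key a')))

lemma exists_tensor_freeTrunc {F : RMod C} {I : Type u} {x : I → C}
    (z : (tensorFunctor F).obj (freeObj x)) :
    ∃ S : Finset I, ∀ S', S ⊆ S' → (tensorFunctor F).map (freeTrunc x S') z = z := by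
  classical
  refine tensor_induction (p := fun z => ∃ S : Finset I, ∀ S', S ⊆ S' →
    (tensorFunctor F).map (freeTrunc x S') z = z) z ⟨∅, fun S' _ => map_zero _⟩ ?_ ?_
  · rintro b b' ⟨S, hS⟩ ⟨S', hS'⟩
    refine ⟨S ∪ S', fun T hT => ?_⟩
    rw [map_add, hS T (Finset.union_subset_left hT), hS' T (Finset.union_subset_right hT)]
  · intro y a b
    obtain ⟨S, hS⟩ := exists_freeTrunc_apply b
    exact ⟨S, fun S' h => (tensorFunctor_map_tmk _ a b).trans (congrArg (tmk F a) (hS S' h))⟩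

lemma map_freeTrunc_apply (T : LMod C ⥤ AddCommGrpCat.{u}) [T.Additive] {I : Type u} (x : I → C)
    (S : Finset I) (z : T.obj (freeObj x)) :
    T.map (freeTrunc x S) z = ∑ s ∈ S, T.map (freeι x s) (T.map (freeπ x s) z) := by
  have h : ∀ (S : Finset I) (f : I → (T.obj (freeObj x) ⟶ T.obj (freeObj x))),
      (∑ s ∈ S, f s).hom z = ∑ s ∈ S, (f s).hom z := fun S f => by
    change (AddMonoidHom.eval z) (AddCommGrpCat.homAddEquiv (∑ s ∈ S, f s)) = _
    rw [map_sum, map_sum]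
    rfl
  rw [freeTrunc, T.map_sum]
  refine (h S _).trans (Finset.sum_congr rfl fun s _ => ?_)
  exact ConcreteCategory.congr_hom (T.map_comp (freeπ x s) (freeι x s)) z

/-- A tensor lives on finitely many summands, and on each of them the standard case applies. -/
lemma coendMap_freeObj_injective {I : Type u} (x : I → C) :
    Function.Injective ((coendMap T).app (freeObj x)) := by
  rw [injective_iff_map_eq_zero]
  intro z hz
  obtain ⟨S, hS⟩ := exists_tensor_freeTrunc z
  rw [← hS S subset_rfl, map_freeTrunc_apply]
  refine Finset.sum_eq_zero fun s _ => ?_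
  have h : (tensorFunctor (stdProj C ⋙ T)).map (freeπ x s) z = 0 := by
    refine coendMap_stdProj_injective (x s) ?_
    refine (ConcreteCategory.congr_hom ((coendMap T).naturality (freeπ x s)) z).trans ?_
    exact ((congrArg (T.map (freeπ x s)) hz).trans (map_zero _)).trans (map_zero _).symm
  rw [h, map_zero]

lemma freeι_coverπ (G : LMod C) (s : Σ x : C, G.obj x) :
    freeι (I := Σ x : C, G.obj x) Sigma.fst s ≫ coverπ G = stdDesc s.2 :=
  stdProj_hom_ext (((congrArg ((coverπ G).app s.1) (freeι_gen s)).trans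
    (coverπ_gen G s)).trans (stdDesc_gen s.2).symm)

/-- Lift to the free cover and truncate: the element becomes a finite sum of images of T(P_x) under
maps given by elements of G. -/
lemma coendMap_surjective (hT : ∀ {I : Type u} (x : I → C) (a : T.obj (freeObj x)),
      ∃ S, T.map (freeTrunc x S) a = a) {G : LMod C}
    (h : Function.Surjective (T.map (coverπ G))) :
    Function.Surjective ((coendMap T).app G) := by
  intro a
  obtain ⟨b, rfl⟩ := h a
  obtain ⟨S, hS⟩ := hT (I := Σ x : C, G.obj x) Sigma.fst b
  refine ⟨∑ s ∈ S, tmk _ (T.map (freeπ (I := Σ x : C, G.obj x) Sigma.fst s) b) s.2, ?_⟩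
  rw [map_sum]
  refine Eq.trans ?_ (congrArg (T.map (coverπ G)) hS)
  refine Eq.trans ?_ (congrArg (T.map (coverπ G))
    (map_freeTrunc_apply T (I := Σ x : C, G.obj x) Sigma.fst S b)).symm
  refine Eq.trans ?_ (map_sum (T.map (coverπ G)).hom _ _).symm
  refine Finset.sum_congr rfl fun s _ => (coendMap_tmk T G _ _).trans ?_
  rw [← freeι_coverπ]
  exact ConcreteCategory.congr_hom (T.map_comp _ _) _

lemma tensorFunctor_map_surjective (F : RMod C) {G G' : LMod C} (α : G ⟶ G') [Epi α] :
    Function.Surjective ((tensorFunctor F).map α) :=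
  (AddCommGrpCat.epi_iff_surjective _).1 inferInstance

/-- A four-lemma chase on the sequence syzygy → cover → G, with injectivity on the cover and
surjectivity on the syzygy. -/
lemma coendMap_injective {G : LMod C}
    (h : ∀ a, T.map ((freeCoverπ C).app G) a = 0 → ∃ b, T.map ((syzι C).app G) b = a)
    (hG : Function.Surjective ((coendMap T).app ((syz C).obj G))) :
    Function.Injective ((coendMap T).app G) := by
  rw [injective_iff_map_eq_zero]
  intro z hz
  obtain ⟨w, rfl⟩ := tensorFunctor_map_surjective (stdProj C ⋙ T) ((freeCoverπ C).app G) z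
  obtain ⟨b, hb⟩ := h ((coendMap T).app _ w) ((ConcreteCategory.congr_hom
    ((coendMap T).naturality ((freeCoverπ C).app G)) w).symm.trans hz)
  obtain ⟨v, rfl⟩ := hG b
  have hv : (tensorFunctor (stdProj C ⋙ T)).map ((syzι C).app G) v = w := by
    refine coendMap_freeObj_injective (I := Σ x : C, G.obj x) Sigma.fst ?_
    exact (ConcreteCategory.congr_hom ((coendMap T).naturality ((syzι C).app G)) v).trans hb
  rw [← hv]
  refine (ConcreteCategory.congr_hom ((tensorFunctor (stdProj C ⋙ T)).map_comp ((syzι C).app G)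
    ((freeCoverπ C).app G)) v).symm.trans ?_
  rw [syzι_π, Functor.map_zero]
  rfl

lemma isIso_coendMap (hT : ∀ {I : Type u} (x : I → C) (a : T.obj (freeObj x)),
      ∃ S, T.map (freeTrunc x S) a = a)
    (h : ∀ G, Function.Surjective (T.map ((freeCoverπ C).app G)))
    (h' : ∀ G a, T.map ((freeCoverπ C).app G) a = 0 → ∃ b, T.map ((syzι C).app G) b = a) :
    IsIso (coendMap T) := by
  have : ∀ G, IsIso ((coendMap T).app G) := fun G =>
    (ConcreteCategory.isIso_iff_bijective _).2
      ⟨coendMap_injective (h' G) (coendMap_surjective hT (h _)), coendMap_surjective hT (h G)⟩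
  exact NatIso.isIso_of_isIso_app _

end Coend

end

end CatDuality

namespace CatDuality

noncomputable section

/-! ### Pointwise kernels of natural transformations -/

section Kernel

variable {J : Type*} [Category* J]

/-- The morphism `δ` is a kernel of the morphism `t` of functors to abelian groups. -/
structure IsKernelMap {A B B' : J ⥤ AddCommGrpCat.{u}} (δ : A ⟶ B) (t : B ⟶ B') : Prop where
  injective : ∀ G, Function.Injective (δ.app G)
  zero : ∀ G a, t.app G (δ.app G a) = 0
  exists_eq : ∀ G b, t.app G b = 0 → ∃ a, δ.app G a = b

variable {A B B' A' : J ⥤ AddCommGrpCat.{u}} {δ : A ⟶ B} {t : B ⟶ B'}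

lemma IsKernelMap.exists_lift (h : IsKernelMap δ t) (f : A' ⟶ B)
    (hf : ∀ G a, t.app G (f.app G a) = 0) : ∃ g : A' ⟶ A, g ≫ δ = f := by
  choose g hg using fun G a => h.exists_eq G _ (hf G a)
  have hadd : ∀ G a b, g G (a + b) = g G a + g G b := fun G a b => h.injective G (by
    rw [map_add, hg, hg, hg, map_add])
  let γ : A' ⟶ A :=
    { app := fun G => AddCommGrpCat.ofHom (AddMonoidHom.mk' (g G) (hadd G))
      naturality := fun G G' α => AddCommGrpCat.hom_ext (AddMonoidHom.ext fun a => by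
        refine h.injective G' ?_
        refine (hg G' _).trans ?_
        refine (ConcreteCategory.congr_hom (f.naturality α) a).trans ?_
        refine (congrArg (B.map α) (hg G a)).symm.trans ?_
        exact (ConcreteCategory.congr_hom (δ.naturality α) (g G a)).symm) }
  exact ⟨γ, NatTrans.ext (funext fun G => AddCommGrpCat.hom_ext (AddMonoidHom.ext (hg G)))⟩

lemma IsKernelMap.eq_id (h : IsKernelMap δ t) {g : A ⟶ A} (hg : g ≫ δ = δ) : g = 𝟙 A :=
  NatTrans.ext (funext fun G => AddCommGrpCat.hom_ext (AddMonoidHom.ext fun a =>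
    h.injective G (ConcreteCategory.congr_hom (NatTrans.congr_app hg G) a)))

/-- Uniqueness of kernels; this is how Ext and Tor functors get compared naturally. -/
lemma IsKernelMap.nonempty_iso (h : IsKernelMap δ t) {B₁ B₁' : J ⥤ AddCommGrpCat.{u}} {δ₁ : A' ⟶ B₁}
    {t₁ : B₁ ⟶ B₁'} (h₁ : IsKernelMap δ₁ t₁) (e : B ≅ B₁) (e' : B' ≅ B₁')
    (he : e.hom ≫ t₁ = t ≫ e'.hom) : Nonempty (A ≅ A') := by
  have he' : e.inv ≫ t = t₁ ≫ e'.inv := by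
    rw [Iso.inv_comp_eq, ← Category.assoc, he, Category.assoc, Iso.hom_inv_id, Category.comp_id]
  obtain ⟨g, hg⟩ := h₁.exists_lift (δ ≫ e.hom) fun G a => by
    refine (ConcreteCategory.congr_hom (NatTrans.congr_app he G) (δ.app G a)).trans ?_
    exact (congrArg (e'.hom.app G) (h.zero G a)).trans (map_zero (e'.hom.app G).hom)
  obtain ⟨g', hg'⟩ := h.exists_lift (δ₁ ≫ e.inv) fun G a => by
    refine (ConcreteCategory.congr_hom (NatTrans.congr_app he' G) (δ₁.app G a)).trans ?_
    exact (congrArg (e'.inv.app G) (h₁.zero G a)).trans (map_zero (e'.inv.app G).hom)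
  refine ⟨⟨g, g', h.eq_id ?_, h₁.eq_id ?_⟩⟩
  · rw [Category.assoc, hg', ← Category.assoc, hg, Category.assoc, Iso.hom_inv_id, Category.comp_id]
  · rw [Category.assoc, hg, ← Category.assoc, hg', Category.assoc, Iso.inv_hom_id, Category.comp_id]

lemma IsKernelMap.isIso (h : IsKernelMap δ t) (h0 : ∀ G, IsZero (B'.obj G)) : IsIso δ := by
  have : ∀ G, IsIso (δ.app G) := fun G => (ConcreteCategory.isIso_iff_bijective _).2
    ⟨h.injective G, fun b => h.exists_eq G b
      ((AddCommGrpCat.subsingleton_of_isZero (h0 G)).elim _ _)⟩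
  exact NatIso.isIso_of_isIso_app _

lemma IsKernelMap.whiskerLeft (h : IsKernelMap δ t) {J' : Type*} [Category* J'] (H : J' ⥤ J) :
    IsKernelMap (Functor.whiskerLeft H δ) (Functor.whiskerLeft H t) where
  injective G := h.injective (H.obj G)
  zero G := h.zero (H.obj G)
  exists_eq G := h.exists_eq (H.obj G)

lemma IsKernelMap.iso_comp (h : IsKernelMap δ t) (e : A' ≅ A) : IsKernelMap (e.hom ≫ δ) t where
  injective G := (h.injective G).comp
    ((ConcreteCategory.isIso_iff_bijective (e.hom.app G)).1 inferInstance).1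
  zero G a := h.zero G (e.hom.app G a)
  exists_eq G b hb := by
    obtain ⟨a, rfl⟩ := h.exists_eq G b hb
    obtain ⟨a, rfl⟩ := ((ConcreteCategory.isIso_iff_bijective (e.hom.app G)).1 inferInstance).2 a
    exact ⟨a, rfl⟩

end Kernel

/-! ### Dimension shifting for Ext -/

section ExtShift

variable {C : Type u} [SmallCategory C] (F : LMod C)

/-- The functor `Extⁱ(F, -)`. -/
abbrev extF (i : ℕ) : LMod C ⥤ AddCommGrpCat.{u} := (Abelian.extFunctor i).obj (op F)

instance (i : ℕ) : (extF F i).Additive := inferInstanceAs (Abelian.extFunctorObj F i).Additive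

/-- The morphism of short exact sequences induced by a morphism of modules. -/
def syzSeqMap {G G' : LMod C} (α : G ⟶ G') : syzSeq G ⟶ syzSeq G' where
  τ₁ := (syz C).map α
  τ₂ := (freeCover C).map α
  τ₃ := α
  comm₁₂ := (syzι C).naturality α
  comm₂₃ := (freeCoverπ C).naturality α

/-- The connecting homomorphism `Extⁱ(F, G) ⟶ Extⁱ⁺¹(F, ΩG)`. -/
def extδ (i : ℕ) : extF F i ⟶ syz C ⋙ extF F (i + 1) where
  app G := AddCommGrpCat.ofHom ((syzSeq_shortExact G).extClass.postcomp F rfl)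
  naturality G G' α := by
    refine AddCommGrpCat.hom_ext (AddMonoidHom.ext fun x => ?_)
    let x : Abelian.Ext F G i := x
    change (x.comp (Abelian.Ext.mk₀ α) (add_zero i)).comp (syzSeq_shortExact G').extClass rfl =
      (x.comp (syzSeq_shortExact G).extClass rfl).comp
        (Abelian.Ext.mk₀ ((syz C).map α)) (add_zero (i + 1))
    have h := ShortComplex.ShortExact.extClass_naturality (syzSeq_shortExact G)
      (syzSeq_shortExact G') (syzSeqMap α)
    refine (Abelian.Ext.comp_assoc x (Abelian.Ext.mk₀ α) (syzSeq_shortExact G').extClass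
      (add_zero i) (zero_add 1) (by lia)).trans ?_
    refine Eq.trans ?_ (Abelian.Ext.comp_assoc x (syzSeq_shortExact G).extClass
      (Abelian.Ext.mk₀ ((syz C).map α)) rfl (add_zero 1) (by lia)).symm
    exact congrArg (fun y => x.comp y rfl) h.symm

variable {F}

/-- In the long exact sequence, vanishing on the free cover makes the connecting map injective, and
its image is the kernel of the next map. -/
lemma isKernelMap_extδ {i : ℕ} (h : ∀ (G : LMod C) (x : Abelian.Ext F ((freeCover C).obj G) i), x = 0) :
    IsKernelMap (extδ F i) (Functor.whiskerRight (syzι C) (extF F (i + 1))) where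
  injective G := by
    refine (injective_iff_map_eq_zero _).2 fun x hx => ?_
    obtain ⟨y, hy⟩ := Abelian.Ext.covariant_sequence_exact₃ F (syzSeq_shortExact G)
      (x : Abelian.Ext F G i) rfl hx
    exact hy.symm.trans ((congrArg ((extF F i).map ((freeCoverπ C).app G)) (h G y)).trans
      (map_zero ((extF F i).map ((freeCoverπ C).app G)).hom))
  zero G x := by
    let x : Abelian.Ext F G i := x
    refine (Abelian.Ext.comp_assoc x (syzSeq_shortExact G).extClass
      (Abelian.Ext.mk₀ ((syzι C).app G)) rfl (add_zero 1) (by lia)).trans ?_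
    refine (congrArg (fun y => x.comp y rfl)
      (syzSeq_shortExact G).extClass_comp).trans ?_
    exact Abelian.Ext.comp_zero _ _ _ _ _
  exists_eq G b hb := Abelian.Ext.covariant_sequence_exact₁ F (syzSeq_shortExact G) b hb rfl

variable {n : ℕ} (hF : IsTypeFP F)
  (hv : ∀ i, i ≠ n → ∀ (y : C) (x : Abelian.Ext F ((stdProj C).obj (op y)) i), x = 0)

include hF hv

/-- A class factors through finitely many standard projectives, where Ext vanishes. -/
lemma ext_freeObj_eq_zero {i : ℕ} (hi : i ≠ n) {I : Type u} (x : I → C)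
    (a : Abelian.Ext F (freeObj x) i) : a = 0 := by
  obtain ⟨S, hS⟩ := hF.exists_ext_freeTrunc x a
  refine hS.symm.trans ((map_freeTrunc_apply (extF F i) x S a).trans ?_)
  refine Finset.sum_eq_zero fun s _ => ?_
  exact (congrArg ((extF F i).map (freeι x s)) (hv i hi _ _)).trans (map_zero _)

lemma ext_eq_zero_of_lt {i : ℕ} (hi : n < i) (G : LMod C) (a : Abelian.Ext F G i) : a = 0 := by
  obtain ⟨N, hN⟩ := hF.exists_ext_eq_zero
  -- Induction on the distance to the length of the resolution: Extⁱ(F, G) embeds in Extⁱ⁺¹ of the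
  -- syzygy.
  have key : ∀ m i, n < i → N < i + m → ∀ (G : LMod C) (a : Abelian.Ext F G i), a = 0 := by
    intro m
    induction m with
    | zero => exact fun i _ h => hN i h
    | succ m ih =>
      intro i hi h G a
      have h1 := (isKernelMap_extδ (F := F) (i := i) fun G x =>
        ext_freeObj_eq_zero hF hv hi.ne' (I := Σ x : C, G.obj x) Sigma.fst x).injective G
      refine h1 ((ih (i + 1) (by lia) (by lia) _ _).trans ?_)
      exact (map_zero ((extδ F i).app G).hom).symm
  exact key (N + 1) i hi (by lia) G a

/-- Extⁿ(F, -) sends free covers to surjections because Extⁿ⁺¹(F, -) vanishes; middle exactness is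
the long exact sequence. -/
lemma isIso_coendMap_extF : IsIso (coendMap (extF F n)) := by
  refine isIso_coendMap (fun x a => hF.exists_ext_freeTrunc x a) (fun G a => ?_) fun G a ha => ?_
  · exact Abelian.Ext.covariant_sequence_exact₃ F (syzSeq_shortExact G) a rfl
      (ext_eq_zero_of_lt hF hv (Nat.lt_succ_self n) _ _)
  · exact Abelian.Ext.covariant_sequence_exact₂ F (syzSeq_shortExact G) a ha

end ExtShift

end

end CatDuality

namespace CatDuality

noncomputable section

/-! ### The functorial resolution by free covers -/

section SyzResolution

variable {C : Type u} [SmallCategory C]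

variable (C) in
/-- The functorial syzygies of a module. -/
def syzPow : ℕ → LMod C ⥤ LMod C
  | 0 => 𝟭 _
  | k + 1 => syzPow k ⋙ syz C

variable (G : LMod C) (k : ℕ)

/-- The `k`-th syzygy. -/
abbrev syzObj : LMod C := (syzPow C k).obj G

/-- The free cover of the `k`-th syzygy. -/
def syzCover : LMod C := (freeCover C).obj (syzObj G k)

/-- The projection to the `k`-th syzygy. -/
def syzCoverπ : syzCover G k ⟶ syzObj G k := (freeCoverπ C).app (syzObj G k)

/-- The inclusion of the syzygy of order `k + 1`. -/
def syzCoverι : syzObj G (k + 1) ⟶ syzCover G k := (syzι C).app (syzObj G k)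

lemma syzCoverι_π : syzCoverι G k ≫ syzCoverπ G k = 0 := syzι_π (syzObj G k)

instance : Epi (syzCoverπ G k) := inferInstanceAs (Epi ((freeCoverπ C).app (syzObj G k)))

instance : Mono (syzCoverι G k) := inferInstanceAs (Mono ((syzι C).app (syzObj G k)))

instance : Projective (syzCover G k) :=
  inferInstanceAs (Projective ((freeCover C).obj (syzObj G k)))

lemma syzCover_shortExact : (ShortComplex.mk _ _ (syzCoverι_π G k)).ShortExact :=
  syzSeq_shortExact (syzObj G k)

/-- The differential of the resolution by free covers. -/
def syzD : syzCover G (k + 1) ⟶ syzCover G k := syzCoverπ G (k + 1) ≫ syzCoverι G k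

lemma syzD_π : syzD G k ≫ syzCoverπ G k = 0 := by
  rw [syzD, Category.assoc, syzCoverι_π, comp_zero]

lemma syzD_syzD : syzD G (k + 1) ≫ syzD G k = 0 := by
  rw [syzD.eq_def G k, ← Category.assoc, syzD_π, zero_comp]

/-- The functorial resolution by free covers. -/
def syzComplex : ChainComplex (LMod C) ℕ := ChainComplex.of (syzCover G) (syzD G) (syzD_syzD G)

lemma syzComplex_d : (syzComplex G).d (k + 1) k = syzD G k :=
  ChainComplex.of_d (syzCover G) (syzD G) k

lemma exists_syzD_eq {x : C} (b : (syzCover G k).obj x) (hb : (syzCoverπ G k).app x b = 0) :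
    ∃ a, (syzD G k).app x a = b := by
  obtain ⟨w, hw⟩ := LMod.exact_iff.1 (syzCover_shortExact G k).exact x b hb
  obtain ⟨v, hv⟩ := (LMod.epi_iff (syzCoverπ G (k + 1))).1 inferInstance x w
  exact ⟨v, (congrArg ((syzCoverι G k).app x) hv).trans hw⟩

/-- The functorial projective resolution by free covers. -/
def syzResolution : ProjectiveResolution G :=
  mkResolution (syzComplex G) (fun k => inferInstanceAs (Projective (syzCover G k)))
    (syzCoverπ G 0) ((congrArg (· ≫ syzCoverπ G 0) (syzComplex_d G 0)).trans (syzD_π G 0))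
    (inferInstanceAs (Epi (syzCoverπ G 0)))
    (LMod.exact_iff.2 fun x b hb => by
      obtain ⟨a, ha⟩ := exists_syzD_eq G 0 b hb
      exact ⟨a, (ConcreteCategory.congr_hom (NatTrans.congr_app (syzComplex_d G 0) x) a).trans ha⟩)
    (fun k => LMod.exact_iff.2 fun x b hb => by
      have hb' : (syzCoverι G k).app x ((syzCoverπ G (k + 1)).app x b) = 0 :=
        (ConcreteCategory.congr_hom (NatTrans.congr_app (syzComplex_d G k) x) b).symm.trans hb
      obtain ⟨a, ha⟩ := exists_syzD_eq G (k + 1) b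
        ((LMod.mono_iff (syzCoverι G k)).1 inferInstance x (hb'.trans (map_zero _).symm))
      exact ⟨a, (ConcreteCategory.congr_hom
        (NatTrans.congr_app (syzComplex_d G (k + 1)) x) a).trans ha⟩)

variable {G} {G' : LMod C} (α : G ⟶ G')

/-- The map of free covers of syzygies induced by a morphism. -/
def syzCoverMap : syzCover G k ⟶ syzCover G' k := (freeCover C).map ((syzPow C k).map α)

lemma syzCoverMap_π : syzCoverMap k α ≫ syzCoverπ G' k = syzCoverπ G k ≫ (syzPow C k).map α :=
  (freeCoverπ C).naturality ((syzPow C k).map α)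

lemma syzCoverι_map :
    (syzPow C (k + 1)).map α ≫ syzCoverι G' k = syzCoverι G k ≫ syzCoverMap k α :=
  (syzι C).naturality ((syzPow C k).map α)

lemma syzCoverMap_d : syzCoverMap (k + 1) α ≫ syzD G' k = syzD G k ≫ syzCoverMap k α := by
  rw [syzD, syzD, ← Category.assoc, syzCoverMap_π, Category.assoc, syzCoverι_map, Category.assoc]

/-- The map of resolutions by free covers induced by a morphism. -/
def syzComplexMap : syzComplex G ⟶ syzComplex G' :=
  ChainComplex.ofHom (fun k => syzCoverMap k α) fun k =>
    (congrArg (syzCoverMap (k + 1) α ≫ ·) (syzComplex_d G' k)).trans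
      ((syzCoverMap_d k α).trans (congrArg (· ≫ syzCoverMap k α) (syzComplex_d G k)).symm)

end SyzResolution

/-! ### Left derived functors as kernels on syzygies -/

section TorShift

variable {C : Type u} [SmallCategory C] (T : LMod C ⥤ AddCommGrpCat.{u}) [T.Additive]

/-- The value of `T` on the resolution by free covers. -/
def mapSyz (G : LMod C) : ChainComplex AddCommGrpCat.{u} ℕ :=
  (T.mapHomologicalComplex _).obj (syzComplex G)

lemma mapSyz_d (G : LMod C) (k : ℕ) : (mapSyz T G).d (k + 1) k = T.map (syzD G k) :=
  congrArg (fun g => T.map g) (syzComplex_d G k)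

/-- The map from the value of `T` on the free cover of a syzygy. -/
def mapSyzπ (G : LMod C) (k : ℕ) : (mapSyz T G).X k ⟶ T.obj (syzObj G k) :=
  T.map (syzCoverπ G k)

lemma mapSyz_d_π (G : LMod C) (k : ℕ) : (mapSyz T G).d (k + 1) k ≫ mapSyzπ T G k = 0 := by
  refine (congrArg (· ≫ mapSyzπ T G k) (mapSyz_d T G k)).trans ?_
  refine (T.map_comp _ _).symm.trans ?_
  rw [syzD_π, T.map_zero]
  rfl

/-- The map from opcycles to the value of `T` on a syzygy. -/
def opcyclesSyz (G : LMod C) (k : ℕ) : (mapSyz T G).opcycles k ⟶ T.obj (syzObj G k) :=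
  (mapSyz T G).descOpcycles (mapSyzπ T G k) (k + 1) (by simp) (mapSyz_d_π T G k)

lemma p_opcyclesSyz (G : LMod C) (k : ℕ) :
    (mapSyz T G).pOpcycles k ≫ opcyclesSyz T G k = mapSyzπ T G k :=
  (mapSyz T G).p_descOpcycles _ _ _ _

lemma opcyclesSyz_comp_ι (G : LMod C) (k : ℕ) :
    opcyclesSyz T G (k + 1) ≫ T.map (syzCoverι G k) =
      ((mapSyz T G).fromOpcycles (k + 1) k : _ ⟶ T.obj (syzCover G k)) := by
  refine (cancel_epi ((mapSyz T G).pOpcycles (k + 1))).1 ?_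
  refine (Category.assoc _ _ _).symm.trans ?_
  refine (congrArg (· ≫ T.map (syzCoverι G k)) (p_opcyclesSyz T G (k + 1))).trans ?_
  refine (T.map_comp _ _).symm.trans ((mapSyz_d T G k).symm.trans ?_)
  exact ((mapSyz T G).p_fromOpcycles (k + 1) k).symm

/-- The map of complexes induced by a morphism. -/
def mapSyzMap {G G' : LMod C} (α : G ⟶ G') : mapSyz T G ⟶ mapSyz T G' :=
  (T.mapHomologicalComplex _).map (syzComplexMap α)

lemma opcyclesSyz_naturality {G G' : LMod C} (α : G ⟶ G') (k : ℕ) :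
    HomologicalComplex.opcyclesMap (mapSyzMap T α) k ≫ opcyclesSyz T G' k =
      opcyclesSyz T G k ≫ T.map ((syzPow C k).map α) := by
  refine (cancel_epi ((mapSyz T G).pOpcycles k)).1 ?_
  rw [← Category.assoc, ← Category.assoc, HomologicalComplex.p_opcyclesMap, Category.assoc,
    p_opcyclesSyz, p_opcyclesSyz]
  refine (T.map_comp (syzCoverMap k α) (syzCoverπ G' k)).symm.trans ?_
  exact (congrArg (fun g => T.map g) (syzCoverMap_π k α)).trans (T.map_comp _ _)

/-- The map from homology to the value of `T` on a syzygy. -/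
def homologySyz (G : LMod C) (k : ℕ) : (mapSyz T G).homology k ⟶ T.obj (syzObj G k) :=
  (mapSyz T G).homologyι k ≫ opcyclesSyz T G k

lemma homologySyz_naturality {G G' : LMod C} (α : G ⟶ G') (k : ℕ) :
    HomologicalComplex.homologyMap (mapSyzMap T α) k ≫ homologySyz T G' k =
      homologySyz T G k ≫ T.map ((syzPow C k).map α) := by
  rw [homologySyz, homologySyz, ← Category.assoc, HomologicalComplex.homologyι_naturality,
    Category.assoc, Category.assoc, opcyclesSyz_naturality]

/-- The computation of left derived functors by free covers. -/
def leftDerivedSyz (G : LMod C) (k : ℕ) : (T.leftDerived k).obj G ≅ (mapSyz T G).homology k :=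
  (syzResolution G).isoLeftDerivedObj T k

lemma leftDerivedSyz_naturality {G G' : LMod C} (α : G ⟶ G') (k : ℕ) :
    (T.leftDerived k).map α ≫ (leftDerivedSyz T G' k).hom =
      (leftDerivedSyz T G k).hom ≫ HomologicalComplex.homologyMap (mapSyzMap T α) k :=
  ProjectiveResolution.isoLeftDerivedObj_hom_naturality α (syzResolution G)
    (syzResolution G') (syzComplexMap α) (syzCoverMap_π 0 α) T k

/-- The connecting morphism of the left derived functors. -/
def torδ (k : ℕ) : T.leftDerived (k + 1) ⟶ syzPow C k ⋙ syz C ⋙ T where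
  app G := (leftDerivedSyz T G (k + 1)).hom ≫ homologySyz T G (k + 1)
  naturality G G' α := by
    refine (Category.assoc _ _ _).symm.trans ?_
    refine (congrArg (· ≫ homologySyz T G' (k + 1))
      (leftDerivedSyz_naturality T α (k + 1))).trans ?_
    refine (Category.assoc _ _ _).trans (Eq.trans ?_ (Category.assoc _ _ _).symm)
    exact congrArg _ (homologySyz_naturality T α (k + 1))

/-- For T right exact, T(ΩᵏG) is the cokernel of the differential, that is, the opcycles. -/
lemma opcyclesSyz_injective [PreservesFiniteColimits T] (G : LMod C) (k : ℕ) :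
    Function.Injective (opcyclesSyz T G k) := by
  refine (injective_iff_map_eq_zero (opcyclesSyz T G k).hom).2 fun z hz => ?_
  obtain ⟨x, rfl⟩ := (AddCommGrpCat.epi_iff_surjective ((mapSyz T G).pOpcycles k)).1 inferInstance z
  have hx : T.map (syzCoverπ G k) x = 0 :=
    (ConcreteCategory.congr_hom (p_opcyclesSyz T G k) x).symm.trans hz
  have hS := (syzCover_shortExact G k).exact.map_of_epi_of_preservesCokernel T
    (syzCover_shortExact G k).epi_g inferInstance
  obtain ⟨w, hw⟩ := (ShortComplex.ab_exact_iff _).1 hS x hx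
  obtain ⟨v, hv⟩ := (AddCommGrpCat.epi_iff_surjective
    (T.map (syzCoverπ G (k + 1)))).1 inferInstance w
  have hd : (mapSyz T G).d (k + 1) k v = x := by
    refine (ConcreteCategory.congr_hom (mapSyz_d T G k) v).trans ?_
    refine (ConcreteCategory.congr_hom (T.map_comp _ _) v).trans ?_
    exact (congrArg (T.map (syzCoverι G k)) hv).trans hw
  rw [← hd]
  exact ConcreteCategory.congr_hom ((mapSyz T G).d_pOpcycles (k + 1) k) v

lemma opcyclesSyz_surjective [PreservesFiniteColimits T] (G : LMod C) (k : ℕ) :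
    Function.Surjective (opcyclesSyz T G k) := by
  intro w
  obtain ⟨v, hv⟩ := (AddCommGrpCat.epi_iff_surjective (T.map (syzCoverπ G k))).1 inferInstance w
  exact ⟨(mapSyz T G).pOpcycles k v, (ConcreteCategory.congr_hom (p_opcyclesSyz T G k) v).trans hv⟩

/-- Homology is the kernel of opcycles → chains one degree down; on syzygies this reads T(Ωᵏ⁺¹G) →
T(cover of ΩᵏG). -/
lemma isKernelMap_torδ [PreservesFiniteColimits T] (k : ℕ) :
    IsKernelMap (torδ T k)
      (Functor.whiskerLeft (syzPow C k) (Functor.whiskerRight (syzι C) T)) where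
  injective G := by
    refine (opcyclesSyz_injective T G (k + 1)).comp (Function.Injective.comp
      (g := (mapSyz T G).homologyι (k + 1)) ?_ ?_)
    · exact (AddCommGrpCat.mono_iff_injective _).1 inferInstance
    · exact (AddCommGrpCat.mono_iff_injective (leftDerivedSyz T G (k + 1)).hom).1 inferInstance
  zero G a := by
    refine (ConcreteCategory.congr_hom (opcyclesSyz_comp_ι T G k) _).trans ?_
    exact ConcreteCategory.congr_hom ((mapSyz T G).homologyι_comp_fromOpcycles (k + 1) k) _
  exists_eq G b hb := by
    obtain ⟨w, rfl⟩ := opcyclesSyz_surjective T G (k + 1) b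
    have hw : (mapSyz T G).fromOpcycles (k + 1) k w = 0 :=
      (ConcreteCategory.congr_hom (opcyclesSyz_comp_ι T G k) w).symm.trans hb
    have hS : (ShortComplex.mk _ _ ((mapSyz T G).homologyι_comp_fromOpcycles (k + 1) k)).Exact :=
      ShortComplex.exact_of_f_is_kernel _ ((mapSyz T G).homologyIsKernel (k + 1) k (by simp))
    obtain ⟨y, rfl⟩ := (ShortComplex.ab_exact_iff _).1 hS w hw
    obtain ⟨a, rfl⟩ := (AddCommGrpCat.epi_iff_surjective
      (leftDerivedSyz T G (k + 1)).hom).1 inferInstance y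
    exact ⟨a, rfl⟩

end TorShift

end

end CatDuality

namespace CatDuality

noncomputable section

/-! ### The duality criterion -/

section Criterion

variable {C : Type u} [SmallCategory C] {F : LMod C} {n : ℕ} (hF : IsTypeFP F)
  (hv : ∀ i, i ≠ n → ∀ (y : C) (x : Abelian.Ext F ((stdProj C).obj (op y)) i), x = 0)

include hF hv

lemma isKernelMap_extδ_of_ne {i : ℕ} (hi : i ≠ n) :
    IsKernelMap (extδ F i) (Functor.whiskerRight (syzι C) (extF F (i + 1))) :=
  isKernelMap_extδ fun G x =>
    ext_freeObj_eq_zero hF hv hi (I := Σ x : C, G.obj x) Sigma.fst x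

/-- Strictly below degree n the free covers contribute nothing on either side, so each connecting
map is an isomorphism. -/
lemma nonempty_syzPow_extF_iso (i : ℕ) :
    ∀ k, i + k < n → Nonempty (extF F i ≅ syzPow C k ⋙ extF F (i + k))
  | 0, _ => ⟨(Functor.leftUnitor (extF F i)).symm⟩
  | k + 1, hk => by
    obtain ⟨e⟩ := nonempty_syzPow_extF_iso i k (by lia)
    have : IsIso (extδ F (i + k)) := by
      refine (isKernelMap_extδ_of_ne hF hv (i := i + k) (by lia)).isIso fun G => ?_
      have : Subsingleton ((freeCover C ⋙ extF F (i + k + 1)).obj G) :=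
        ⟨fun a b => (ext_freeObj_eq_zero hF hv (by lia) (I := Σ x : C, G.obj x) Sigma.fst a).trans
          (ext_freeObj_eq_zero hF hv (by lia) (I := Σ x : C, G.obj x) Sigma.fst b).symm⟩
      exact AddCommGrpCat.isZero_of_subsingleton _
    exact ⟨e ≪≫ Functor.isoWhiskerLeft (syzPow C k) (asIso (extδ F (i + k)))⟩

/-- Shift to degree n - 1, where Ext becomes a kernel of a map of Extⁿ groups. Replacing Extⁿ(F, -)
by the tensor product gives the kernel that computes Tor. -/
lemma nonempty_extF_iso_leftDerived (i k : ℕ) (h : i + k + 1 = n) :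
    Nonempty (extF F i ≅ (tensorFunctor (dualModule F n)).leftDerived (k + 1)) := by
  subst h
  obtain ⟨e⟩ := nonempty_syzPow_extF_iso hF hv i k (by lia)
  have h1 := ((isKernelMap_extδ_of_ne hF hv (i := i + k) (by lia)).whiskerLeft
    (syzPow C k)).iso_comp e
  have h2 := isKernelMap_torδ (tensorFunctor (stdProj C ⋙ extF F (i + k + 1))) k
  have := isIso_coendMap_extF hF hv
  let θ := asIso (coendMap (extF F (i + k + 1)))
  obtain ⟨e'⟩ := h2.nonempty_iso h1
    (Functor.isoWhiskerLeft (syzPow C k) (Functor.isoWhiskerLeft (syz C) θ))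
    (Functor.isoWhiskerLeft (syzPow C k) (Functor.isoWhiskerLeft (freeCover C) θ))
    (NatTrans.ext (funext fun G => (θ.hom.naturality ((syzι C).app ((syzPow C k).obj G))).symm))
  exact ⟨e'.symm⟩

/-- Below n the two sides are the same kernel, at n this is Eilenberg–Watts, and above n both sides
vanish. -/
lemma isDualityFunctor_of_ext_eq_zero : IsDualityFunctor F n := by
  refine ⟨hF, fun i => ?_⟩
  rcases lt_trichotomy i n with hi | rfl | hi
  · obtain ⟨k, hk⟩ := Nat.exists_eq_add_of_lt hi
    have h : (n : ℤ) - (i : ℤ) = Int.ofNat (k + 1) := by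
      rw [Int.ofNat_eq_natCast]
      lia
    rw [h]
    exact nonempty_extF_iso_leftDerived hF hv i k hk.symm
  · have h : (i : ℤ) - (i : ℤ) = Int.ofNat 0 := sub_self _
    rw [h]
    have := isIso_coendMap_extF hF hv
    exact ⟨(asIso (coendMap (extF F i))).symm ≪≫
      (Functor.leftDerivedZeroIsoSelf (tensorFunctor (dualModule F i))).symm⟩
  · obtain ⟨k, hk⟩ := Nat.exists_eq_add_of_lt hi
    have h : (n : ℤ) - (i : ℤ) = Int.negSucc k := by
      rw [Int.negSucc_eq]
      lia
    rw [h]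
    refine ⟨IsZero.iso ?_ ?_⟩
    · refine (Functor.isZero_iff _).2 fun G => ?_
      have : Subsingleton ((extF F i).obj G) :=
        ⟨fun a b => (ext_eq_zero_of_lt hF hv hi G a).trans (ext_eq_zero_of_lt hF hv hi G b).symm⟩
      exact AddCommGrpCat.isZero_of_subsingleton _
    · refine (Functor.isZero_iff _).2 fun G => ?_
      exact AddCommGrpCat.isZero_of_subsingleton (AddCommGrpCat.of PUnit.{u + 1})

end Criterion

end

end CatDuality

theorem mainTheorem12 {C D : Type u} [CategoryTheory.SmallCategory C]
    [CategoryTheory.SmallCategory D] (φ : C ⥤ D) (n : ℕ)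
    (hC : CatDuality.IsDualityCategoryOfDim C n)
    (hφ : ∀ d : D, CatDuality.IsContractible (CostructuredArrow φ d))
    (hTor : ∀ (d : D) (i : ℕ), i ≠ n →
      IsZero ((CatDuality.Tor ((StructuredArrow.proj d φ).op ⋙ CatDuality.dualizingFunctor C n)
        ((n : ℤ) - (i : ℤ))).obj (CatDuality.constZ (StructuredArrow d φ)))) :
    CatDuality.IsDualityCategory D :=
  ⟨n, CatDuality.isDualityFunctor_of_ext_eq_zero (CatDuality.isTypeFP_ind φ hφ hC.1)
    fun i hi d x => CatDuality.ext_stdProj_eq_zero φ hC hφ (hTor d i hi) x⟩
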